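/- **Setting.** Let $n\ge 3$, $p+q=n$, let $M$ be a smooth $n$-manifold with a conformal structure $[g]$ of signature $(p,q)$, and let $\pi:\mathcal Q\to M$ be its ray bundle, $\mathcal Q=\{g_x: x\in M,\ g\in[g]\}\subset S^2T^*M$, with the $\mathbb R_+$-action $\rho^s(g_x)=s^2g_x$. Let $\tilde M$ be an ambient manifold, i.e. a smooth $(n+2)$-manifold with a smooth free $\mathbb R_+$-action $\rho$ and an $\mathbb R_+$-equivariant embedding $\mathcal Q\hookrightarrow\tilde M$ (we regard $\mathcal Q$ as a subset of $\tilde M$), and let $X$ be the vector field generating the action, $X(u)=\frac{d}{dt}|_{t=0}\rho^{e^t}(u)$. Let $\tilde h$ be an ambient metric, i.e. a pseudo-Riemannian metric on $\tilde M$ of signature $(p+1,q+1)$ with $(\rho^s)^*\tilde h=s^2\tilde h$ for all $s>0$ and $\tilde h(\xi,\eta)=g_x(T\pi\,\xi,T\pi\,\eta)$ for $\xi,\eta\in T_{g_x}\mathcal Q$. Put $\alpha=\tilde h(X,\cdot)$. For a covariant tensor $t$ on $\tilde M$, "$t|_{\mathcal Q}=0$" means that $t$ vanishes at all points of $\mathcal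 Q$ on all vectors tangent to $\tilde M$; "the tangential components of $t$ vanish along $\mathcal Q$" means that $t$ vanishes at all points of $\mathcal Q$ on vectors tangent to $\mathcal Q$. **Theorem.** (1) $\operatorname{Ric}(\tilde h)(X,X)|_{\mathcal Q}=0$ if and only if $i_Xd\alpha|_{\mathcal Q}=0$. If this is the case, then $r:=\tfrac12\tilde h(X,X)$ is a defining function for $\mathcal Q$: it is smooth on an open neighbourhood $U$ of $\mathcal Q$ with $r^{-1}(0)\cap U=\mathcal Q$, and $dr\ne0$ at every point of $\mathcal Q$. Moreover, for every smooth vector field $Y$ on an open subset of $\tilde M$ with $\tilde h(X,Y)=1$ one has $Y\cdot r=1+O(r)$, i.e. $Y\cdot r=1$ at all points of $\mathcal Q$ in that subset. (2) The tangential components of $\operatorname{Ric}(\tilde h)(X,\cdot)$ vanish along $\mathcal Q$ if and only if $d\alpha|_{\mathcal Q}=0$. If moreover the tangential components of $\operatorname{Ric}(\tilde h)$ vanish along $\mathcal Q$, then $\tilde h$ induces a normal standard tractor bundle for $[g]$, as follows. Let $\mathcal T=(T\tilde M|_{\mathcal Q})/\mathbb R_+$ for the action $s\cdot\xi=s^{-1}T\rho^s\xi$;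 this is a vector bundle over $M$ of rank $n+2$ whose smooth sections correspond to the smooth vector fields along $\mathcal Q$ that are homogeneous of degree $-1$. The metric $\tilde h$ descends to a bundle metric $h$ on $\mathcal T$, and $f\mapsto fX$ defines an inclusion $j:\mathcal E[-1]\to\mathcal T$, where sections of $\mathcal E[-1]$ are functions $f$ on $\mathcal Q$ with $f(\rho^s(u))=s^{-1}f(u)$. The Levi-Civita connection of $\tilde h$ descends to a linear connection $\nabla$ on $\mathcal T$: if a section $\sigma$ corresponds to the field $\tilde\sigma$ along $\mathcal Q$, then for every $w\in T\mathcal Q$ the derivative $\tilde\nabla_w\tilde\sigma$ is the value of the field corresponding to $\nabla_{T\pi\,w}\sigma$. Then: - $(\mathcal T,j,h,\nabla)$ is a standard tractor bundle for $[g]$: $h$ has signature $(p+1,q+1)$; $j$ is a smooth injective bundle map with null image $\mathcal T^1$; $\nabla h=0$; for every $0\ne\xi\in T_xM$ there is a smooth section $\sigma$ of $\mathcal T^1$ with $\nabla_\xi\sigma\notin\mathcal T^1_x$; and $h(\nabla_\xi(jf),\nabla_\eta(jf'))=f(u)f'(u)\,u(\xi,\eta)$ for all $u\in\mathcal Q_x$,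 $\xi,\eta\in T_xM$ and all smooth sections $f,f'$ of $\mathcal E[-1]$, i.e. under the isomorphism $TM[-1]\cong\mathcal T^0/\mathcal T^1$, $\mathcal T^0=(\mathcal T^1)^\perp$, induced by $\nabla$, the metric $h$ induces the given conformal structure. - $\nabla$ is normal: its curvature $R$ satisfies $R(\xi,\eta)\mathcal T^1\subset\mathcal T^1$, and the tensor $W\in\Gamma(\Lambda^2T^*M\otimes L(TM,TM))$ by which $R$ acts on $\mathcal T^0/\mathcal T^1\cong TM[-1]$ has vanishing Ricci-type contraction: the trace of $\xi\mapsto W(\xi,\eta)\zeta$ is zero for all $\eta,\zeta\in T_xM$. -/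

import Mathlib

open Bundle Manifold
open scoped ContDiff

noncomputable section

namespace AmbientTractor

/-! ### Pseudo-Riemannian metrics -/

/-- `h` is a smooth bundle metric of signature `(p, q)` on the vector bundle `V`. For `V = TM` this
is a pseudo-Riemannian metric on `M`. -/
structure IsPseudoMetric {EB : Type*} [NormedAddCommGroup EB] [NormedSpace ℝ EB]
    {HB : Type*} [TopologicalSpace HB] (IB : ModelWithCorners ℝ EB HB)
    {B : Type*} [TopologicalSpace B] [ChartedSpace HB B]
    (F : Type*) [NormedAddCommGroup F] [NormedSpace ℝ F]
    (V : B → Type*) [TopologicalSpace (TotalSpace F V)]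
    [∀ b, TopologicalSpace (V b)] [∀ b, AddCommGroup (V b)] [∀ b, Module ℝ (V b)]
    [∀ b, IsTopologicalAddGroup (V b)] [∀ b, ContinuousSMul ℝ (V b)]
    [FiberBundle F V] [VectorBundle ℝ F V]
    (p q : ℕ) (h : ∀ b, V b →L[ℝ] V b →L[ℝ] ℝ) : Prop where
  symm : ∀ b v w, h b v w = h b w v
  nondegenerate : ∀ b v, (∀ w, h b v w = 0) → v = 0
  sigPos_eq : ∀ b, sigPos (h b).toBilinForm.toQuadraticMap = p
  sigNeg_eq : ∀ b, sigNeg (h b).toBilinForm.toQuadraticMap = q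
  contMDiff : ContMDiff IB (IB.prod 𝓘(ℝ, F →L[ℝ] F →L[ℝ] ℝ)) ∞
    (fun b ↦ TotalSpace.mk' (F →L[ℝ] F →L[ℝ] ℝ) (E := fun b ↦ V b →L[ℝ] V b →L[ℝ] ℝ) b (h b))

/-! ### Local differential geometry of a metric, computed in charts

In Mathlib the tangent space at `u` is the model vector space, a vector being identified with its
coordinates in the preferred chart at `u`. Hence a tensor at `u` may be computed as the value at
the image of `u` of the coordinate expression in that chart. -/

section Coordinates

variable {m : ℕ} (G : EuclideanSpace ℝ (Fin m) →
  EuclideanSpace ℝ (Fin m) →L[ℝ] EuclideanSpace ℝ (Fin m) →L[ℝ] ℝ)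

/-- The Christoffel symbols `Γ_y(v, w)` of the Levi-Civita connection of a metric `G` given in
coordinates: `2 G(Γ(v, w), z) = (∂_v G)(w, z) + (∂_w G)(v, z) - (∂_z G)(v, w)`. -/
def christoffel (y v w : EuclideanSpace ℝ (Fin m)) : EuclideanSpace ℝ (Fin m) :=
  (1 / 2 : ℝ) • (G y).inverse
    (fderiv ℝ G y v w + fderiv ℝ G y w v - ((fderiv ℝ G y).flip v).flip w)

/-- The Riemann curvature `R(v, w) z` at `y` of a metric given in coordinates. -/
def coordRiemann (y v w z : EuclideanSpace ℝ (Fin m)) : EuclideanSpace ℝ (Fin m) :=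
  fderiv ℝ (fun y' ↦ christoffel G y' w z) y v - fderiv ℝ (fun y' ↦ christoffel G y' v z) y w +
    christoffel G y v (christoffel G y w z) - christoffel G y w (christoffel G y v z)

/-- The Ricci curvature `Ric(w, z) = trace (v ↦ R(v, w) z)` at `y` of a metric given in
coordinates. -/
def coordRicci (y w z : EuclideanSpace ℝ (Fin m)) : ℝ :=
  ∑ i : Fin m, coordRiemann G y (EuclideanSpace.single i 1) w z i

end Coordinates

section Local

variable {m : ℕ} {A : Type*} [TopologicalSpace A] [ChartedSpace (EuclideanSpace ℝ (Fin m)) A]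

/-- The derivative at `y` of the inverse of the preferred chart at `u`. -/
def chartFrame (u : A) (y : EuclideanSpace ℝ (Fin m)) :
    EuclideanSpace ℝ (Fin m) →L[ℝ] TangentSpace (𝓡 m) ((extChartAt (𝓡 m) u).symm y) :=
  mfderiv 𝓘(ℝ, EuclideanSpace ℝ (Fin m)) (𝓡 m) (extChartAt (𝓡 m) u).symm y

/-- The coordinate expression of a one-form `a` in the preferred chart at `u`. -/
def chartForm (a : ∀ u : A, TangentSpace (𝓡 m) u →L[ℝ] ℝ) (u : A)
    (y : EuclideanSpace ℝ (Fin m)) : EuclideanSpace ℝ (Fin m) →L[ℝ] ℝ :=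
  (a ((extChartAt (𝓡 m) u).symm y)).comp (chartFrame u y)

/-- The exterior derivative of a one-form,
`da(ξ, η) = ξ · a(η) - η · a(ξ) - a([ξ, η])`. -/
def extDerivForm (a : ∀ u : A, TangentSpace (𝓡 m) u →L[ℝ] ℝ) (u : A)
    (v w : TangentSpace (𝓡 m) u) : ℝ :=
  fderiv ℝ (chartForm a u) (extChartAt (𝓡 m) u u) v w -
    fderiv ℝ (chartForm a u) (extChartAt (𝓡 m) u u) w v

variable (h : ∀ u : A, TangentSpace (𝓡 m) u →L[ℝ] TangentSpace (𝓡 m) u →L[ℝ] ℝ)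

/-- The coordinate expression `h_{ij}` of a metric in the preferred chart at `u`. -/
def chartMetric (u : A) (y : EuclideanSpace ℝ (Fin m)) :
    EuclideanSpace ℝ (Fin m) →L[ℝ] EuclideanSpace ℝ (Fin m) →L[ℝ] ℝ :=
  ContinuousLinearMap.bilinearComp (E := EuclideanSpace ℝ (Fin m))
    (F := EuclideanSpace ℝ (Fin m)) (h ((extChartAt (𝓡 m) u).symm y))
    (chartFrame u y) (chartFrame u y)

/-- The Ricci curvature `Ric(w, z)` of the metric `h` at `u`. -/
def ricci (u : A) (w z : TangentSpace (𝓡 m) u) : ℝ :=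
  coordRicci (chartMetric h u) (extChartAt (𝓡 m) u u) w z

/-- The Levi-Civita covariant derivative in the direction `w` of a vector field `σ` along a map
`N → A` (the map being `z ↦ (σ z).proj`). In the chart at the image of `z` it is
`∂_w σ + Γ(w, σ)`. It agrees with `∇_w` of any extension of `σ` to a vector field on `A`. -/
def covDerivAlong {EN : Type*} [NormedAddCommGroup EN] [NormedSpace ℝ EN]
    {HN : Type*} [TopologicalSpace HN] (IN : ModelWithCorners ℝ EN HN)
    {N : Type*} [TopologicalSpace N] [ChartedSpace HN N] [IsManifold (𝓡 m) ∞ A]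
    (σ : N → TangentBundle (𝓡 m) A) (z : N) (w : TangentSpace IN z) :
    TangentSpace (𝓡 m) (σ z).proj :=
  let u : A := (σ z).proj
  let coord : N → EuclideanSpace ℝ (Fin m) := fun y ↦
    (trivializationAt (EuclideanSpace ℝ (Fin m)) (TangentSpace (𝓡 m)) u (σ y)).2
  let dcoord : EuclideanSpace ℝ (Fin m) := mfderiv IN 𝓘(ℝ, EuclideanSpace ℝ (Fin m)) coord z w
  dcoord + christoffel (chartMetric h u) (extChartAt (𝓡 m) u u)
      (mfderiv IN (𝓡 m) (fun y ↦ (σ y).proj) z w) (σ z).2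

end Local

/-! ### Conformal structures -/

/-- The multiplicative group `ℝ₊` of positive real numbers. -/
abbrev PosReal : Type := {s : ℝ // 0 < s}

/-- The exponential isomorphism `ℝ → ℝ₊`. -/
def expPos (t : ℝ) : PosReal := ⟨Real.exp t, Real.exp_pos t⟩

/-- A conformal structure of signature `(p, q)`: an equivalence class of pseudo-Riemannian metrics
under multiplication by positive smooth functions. -/
structure ConformalStructure (n p q : ℕ) (M : Type*) [TopologicalSpace M]
    [ChartedSpace (EuclideanSpace ℝ (Fin n)) M] [IsManifold (𝓡 n) ∞ M] where
  metrics : Set (∀ x : M, TangentSpace (𝓡 n) x →L[ℝ] TangentSpace (𝓡 n) x →L[ℝ] ℝ)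
  nonempty : metrics.Nonempty
  isPseudoMetric : ∀ g ∈ metrics, IsPseudoMetric (𝓡 n) (EuclideanSpace ℝ (Fin n))
    (TangentSpace (𝓡 n) : M → Type _) p q g
  mem_iff : ∀ g ∈ metrics, ∀ g', g' ∈ metrics ↔
    ∃ f : M → ℝ, ContMDiff (𝓡 n) 𝓘(ℝ, ℝ) ∞ f ∧ (∀ x, 0 < f x) ∧ ∀ x, g' x = f x • g x

namespace ConformalStructure

variable {n p q : ℕ} {M : Type*} [TopologicalSpace M]
    [ChartedSpace (EuclideanSpace ℝ (Fin n)) M] [IsManifold (𝓡 n) ∞ M]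
    (c : ConformalStructure n p q M)

/-- The ray bundle `𝒬 ⊂ S²T*M` of a conformal structure: pairs `(x, g_x)` with `g` a metric in the
conformal class. -/
@[ext] structure RayBundle where
  base : M
  form : TangentSpace (𝓡 n) base →L[ℝ] TangentSpace (𝓡 n) base →L[ℝ] ℝ
  mem : ∃ g ∈ c.metrics, g base = form

variable {c} in
/-- The value of a metric of the conformal class at `x`. -/
def value {g : ∀ x : M, TangentSpace (𝓡 n) x →L[ℝ] TangentSpace (𝓡 n) x →L[ℝ] ℝ}
    (hg : g ∈ c.metrics) (x : M) : c.RayBundle := ⟨x, g x, g, hg, rfl⟩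

variable {c} in
/-- The principal action `ρ^s(g_x) = s² g_x` of `ℝ₊` on `𝒬`. -/
def dilate (s : PosReal) (b : c.RayBundle) : c.RayBundle where
  base := b.base
  form := (s : ℝ) ^ 2 • b.form
  mem := by
    obtain ⟨g, hg, hb⟩ := b.mem
    refine ⟨fun x ↦ (s : ℝ) ^ 2 • g x, (c.mem_iff g hg _).2
      ⟨fun _ ↦ (s : ℝ) ^ 2, contMDiff_const, fun _ ↦ pow_pos s.2 2, fun _ ↦ rfl⟩, ?_⟩
    simp only [hb]

variable {c} in
/-- The global trivialization `M × ℝ ≃ 𝒬`, `(x, t) ↦ ρ^{exp t}(g_x) = e^{2t} g_x`, given by a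
metric of the conformal class. The smooth structure of `𝒬` is the one for which these bijections
are diffeomorphisms. -/
def triv {g : ∀ x : M, TangentSpace (𝓡 n) x →L[ℝ] TangentSpace (𝓡 n) x →L[ℝ] ℝ}
    (hg : g ∈ c.metrics) (z : M × ℝ) : c.RayBundle := dilate (expPos z.2) (value hg z.1)

/-- The fibre at `x` of the density bundle `ℰ[w]`: functions `φ` on the fibre `𝒬_x` with
`φ(ρ^s(b)) = s^w φ(b)`. -/
def density (w : ℝ) (x : M) : Submodule ℝ ({b : c.RayBundle // b.base = x} → ℝ) where
  carrier := {φ | ∀ (s : PosReal) (b : {b : c.RayBundle // b.base = x}),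
    φ ⟨dilate s b.1, b.2⟩ = (s : ℝ) ^ w * φ b}
  add_mem' := by
    intro φ ψ hφ hψ s b
    simp only [Pi.add_apply, hφ s b, hψ s b, mul_add]
  zero_mem' := by
    intro s b
    simp
  smul_mem' := by
    intro r φ hφ s b
    simp only [Pi.smul_apply, hφ s b, smul_eq_mul]
    ring

variable {c} in
/-- The homogeneous function on `𝒬` corresponding to a section of `ℰ[w]`. -/
def densityFun {w : ℝ} (f : ∀ x, c.density w x) (b : c.RayBundle) : ℝ :=
  (f b.base).1 ⟨b, rfl⟩

variable {c} in
/-- A section of `ℰ[w]` is smooth if the corresponding function on `𝒬` is smooth. -/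
def IsSmoothDensity {w : ℝ} (f : ∀ x, c.density w x) : Prop :=
  ∀ g, ∀ hg : g ∈ c.metrics,
    ContMDiff ((𝓡 n).prod 𝓘(ℝ, ℝ)) 𝓘(ℝ, ℝ) ∞ (fun z ↦ densityFun f (triv hg z))

end ConformalStructure

/-! ### Standard tractor bundles -/

section Tractor

variable {n p q : ℕ} {M : Type*} [TopologicalSpace M]
    [ChartedSpace (EuclideanSpace ℝ (Fin n)) M] [IsManifold (𝓡 n) ∞ M]
    (c : ConformalStructure n p q M)
    {V : M → Type*} [TopologicalSpace (TotalSpace (EuclideanSpace ℝ (Fin (n + 2))) V)]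
    [∀ x, TopologicalSpace (V x)] [∀ x, AddCommGroup (V x)] [∀ x, Module ℝ (V x)]
    [∀ x, IsTopologicalAddGroup (V x)] [∀ x, ContinuousSMul ℝ (V x)]
    [FiberBundle (EuclideanSpace ℝ (Fin (n + 2))) V]
    [VectorBundle ℝ (EuclideanSpace ℝ (Fin (n + 2))) V]

/-- Smoothness of a section of a vector bundle of rank `n + 2`. -/
def IsSmoothSection (n : ℕ) {M : Type*} [TopologicalSpace M]
    [ChartedSpace (EuclideanSpace ℝ (Fin n)) M]
    {V : M → Type*} [TopologicalSpace (TotalSpace (EuclideanSpace ℝ (Fin (n + 2))) V)]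
    [∀ x, TopologicalSpace (V x)]
    [FiberBundle (EuclideanSpace ℝ (Fin (n + 2))) V] (σ : ∀ x, V x) : Prop :=
  ContMDiff (𝓡 n) ((𝓡 n).prod 𝓘(ℝ, EuclideanSpace ℝ (Fin (n + 2)))) ∞
    (fun x ↦ TotalSpace.mk' (EuclideanSpace ℝ (Fin (n + 2))) x (σ x))

/-- Smoothness of a vector field on `M`. -/
def IsSmoothField {n : ℕ} {M : Type*} [TopologicalSpace M]
    [ChartedSpace (EuclideanSpace ℝ (Fin n)) M] [IsManifold (𝓡 n) ∞ M]
    (ξ : ∀ x : M, TangentSpace (𝓡 n) x) : Prop :=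
  ContMDiff (𝓡 n) (𝓡 n).tangent ∞ (fun x ↦ (⟨x, ξ x⟩ : TangentBundle (𝓡 n) M))

/-- `(V, j, h, ∇)` is a conformal standard tractor bundle with tractor connection for the conformal
structure `c`. Here `V` is a vector bundle of rank `n + 2`, `j : ℰ[-1] → V` has image `V¹`, `h` is
the tractor metric, and `∇_v σ (x)` is written `cov σ x v`. -/
structure IsStandardTractorBundle (j : ∀ x, c.density (-1) x →ₗ[ℝ] V x)
    (h : ∀ x, V x →L[ℝ] V x →L[ℝ] ℝ)
    (cov : CovariantDerivative (𝓡 n) (EuclideanSpace ℝ (Fin (n + 2))) V) : Prop where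
  isPseudoMetric : IsPseudoMetric (𝓡 n) (EuclideanSpace ℝ (Fin (n + 2))) V (p + 1) (q + 1) h
  smooth_inclusion : ∀ f : ∀ x, c.density (-1) x, c.IsSmoothDensity f →
    IsSmoothSection n (fun x ↦ j x (f x))
  injective : ∀ x, Function.Injective (j x)
  null : ∀ x φ ψ, h x (j x φ) (j x ψ) = 0
  smooth_connection : CovariantDerivative.ContMDiffCovariantDerivative cov ∞
  metric_connection : ∀ σ τ : ∀ x, V x, IsSmoothSection n σ → IsSmoothSection n τ →
    ∀ (x : M) (v : TangentSpace (𝓡 n) x),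
      (mfderiv (𝓡 n) 𝓘(ℝ, ℝ) (fun y ↦ h y (σ y) (τ y)) x v : ℝ) =
        h x (cov σ x v) (τ x) + h x (σ x) (cov τ x v)
  nondegenerate : ∀ (x : M) (v : TangentSpace (𝓡 n) x), v ≠ 0 →
    ∃ f : ∀ x, c.density (-1) x, c.IsSmoothDensity f ∧
      cov (fun y ↦ j y (f y)) x v ∉ LinearMap.range (j x)
  /-- The map `(ξ, f) ↦ ∇_ξ (j f)` induces `TM[-1] ≅ V⁰ / V¹`, and the metric which `h` induces on
  the quotient is the conformal structure `c`, viewed as the tautological section of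
  `S²T*M[2]`. -/
  conformal : ∀ f f' : ∀ x, c.density (-1) x, c.IsSmoothDensity f → c.IsSmoothDensity f' →
    ∀ (b : c.RayBundle) (v w : TangentSpace (𝓡 n) b.base),
      h b.base (cov (fun y ↦ j y (f y)) b.base v) (cov (fun y ↦ j y (f' y)) b.base w) =
        ConformalStructure.densityFun f b * ConformalStructure.densityFun f' b * b.form v w

/-- The curvature `R(ξ, η) σ` of a linear connection. -/
def curvature (cov : CovariantDerivative (𝓡 n) (EuclideanSpace ℝ (Fin (n + 2))) V)
    (ξ η : ∀ x : M, TangentSpace (𝓡 n) x) (σ : ∀ x, V x) (x : M) : V x :=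
  cov (fun y ↦ cov σ y (η y)) x (ξ x) - cov (fun y ↦ cov σ y (ξ y)) x (η x) -
    cov σ x (VectorField.mlieBracket (𝓡 n) ξ η x)

/-- The normalisation condition on a tractor connection: its curvature preserves `V¹`, and the
tensor `W ∈ Λ²T*M ⊗ L(TM, TM)` by which the curvature acts on `V⁰ / V¹ ≅ TM[-1]` has vanishing
Ricci-type contraction. (The class of `∇_ζ (j f)` in `V⁰ / V¹` corresponds to `ζ ⊗ f`, so
`W` is the tensor for which `R(ξ, η) ∇_ζ (j f)` equals `∇_{W(ξ, η) ζ} (j f)` modulo `V¹`.) -/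
structure IsNormal (j : ∀ x, c.density (-1) x →ₗ[ℝ] V x)
    (cov : CovariantDerivative (𝓡 n) (EuclideanSpace ℝ (Fin (n + 2))) V) : Prop where
  torsion_free : ∀ ξ η : ∀ x : M, TangentSpace (𝓡 n) x, IsSmoothField ξ → IsSmoothField η →
    ∀ f : ∀ x, c.density (-1) x, c.IsSmoothDensity f →
    ∀ x, curvature cov ξ η (fun y ↦ j y (f y)) x ∈ LinearMap.range (j x)
  ricci_zero : ∀ x : M, ∃ W : TangentSpace (𝓡 n) x →ₗ[ℝ] TangentSpace (𝓡 n) x →ₗ[ℝ]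
      TangentSpace (𝓡 n) x →ₗ[ℝ] TangentSpace (𝓡 n) x,
    (∀ ξ η ζ : ∀ x : M, TangentSpace (𝓡 n) x,
      IsSmoothField ξ → IsSmoothField η → IsSmoothField ζ →
      ∀ f : ∀ x, c.density (-1) x, c.IsSmoothDensity f →
      curvature cov ξ η (fun y ↦ cov (fun y ↦ j y (f y)) y (ζ y)) x -
        cov (fun y ↦ j y (f y)) x (W (ξ x) (η x) (ζ x)) ∈ LinearMap.range (j x)) ∧
    ∀ v w : TangentSpace (𝓡 n) x,
      LinearMap.trace ℝ (TangentSpace (𝓡 n) x) ((W.flip v).flip w) = 0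

end Tractor

/-! ### Ambient manifolds and ambient metrics -/

section Ambient

/-- The fundamental vector field `X(u) = d/dt|₀ ρ^{exp t}(u)` of an `ℝ₊`-action. -/
def generator {m : ℕ} {A : Type*} [TopologicalSpace A]
    [ChartedSpace (EuclideanSpace ℝ (Fin m)) A] [MulAction PosReal A] (u : A) :
    TangentSpace (𝓡 m) u :=
  (mfderiv 𝓘(ℝ, ℝ) (𝓡 m) (fun t : ℝ ↦ expPos t • u) 0 (1 : ℝ) : EuclideanSpace ℝ (Fin m))

variable {n p q : ℕ} {M : Type*} [TopologicalSpace M]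
    [ChartedSpace (EuclideanSpace ℝ (Fin n)) M] [IsManifold (𝓡 n) ∞ M]
    {c : ConformalStructure n p q M}
    {A : Type*} [TopologicalSpace A] [ChartedSpace (EuclideanSpace ℝ (Fin (n + 2))) A]
    [MulAction PosReal A]

/-- `ι : 𝒬 → A` makes the manifold `A` of dimension `n + 2` with its `ℝ₊`-action an ambient
manifold: the action is smooth and free and `ι` is an equivariant smooth embedding. -/
structure IsAmbientManifold (ι : c.RayBundle → A) : Prop where
  smooth_action : ContMDiff (𝓘(ℝ, ℝ).prod (𝓡 (n + 2))) (𝓡 (n + 2)) ∞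
    (fun z : ℝ × A ↦ expPos z.1 • z.2)
  free : ∀ (s : PosReal) (u : A), s • u = u → s = 1
  equivariant : ∀ (s : PosReal) (b : c.RayBundle), ι (ConformalStructure.dilate s b) = s • ι b
  embedding : ∀ g, ∀ hg : g ∈ c.metrics,
    IsSmoothEmbedding ((𝓡 n).prod 𝓘(ℝ, ℝ)) (𝓡 (n + 2)) ∞
      (fun z : M × ℝ ↦ ι (ConformalStructure.triv hg z))

/-- The tangent bundle `T𝒬` as a subset of `TA`. -/
def tangentQ (ι : c.RayBundle → A) : Set (TangentBundle (𝓡 (n + 2)) A) :=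
  {ζ | ∃ g, ∃ hg : g ∈ c.metrics, ζ ∈ Set.range (tangentMap ((𝓡 n).prod 𝓘(ℝ, ℝ)) (𝓡 (n + 2))
    (fun z : M × ℝ ↦ ι (ConformalStructure.triv hg z)))}

/-- `h` is an ambient metric: a pseudo-Riemannian metric of signature `(p + 1, q + 1)` which is
homogeneous of degree two, `(ρ^s)^* h = s² h`, and satisfies `h(ξ, η) = g_x(Tπ ξ, Tπ η)` for
`ξ, η ∈ T𝒬` at the point `g_x`. -/
structure IsAmbientMetric [IsManifold (𝓡 (n + 2)) ∞ A] (ι : c.RayBundle → A)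
    (h : ∀ u : A, TangentSpace (𝓡 (n + 2)) u →L[ℝ] TangentSpace (𝓡 (n + 2)) u →L[ℝ] ℝ) :
    Prop where
  isPseudoMetric : IsPseudoMetric (𝓡 (n + 2)) (EuclideanSpace ℝ (Fin (n + 2)))
    (TangentSpace (𝓡 (n + 2)) : A → Type _) (p + 1) (q + 1) h
  homogeneous : ∀ (s : PosReal) (u : A) (v w : TangentSpace (𝓡 (n + 2)) u),
    h (s • u) (mfderiv (𝓡 (n + 2)) (𝓡 (n + 2)) (fun u' : A ↦ s • u') u v)
      (mfderiv (𝓡 (n + 2)) (𝓡 (n + 2)) (fun u' : A ↦ s • u') u w) = (s : ℝ) ^ 2 * h u v w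
  tautological : ∀ g, ∀ hg : g ∈ c.metrics, ∀ (z : M × ℝ)
    (v w : TangentSpace ((𝓡 n).prod 𝓘(ℝ, ℝ)) z),
    h (ι (ConformalStructure.triv hg z))
      (mfderiv ((𝓡 n).prod 𝓘(ℝ, ℝ)) (𝓡 (n + 2))
        (fun z : M × ℝ ↦ ι (ConformalStructure.triv hg z)) z v)
      (mfderiv ((𝓡 n).prod 𝓘(ℝ, ℝ)) (𝓡 (n + 2))
        (fun z : M × ℝ ↦ ι (ConformalStructure.triv hg z)) z w) =
    (ConformalStructure.triv hg z).form
      (mfderiv ((𝓡 n).prod 𝓘(ℝ, ℝ)) (𝓡 n) Prod.fst z v)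
      (mfderiv ((𝓡 n).prod 𝓘(ℝ, ℝ)) (𝓡 n) Prod.fst z w)

/-- The one-form `α = h(X, ·)` dual to the generator `X`. -/
def dualForm (h : ∀ u : A, TangentSpace (𝓡 (n + 2)) u →L[ℝ] TangentSpace (𝓡 (n + 2)) u →L[ℝ] ℝ)
    (u : A) : TangentSpace (𝓡 (n + 2)) u →L[ℝ] ℝ := h u (generator u)

/-- `r` is a defining function for the image `S` of `𝒬`: on some open neighbourhood `U` of `S` it is
smooth with zero set `S`, and `dr` vanishes at no point of `S`. -/
def IsDefiningFunction (S : Set A) (r : A → ℝ) : Prop :=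
  ∃ U : Set A, IsOpen U ∧ S ⊆ U ∧ ContMDiffOn (𝓡 (n + 2)) 𝓘(ℝ, ℝ) ∞ r U ∧
    (∀ u ∈ U, r u = 0 ↔ u ∈ S) ∧ ∀ u ∈ S, mfderiv (𝓡 (n + 2)) 𝓘(ℝ, ℝ) r u ≠ 0

/-! ### The tractor bundle of an ambient metric -/

/-- The action `s · ξ = s⁻¹ Tρ^s ξ` of `ℝ₊` on `TA`. -/
def tractorAction (s : PosReal) (ζ : TangentBundle (𝓡 (n + 2)) A) :
    TangentBundle (𝓡 (n + 2)) A :=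
  ⟨s • ζ.proj, (s : ℝ)⁻¹ •
    mfderiv (𝓡 (n + 2)) (𝓡 (n + 2)) (fun u : A ↦ s • u) ζ.proj ζ.2⟩

/-- The smooth map `x ↦ g_x ∈ 𝒬 ⊂ A` given by a metric in the conformal class. It meets every
`ℝ₊`-orbit in `𝒬` exactly once. -/
def slice {ι : c.RayBundle → A} (hA : IsAmbientManifold ι)
    {g : ∀ x : M, TangentSpace (𝓡 n) x →L[ℝ] TangentSpace (𝓡 n) x →L[ℝ] ℝ}
    (hg : g ∈ c.metrics) : ContMDiffMap (𝓡 n) (𝓡 (n + 2)) M A ∞ where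
  val x := ι (ConformalStructure.value hg x)
  property := by
    have h1 := (hA.embedding g hg).contMDiff
    have h2 : ContMDiff (𝓡 n) ((𝓡 n).prod 𝓘(ℝ, ℝ)) ∞ (fun x : M ↦ (x, (0 : ℝ))) :=
      contMDiff_id.prodMk contMDiff_const
    have h3 := h1.comp h2
    convert h3 using 1
    funext x
    have h5 : (expPos 0 : ℝ) ^ 2 • g x = g x := by
      rw [show (expPos 0 : ℝ) ^ 2 = 1 by simp [expPos]]
      exact one_smul ℝ (g x)
    have h4 : ConformalStructure.triv hg (x, (0 : ℝ)) = ConformalStructure.value hg x :=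
      ConformalStructure.RayBundle.ext rfl h5
    simp [h4]

/-- The fibre of the tractor bundle `𝒯 = (TA|_𝒬) / ℝ₊` at `x`. As every orbit in `TA|_𝒬` over `x`
contains precisely one element of `T_u A`, where `u` is the point at which the slice `f : M → A`
meets the orbit `𝒬_x`, the fibre is realized as `T_{f(x)} A`. -/
def Tractor (f : ContMDiffMap (𝓡 n) (𝓡 (n + 2)) M A ∞) (x : M) : Type :=
  TangentSpace (𝓡 (n + 2)) (f x)

section Instances

variable (f : ContMDiffMap (𝓡 n) (𝓡 (n + 2)) M A ∞)

instance (x : M) : TopologicalSpace (Tractor f x) :=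
  inferInstanceAs (TopologicalSpace (TangentSpace (𝓡 (n + 2)) (f x)))

instance (x : M) : AddCommGroup (Tractor f x) :=
  inferInstanceAs (AddCommGroup (TangentSpace (𝓡 (n + 2)) (f x)))

instance (x : M) : Module ℝ (Tractor f x) :=
  inferInstanceAs (Module ℝ (TangentSpace (𝓡 (n + 2)) (f x)))

instance (x : M) : IsTopologicalAddGroup (Tractor f x) :=
  inferInstanceAs (IsTopologicalAddGroup (TangentSpace (𝓡 (n + 2)) (f x)))

instance (x : M) : ContinuousSMul ℝ (Tractor f x) :=
  inferInstanceAs (ContinuousSMul ℝ (TangentSpace (𝓡 (n + 2)) (f x)))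

variable [IsManifold (𝓡 (n + 2)) ∞ A]

instance : TopologicalSpace (TotalSpace (EuclideanSpace ℝ (Fin (n + 2))) (Tractor f)) :=
  inferInstanceAs (TopologicalSpace (TotalSpace (EuclideanSpace ℝ (Fin (n + 2)))
    (f *ᵖ (TangentSpace (𝓡 (n + 2)) : A → Type _))))

instance : FiberBundle (EuclideanSpace ℝ (Fin (n + 2))) (Tractor f) :=
  inferInstanceAs (FiberBundle (EuclideanSpace ℝ (Fin (n + 2)))
    (f *ᵖ (TangentSpace (𝓡 (n + 2)) : A → Type _)))

instance : VectorBundle ℝ (EuclideanSpace ℝ (Fin (n + 2))) (Tractor f) :=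
  inferInstanceAs (VectorBundle ℝ (EuclideanSpace ℝ (Fin (n + 2)))
    (f *ᵖ (TangentSpace (𝓡 (n + 2)) : A → Type _)))

instance : ContMDiffVectorBundle ∞ (EuclideanSpace ℝ (Fin (n + 2))) (Tractor f) (𝓡 n) :=
  inferInstanceAs (ContMDiffVectorBundle ∞ (EuclideanSpace ℝ (Fin (n + 2)))
    (f *ᵖ (TangentSpace (𝓡 (n + 2)) : A → Type _)) (𝓡 n))

end Instances

/-- The vector field along `𝒬`, homogeneous of degree `-1`, corresponding to a section `σ` of `𝒯`.
Here `𝒬` is identified with `M × ℝ` by the slice `f`. -/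
def homogeneousLift {f : ContMDiffMap (𝓡 n) (𝓡 (n + 2)) M A ∞} (σ : ∀ x, Tractor f x)
    (z : M × ℝ) : TangentBundle (𝓡 (n + 2)) A :=
  tractorAction (expPos z.2) ⟨f z.1, σ z.1⟩

/-- The tractor metric induced by `h`. -/
def tractorMetric
    (h : ∀ u : A, TangentSpace (𝓡 (n + 2)) u →L[ℝ] TangentSpace (𝓡 (n + 2)) u →L[ℝ] ℝ)
    (f : ContMDiffMap (𝓡 n) (𝓡 (n + 2)) M A ∞) (x : M) :
    Tractor f x →L[ℝ] Tractor f x →L[ℝ] ℝ := h (f x)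

/-- The inclusion `ℰ[-1] → 𝒯`, `φ ↦ φ X`. -/
def tractorInclusion {ι : c.RayBundle → A} (hA : IsAmbientManifold ι)
    {g : ∀ x : M, TangentSpace (𝓡 n) x →L[ℝ] TangentSpace (𝓡 n) x →L[ℝ] ℝ}
    (hg : g ∈ c.metrics) (x : M) : c.density (-1) x →ₗ[ℝ] Tractor (slice hA hg) x where
  toFun φ := (φ.1 ⟨ConformalStructure.value hg x, rfl⟩ •
    (generator (slice hA hg x) : TangentSpace (𝓡 (n + 2)) (slice hA hg x)) :
      TangentSpace (𝓡 (n + 2)) (slice hA hg x))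
  map_add' _ _ := add_smul _ _ _
  map_smul' _ _ := mul_smul _ _ _

/-- The bundle `𝒯` with its metric and the inclusion of `ℰ[-1]` is the quotient of `TA|_𝒬` by the
action `s · ξ = s⁻¹ Tρ^s ξ`, with the structure induced by `h` and `X`. -/
structure IsQuotientBundle [IsManifold (𝓡 (n + 2)) ∞ A] {ι : c.RayBundle → A}
    (hA : IsAmbientManifold ι)
    (h : ∀ u : A, TangentSpace (𝓡 (n + 2)) u →L[ℝ] TangentSpace (𝓡 (n + 2)) u →L[ℝ] ℝ)
    {g : ∀ x : M, TangentSpace (𝓡 n) x →L[ℝ] TangentSpace (𝓡 n) x →L[ℝ] ℝ}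
    (hg : g ∈ c.metrics) : Prop where
  /-- Each orbit in `TA|_𝒬` contains exactly one element of `𝒯`. -/
  orbit : ∀ ζ : TangentBundle (𝓡 (n + 2)) A, ζ.proj ∈ Set.range ι →
    ∃! v : TotalSpace (EuclideanSpace ℝ (Fin (n + 2))) (Tractor (slice hA hg)),
      ∃ s : PosReal, ζ = tractorAction s ⟨slice hA hg v.proj, v.2⟩
  /-- Smooth local sections of `𝒯` are the smooth vector fields along `𝒬` which are homogeneous of
  degree `-1`. -/
  smooth : ∀ U : Set M, IsOpen U → ∀ σ : ∀ x, Tractor (slice hA hg) x,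
    (ContMDiffOn (𝓡 n) ((𝓡 n).prod 𝓘(ℝ, EuclideanSpace ℝ (Fin (n + 2)))) ∞
      (fun x ↦ TotalSpace.mk' (EuclideanSpace ℝ (Fin (n + 2))) x (σ x)) U ↔
    ContMDiffOn ((𝓡 n).prod 𝓘(ℝ, ℝ)) (𝓡 (n + 2)).tangent ∞ (homogeneousLift σ)
      (U ×ˢ Set.univ))
  /-- The tractor metric is the metric to which `h` descends. -/
  metric : ∀ (σ τ : ∀ x, Tractor (slice hA hg) x) (z : M × ℝ),
    h (homogeneousLift σ z).proj (homogeneousLift σ z).2 (homogeneousLift τ z).2 =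
      tractorMetric h (slice hA hg) z.1 (σ z.1) (τ z.1)
  /-- The inclusion of `ℰ[-1]` maps a function `φ`, homogeneous of degree `-1`, to the field `φ X`
  along `𝒬`. -/
  inclusion : ∀ (φ : ∀ x, c.density (-1) x) (z : M × ℝ),
    homogeneousLift (fun x ↦ tractorInclusion hA hg x (φ x)) z =
      ⟨ι (ConformalStructure.triv hg z),
        ConformalStructure.densityFun φ (ConformalStructure.triv hg z) • generator _⟩

/-- The linear connection on `𝒯` is induced by the Levi-Civita connection of `h`: for every smooth
section `σ` of `𝒯`, every point of `𝒬` and every vector `w` tangent to `𝒬` there, the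
Levi-Civita derivative in the direction `w` of the homogeneous field corresponding to `σ` is the
value of the field corresponding to `∇_{Tπ w} σ`. -/
def IsInducedConnection [IsManifold (𝓡 (n + 2)) ∞ A]
    (h : ∀ u : A, TangentSpace (𝓡 (n + 2)) u →L[ℝ] TangentSpace (𝓡 (n + 2)) u →L[ℝ] ℝ)
    (f : ContMDiffMap (𝓡 n) (𝓡 (n + 2)) M A ∞)
    (cov : CovariantDerivative (𝓡 n) (EuclideanSpace ℝ (Fin (n + 2))) (Tractor f)) : Prop :=
  ∀ σ : ∀ x, Tractor f x, IsSmoothSection n σ →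
    ∀ (z : M × ℝ) (w : TangentSpace ((𝓡 n).prod 𝓘(ℝ, ℝ)) z),
      covDerivAlong h ((𝓡 n).prod 𝓘(ℝ, ℝ)) (homogeneousLift σ) z w =
        (tractorAction (expPos z.2)
          ⟨f z.1, cov σ z.1 (mfderiv ((𝓡 n).prod 𝓘(ℝ, ℝ)) (𝓡 n) Prod.fst z w)⟩).2

/-- The ambient metric `h` induces a normal standard tractor bundle: the quotient bundle
`𝒯 = (TA|_𝒬) / ℝ₊` with the metric and the inclusion of `ℰ[-1]` induced by `h` and `X` carries a
connection induced by the Levi-Civita connection of `h`, these data form a standard tractor bundle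
for the given conformal structure, and the connection is normal. -/
def InducesNormalTractorBundle [IsManifold (𝓡 (n + 2)) ∞ A] {ι : c.RayBundle → A}
    (hA : IsAmbientManifold ι)
    (h : ∀ u : A, TangentSpace (𝓡 (n + 2)) u →L[ℝ] TangentSpace (𝓡 (n + 2)) u →L[ℝ] ℝ) : Prop :=
  ∀ g, ∀ hg : g ∈ c.metrics, IsQuotientBundle hA h hg ∧
    ∃ cov : CovariantDerivative (𝓡 n) (EuclideanSpace ℝ (Fin (n + 2))) (Tractor (slice hA hg)),
      IsInducedConnection h (slice hA hg) cov ∧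
      IsStandardTractorBundle c (tractorInclusion hA hg) (tractorMetric h (slice hA hg)) cov ∧
      IsNormal c (tractorInclusion hA hg) cov

end Ambient

end AmbientTractor

end

open Bundle Manifold
open scoped ContDiff

noncomputable section

namespace AmbientTractor

/-! Write X for the generator, α = h(X,·), r = ½h(X,X), and let N be a vector at a point of 𝒬 with
α(N) = 1.

Homogeneity of h makes X homothetic, L_X h = 2h. The symmetric part of ∇X is therefore the identity
and its skew part is half of dα: 2h(∇_vX, w) = 2h(v,w) + dα(v,w). A homothetic field is affine,
∇²X(v,w) = R(v,X)w (`nablaSq_eq_riemann`), and 2∇²X is the covariant derivative of dα. Thus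
Ric(X,w), the trace of v ↦ R(v,X)w, is controlled by first derivatives of dα.

The tautological condition gives T𝒬 = ker α along 𝒬. Hence α pulls back to zero on 𝒬, dα vanishes on
pairs of tangential vectors, and all of dα at a point of 𝒬 is encoded in the numbers dα(v,N), v
tangential. Differentiating dα = 0 on T𝒬 along 𝒬 yields the tangential part of ∇²X
(`nablaSq_tangent`), and a trace computation gives, on 𝒬, 2Ric(X,X) = n dα(X,N). If i_X dα = 0 on 𝒬,
it also gives 2Ric(X,w) = n dα(w,N) for tangential w. These are `two_mul_trace_riemannMap_self` and
`two_mul_trace_riemannMap_tangent`; both equivalences follow because n ≠ 0.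

Moreover dr = h(∇X, X) = α + ½dα(·,X), so dr = α on 𝒬 once i_X dα = 0 there. As α has no zeros on 𝒬
and kernel T𝒬, the function r is transverse to 𝒬, and `eventually_mem_of_transverse` identifies its
zeros near 𝒬.

If dα = 0 along 𝒬, then ∇_vX = v there. A field σ homogeneous of degree −1 satisfies ∇_Xσ = [X,σ] +
∇_σX = −σ + σ = 0, so the Levi-Civita connection descends. A metric g in the class gives a slice f :
M → 𝒬, the tractor bundle is f^*TA, and its connection is the pull-back connection. The formula
∇_v(φX) = φ Tf(v) + dφ(v)X gives the nondegeneracy and the conformal metric. The curvature is the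
pull-back of R. Since ∇²X(c,·) = 0 for tangential c, for tangential v, w, z one has R(v,w)X = 0,
R(X,w) = 0 and R(·,w)z ∈ T𝒬 (`riemann_field`, `riemann_field_left`, `riemann_tangent`). The first
identity shows that the curvature kills the distinguished line; the other two show that the
Ricci-type contraction of W equals Ric on tangential vectors.

All tensor computations take place in preferred charts. Naturality of the covariant derivative under
maps that are isometric up to a constant (`covDerivIn_tangentMap`) provides both the independence of
the chart and the compatibility with dilations. -/

open Filter Topology

set_option maxSynthPendingDepth 3
set_option linter.unusedSectionVars false

/-! ### Calculus of metrics in coordinates -/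

section Flat

variable {E : Type*} [NormedAddCommGroup E] [NormedSpace ℝ E]

/-- `G` is the coordinate expression of a smooth nondegenerate metric on the open set `O`. -/
structure IsCoordMetric (G : E → E →L[ℝ] E →L[ℝ] ℝ) (O : Set E) :
    Prop where
  isOpen : IsOpen O
  contDiffOn : ContDiffOn ℝ ∞ G O
  symm : ∀ y ∈ O, ∀ v w, G y v w = G y w v
  nondegenerate : ∀ y ∈ O, ∀ v, (∀ w, G y v w = 0) → v = 0

/-- The Christoffel symbols of the first kind, as a bilinear map. -/
def firstKind (G : E → E →L[ℝ] E →L[ℝ] ℝ) (y : E) :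
    E →L[ℝ] E →L[ℝ] E →L[ℝ] ℝ :=
  fderiv ℝ G y + (fderiv ℝ G y).flip -
    (ContinuousLinearMap.flipₗᵢ ℝ E E ℝ).toContinuousLinearEquiv.toContinuousLinearMap.comp
      (fderiv ℝ G y).flip

/-- The Christoffel symbols as a bilinear map. -/
def christoffelMap (G : E → E →L[ℝ] E →L[ℝ] ℝ) (y : E) :
    E →L[ℝ] E →L[ℝ] E :=
  (1 / 2 : ℝ) • (ContinuousLinearMap.compL ℝ E (E →L[ℝ] ℝ) E
    (G y).inverse).comp (firstKind G y)

variable {G : E → E →L[ℝ] E →L[ℝ] ℝ} {O : Set E}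

lemma firstKind_apply (y v w z : E) :
    firstKind G y v w z = fderiv ℝ G y v w z + fderiv ℝ G y w v z - fderiv ℝ G y z v w := rfl

lemma christoffelMap_apply (y v w : E) :
    christoffelMap G y v w = (1 / 2 : ℝ) • (G y).inverse (firstKind G y v w) := rfl

namespace IsCoordMetric

variable (hG : IsCoordMetric G O) {y : E}

include hG

lemma contDiffAt (hy : y ∈ O) : ContDiffAt ℝ ∞ G y :=
  hG.contDiffOn.contDiffAt (hG.isOpen.mem_nhds hy)

lemma eventually_mem (hy : y ∈ O) : ∀ᶠ y' in 𝓝 y, y' ∈ O := hG.isOpen.mem_nhds hy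

lemma differentiableAt (hy : y ∈ O) : DifferentiableAt ℝ G y :=
  (hG.contDiffAt hy).differentiableAt (by simp)

lemma ext_of_apply (hy : y ∈ O) {v w : E} (h : ∀ z, G y v z = G y w z) : v = w := by
  rw [← sub_eq_zero]
  refine hG.nondegenerate y hy _ fun z ↦ ?_
  rw [map_sub, sub_apply, h, sub_self]

lemma fderiv_symm (hy : y ∈ O) (u v w : E) :
    fderiv ℝ G y u v w = fderiv ℝ G y u w v := by
  have key : ∀ a b : E,
      HasFDerivAt (fun y ↦ G y a b) (((ContinuousLinearMap.apply ℝ ℝ b).comp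
        (ContinuousLinearMap.apply ℝ (E →L[ℝ] ℝ) a)).comp (fderiv ℝ G y)) y := fun a b ↦
    ((ContinuousLinearMap.apply ℝ ℝ b).comp
      (ContinuousLinearMap.apply ℝ (E →L[ℝ] ℝ) a)).hasFDerivAt.comp y
        (hG.differentiableAt hy).hasFDerivAt
  have h1 := key v w
  have h2 := (key w v).congr_of_eventuallyEq (f₁ := fun y ↦ G y v w)
    ((hG.eventually_mem hy).mono fun y' hy' ↦ hG.symm y' hy' v w)
  exact congrArg (fun L ↦ L u) (h1.unique h2)

variable [FiniteDimensional ℝ E]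

/-- Nondegeneracy is injectivity of v ↦ G(v,·), and E has the same dimension as its dual. -/
lemma isInvertible (hy : y ∈ O) : (G y).IsInvertible := by
  have hinj : Function.Injective (G y) := by
    intro v w h
    exact hG.ext_of_apply hy fun z ↦ by rw [h]
  have hdim : Module.finrank ℝ E = Module.finrank ℝ (E →L[ℝ] ℝ) := by
    rw [← LinearMap.toContinuousLinearMap.finrank_eq]
    exact (Subspace.dual_finrank_eq (K := ℝ) (V := E)).symm
  let e := LinearEquiv.ofInjectiveOfFinrankEq (G y : E →ₗ[ℝ] (E →L[ℝ] ℝ)) hinj hdim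
  exact ⟨e.toContinuousLinearEquiv, by ext; rfl⟩

lemma apply_inverse (hy : y ∈ O) (a : E →L[ℝ] ℝ) : G y ((G y).inverse a) = a := by
  obtain ⟨e, he⟩ := hG.isInvertible hy
  rw [← he, ContinuousLinearMap.inverse_equiv]
  simp

lemma contDiffAt_christoffelMap (hy : y ∈ O) : ContDiffAt ℝ ∞ (christoffelMap G) y := by
  have h1 : ContDiffAt ℝ ∞ (fderiv ℝ G) y := (hG.contDiffAt hy).fderiv_right (by simp)
  have h2 : ContDiffAt ℝ ∞ (fun y ↦ (fderiv ℝ G y).flip) y :=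
    (ContinuousLinearMap.flipₗᵢ ℝ E E
      (E →L[ℝ] ℝ)).contDiff.contDiffAt.comp y h1
  have h3 : ContDiffAt ℝ ∞ (firstKind G) y :=
    (h1.add h2).sub (contDiffAt_const.clm_comp h2)
  have h4 : ContDiffAt ℝ ∞ (fun y ↦ (G y).inverse) y := by
    obtain ⟨e, he⟩ := hG.isInvertible hy
    have h6 : ContDiffAt ℝ ∞ (ContinuousLinearMap.inverse : (E →L[ℝ] E →L[ℝ] ℝ) → _) (G y) := by
      rw [← he]
      exact contDiffAt_map_inverse e
    exact h6.comp y (hG.contDiffAt hy)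
  have h5 : ContDiffAt ℝ ∞
      (fun y ↦ ContinuousLinearMap.compL ℝ E (E →L[ℝ] ℝ) E (G y).inverse) y :=
    (ContinuousLinearMap.compL ℝ E (E →L[ℝ] ℝ) E).contDiff.contDiffAt.comp y h4
  exact (h5.clm_comp h3).const_smul _

lemma two_mul_apply_christoffel (hy : y ∈ O) (v w z : E) :
    2 * G y (christoffelMap G y v w) z =
      fderiv ℝ G y v w z + fderiv ℝ G y w v z - fderiv ℝ G y z v w := by
  rw [christoffelMap_apply, map_smul, hG.apply_inverse hy, smul_apply, smul_eq_mul,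
    ← firstKind_apply]
  ring

lemma christoffel_symm (hy : y ∈ O) (v w : E) :
    christoffelMap G y v w = christoffelMap G y w v := by
  refine hG.ext_of_apply hy fun z ↦ ?_
  have h1 := hG.two_mul_apply_christoffel hy v w z
  have h2 := hG.two_mul_apply_christoffel hy w v z
  rw [hG.fderiv_symm hy z w v] at h2
  linarith

/-- The Levi-Civita connection is metric. -/
lemma fderiv_apply (hy : y ∈ O) (u v w : E) :
    fderiv ℝ G y u v w =
      G y (christoffelMap G y u v) w + G y v (christoffelMap G y u w) := by
  have h1 := hG.two_mul_apply_christoffel hy u v w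
  have h2 := hG.two_mul_apply_christoffel hy u w v
  rw [hG.symm y hy v]
  have h3 := hG.fderiv_symm hy u w v
  have h4 := hG.fderiv_symm hy v u w
  have h5 := hG.fderiv_symm hy w u v
  linarith

end IsCoordMetric

end Flat

/-! ### Curvature, homothetic fields and change of coordinates -/

section Flat

variable {E : Type*} [NormedAddCommGroup E] [NormedSpace ℝ E]
  {P : Type*} [NormedAddCommGroup P] [NormedSpace ℝ P]
  {F₁ : Type*} [NormedAddCommGroup F₁] [NormedSpace ℝ F₁]
  {F₂ : Type*} [NormedAddCommGroup F₂] [NormedSpace ℝ F₂]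
  {F₃ : Type*} [NormedAddCommGroup F₃] [NormedSpace ℝ F₃]

lemma fderiv_clm_apply_apply {A : P → F₁ →L[ℝ] F₂} {V : P → F₁} {p : P}
    (hA : DifferentiableAt ℝ A p) (hV : DifferentiableAt ℝ V p) (u : P) :
    fderiv ℝ (fun p ↦ A p (V p)) p u = fderiv ℝ A p u (V p) + A p (fderiv ℝ V p u) := by
  rw [fderiv_clm_apply hA hV]
  simp [add_comm]

lemma fderiv_clm_apply₂ {B : P → F₁ →L[ℝ] F₂ →L[ℝ] F₃} {V : P → F₁} {W : P → F₂} {p : P}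
    (hB : DifferentiableAt ℝ B p) (hV : DifferentiableAt ℝ V p) (hW : DifferentiableAt ℝ W p)
    (u : P) :
    fderiv ℝ (fun p ↦ B p (V p) (W p)) p u =
      fderiv ℝ B p u (V p) (W p) + B p (fderiv ℝ V p u) (W p) + B p (V p) (fderiv ℝ W p u) := by
  rw [fderiv_clm_apply_apply (hB.clm_apply hV) hW, fderiv_clm_apply_apply hB hV, add_apply]

lemma fderiv_comp_apply {f : F₁ → F₂} {g : P → F₁} {p : P}
    (hf : DifferentiableAt ℝ f (g p)) (hg : DifferentiableAt ℝ g p) (u : P) :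
    fderiv ℝ (fun p ↦ f (g p)) p u = fderiv ℝ f (g p) (fderiv ℝ g p u) := by
  have := (hf.hasFDerivAt.comp p hg.hasFDerivAt).fderiv
  exact congrArg (fun L ↦ L u) this

lemma _root_.ContDiffAt.differentiableAt_fderiv {f : P → F₁} {p : P} (hf : ContDiffAt ℝ ∞ f p) :
    DifferentiableAt ℝ (fderiv ℝ f) p :=
  (hf.fderiv_right (m := 1) (by norm_cast)).differentiableAt (by simp)

lemma _root_.ContDiffAt.fderiv_fderiv_symm {f : P → F₁} {p : P} (hf : ContDiffAt ℝ ∞ f p)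
    (v w : P) : fderiv ℝ (fderiv ℝ f) p v w = fderiv ℝ (fderiv ℝ f) p w v := by
  have h := hf.isSymmSndFDerivAt (by
    rw [minSmoothness_of_isRCLikeNormedField]
    exact WithTop.coe_le_coe.2 (le_top : (2 : ℕ∞) ≤ ⊤))
  exact h v w

variable {G G' : E → E →L[ℝ] E →L[ℝ] ℝ} {O O' : Set E}

/-- The Riemann curvature `R(v, w) z` of a metric given in coordinates. -/
def riemann (G : E → E →L[ℝ] E →L[ℝ] ℝ) (y v w z : E) : E :=
  fderiv ℝ (christoffelMap G) y v w z - fderiv ℝ (christoffelMap G) y w v z +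
    christoffelMap G y v (christoffelMap G y w z) - christoffelMap G y w (christoffelMap G y v z)

/-- The covariant derivative of a vector field in coordinates. -/
def nabla (G : E → E →L[ℝ] E →L[ℝ] ℝ) (X : E → E) (y : E) : E →L[ℝ] E :=
  fderiv ℝ X y + (christoffelMap G y).flip (X y)

lemma nabla_apply (X : E → E) (y v : E) :
    nabla G X y v = fderiv ℝ X y v + christoffelMap G y v (X y) := rfl

/-- The second covariant derivative of a vector field in coordinates. -/
def nablaSq (G : E → E →L[ℝ] E →L[ℝ] ℝ) (X : E → E) (y v w : E) : E :=
  fderiv ℝ (nabla G X) y v w + christoffelMap G y v (nabla G X y w) -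
    nabla G X y (christoffelMap G y v w)

/-- The exterior derivative of the one-form dual to a vector field, in coordinates. -/
def curl (G : E → E →L[ℝ] E →L[ℝ] ℝ) (X : E → E) (y v w : E) : ℝ :=
  G y (nabla G X y v) w - G y v (nabla G X y w)

/-- The vector field `X` is homothetic: the Lie derivative of the metric is `2 G`. -/
def IsHomothetic (G : E → E →L[ℝ] E →L[ℝ] ℝ) (X : E → E) (y : E) : Prop :=
  ∀ v w, fderiv ℝ G y (X y) v w + G y (fderiv ℝ X y v) w + G y v (fderiv ℝ X y w) = 2 * G y v w

variable [FiniteDimensional ℝ E]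

namespace IsCoordMetric

variable (hG : IsCoordMetric G O) {y : E}

include hG

lemma differentiableAt_christoffelMap (hy : y ∈ O) :
    DifferentiableAt ℝ (christoffelMap G) y :=
  (hG.contDiffAt_christoffelMap hy).differentiableAt (by simp)

/-- The transformation law of the Christoffel symbols under maps which are isometric up to a
constant factor. -/
lemma fderiv_christoffelMap (hG' : IsCoordMetric G' O') {Ψ : E → E} {l : ℝ} (hl : l ≠ 0)
    (hy : y ∈ O') (hΨy : Ψ y ∈ O) (hΨ : ContDiffAt ℝ ∞ Ψ y)
    (h : ∀ᶠ y' in 𝓝 y, ∀ v w, G' y' v w = l * G (Ψ y') (fderiv ℝ Ψ y' v) (fderiv ℝ Ψ y' w))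
    (v w : E) :
    fderiv ℝ Ψ y (christoffelMap G' y v w) =
      christoffelMap G (Ψ y) (fderiv ℝ Ψ y v) (fderiv ℝ Ψ y w) +
        fderiv ℝ (fderiv ℝ Ψ) y v w := by
  have h0 := h.self_of_nhds
  have hinj : Function.Injective (fderiv ℝ Ψ y) := by
    intro a b hab
    refine hG'.ext_of_apply hy fun z ↦ ?_
    rw [h0, h0, hab]
  -- Surjectivity lets the test vector in the Koszul formula for G be taken of the form DΨ(z).
  have hsurj : Function.Surjective (fderiv ℝ Ψ y) :=
    LinearMap.surjective_of_injective (f := (fderiv ℝ Ψ y : E →ₗ[ℝ] E)) hinj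
  have hΨ1 : DifferentiableAt ℝ Ψ y := hΨ.differentiableAt (by simp)
  have hd : ∀ u a b, fderiv ℝ G' y u a b =
      l * (fderiv ℝ G (Ψ y) (fderiv ℝ Ψ y u) (fderiv ℝ Ψ y a) (fderiv ℝ Ψ y b) +
        G (Ψ y) (fderiv ℝ (fderiv ℝ Ψ) y u a) (fderiv ℝ Ψ y b) +
        G (Ψ y) (fderiv ℝ Ψ y a) (fderiv ℝ (fderiv ℝ Ψ) y u b)) := by
    intro u a b
    have e1 : fderiv ℝ (fun y' ↦ G' y' a b) y u = fderiv ℝ G' y u a b := by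
      rw [fderiv_clm_apply₂ (hG'.differentiableAt hy) (differentiableAt_const _)
        (differentiableAt_const _)]
      simp
    have hc : DifferentiableAt ℝ (fun y' ↦ G (Ψ y')) y :=
      (hG.differentiableAt hΨy).comp y hΨ1
    have hD : ∀ a, DifferentiableAt ℝ (fun y' ↦ fderiv ℝ Ψ y' a) y := fun a ↦
      hΨ.differentiableAt_fderiv.clm_apply (differentiableAt_const _)
    have hDD : ∀ a, fderiv ℝ (fun y' ↦ fderiv ℝ Ψ y' a) y u = fderiv ℝ (fderiv ℝ Ψ) y u a := by
      intro a
      rw [fderiv_clm_apply_apply hΨ.differentiableAt_fderiv (differentiableAt_const _)]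
      simp
    have e2 : (fun y' ↦ G' y' a b) =ᶠ[𝓝 y] fun y' ↦
      l * G (Ψ y') (fderiv ℝ Ψ y' a) (fderiv ℝ Ψ y' b) := h.mono fun y' hy' ↦ hy' a b
    rw [← e1, e2.fderiv_eq, fderiv_const_mul ((hc.clm_apply (hD a)).clm_apply (hD b)), smul_apply,
      smul_eq_mul, fderiv_clm_apply₂ hc (hD a) (hD b), hDD, hDD,
      fderiv_comp_apply (hG.differentiableAt hΨy) hΨ1]
  refine hG.ext_of_apply hΨy fun z' ↦ ?_
  obtain ⟨z, rfl⟩ := hsurj z'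
  -- The Koszul formulas for G' and for G are compared. By symmetry of D²Ψ all its contributions
  -- cancel except D²Ψ(v,w), and the constant l enters as a common factor.
  have h1 := hG'.two_mul_apply_christoffel hy v w z
  have h2 := hG.two_mul_apply_christoffel hΨy (fderiv ℝ Ψ y v) (fderiv ℝ Ψ y w) (fderiv ℝ Ψ y z)
  rw [h0, hd, hd, hd] at h1
  rw [map_add, add_apply]
  have s1 := hΨ.fderiv_fderiv_symm w v
  have s2 := hΨ.fderiv_fderiv_symm w z
  have s3 := hΨ.fderiv_fderiv_symm v z
  rw [s1, s2, s3, hG.symm _ hΨy (fderiv ℝ Ψ y w) (fderiv ℝ (fderiv ℝ Ψ) y z v)] at h1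
  apply mul_left_cancel₀ hl
  linear_combination h1 / 2 - l * h2 / 2

end IsCoordMetric

end Flat

/-! ### Covariant derivatives along maps, curvature identities, homothetic fields -/

section Along

variable {E : Type*} [NormedAddCommGroup E] [NormedSpace ℝ E]
  {P : Type*} [NormedAddCommGroup P] [NormedSpace ℝ P]

/-- The Levi-Civita derivative in the direction `c` of a vector field `a` along a map `φ`, in
coordinates. -/
def covAlong (G : E → E →L[ℝ] E →L[ℝ] ℝ) (φ a : P → E) (z c : P) : E :=
  fderiv ℝ a z c + christoffelMap G (φ z) (fderiv ℝ φ z c) (a z)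

variable {G : E → E →L[ℝ] E →L[ℝ] ℝ} {O : Set E} {φ a b : P → E} {z : P} {X : E → E} {y : E}

lemma covAlong_comp {f : E → E} (hf : DifferentiableAt ℝ f (φ z)) (hφ : DifferentiableAt ℝ φ z)
    (c : P) : covAlong G φ (fun z ↦ f (φ z)) z c = nabla G f (φ z) (fderiv ℝ φ z c) := by
  rw [covAlong, nabla_apply, fderiv_comp_apply hf hφ]

variable [FiniteDimensional ℝ E]

namespace IsCoordMetric

variable (hG : IsCoordMetric G O)

include hG

lemma fderiv_metric_along (hz : φ z ∈ O) (hφ : DifferentiableAt ℝ φ z)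
    (ha : DifferentiableAt ℝ a z) (hb : DifferentiableAt ℝ b z) (c : P) :
    fderiv ℝ (fun z ↦ G (φ z) (a z) (b z)) z c =
      G (φ z) (covAlong G φ a z c) (b z) + G (φ z) (a z) (covAlong G φ b z c) := by
  have h1 : DifferentiableAt ℝ (fun z ↦ G (φ z)) z := (hG.differentiableAt hz).comp z hφ
  rw [fderiv_clm_apply₂ h1 ha hb, fderiv_comp_apply (hG.differentiableAt hz) hφ,
    hG.fderiv_apply hz, covAlong, covAlong]
  simp only [map_add, add_apply]
  ring

lemma contDiffAt_nabla (hy : y ∈ O) (hX : ContDiffAt ℝ ∞ X y) :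
    ContDiffAt ℝ ∞ (nabla G X) y := by
  have h1 : ContDiffAt ℝ ∞ (fderiv ℝ X) y := hX.fderiv_right (by simp)
  have h2 : ContDiffAt ℝ ∞ (fun y ↦ (christoffelMap G y).flip) y :=
    (ContinuousLinearMap.flipₗᵢ ℝ E E E).contDiff.contDiffAt.comp y
      (hG.contDiffAt_christoffelMap hy)
  exact h1.add (h2.clm_apply hX)

lemma covAlong_nabla (hz : φ z ∈ O) (hφ : DifferentiableAt ℝ φ z) (hX : ContDiffAt ℝ ∞ X (φ z))
    (ha : DifferentiableAt ℝ a z) (c : P) :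
    covAlong G φ (fun z ↦ nabla G X (φ z) (a z)) z c =
      nablaSq G X (φ z) (fderiv ℝ φ z c) (a z) + nabla G X (φ z) (covAlong G φ a z c) := by
  have h1 := (hG.contDiffAt_nabla hz hX).differentiableAt (by simp)
  have h2 : DifferentiableAt ℝ (fun z ↦ nabla G X (φ z)) z := h1.comp z hφ
  rw [covAlong, fderiv_clm_apply_apply h2 ha, fderiv_comp_apply h1 hφ, nablaSq, covAlong]
  simp only [map_add]
  abel

/-- Torsion-freeness along a map: both D²φ and Γ are symmetric. -/
lemma covAlong_fderiv_symm (hz : φ z ∈ O) (hφ : ContDiffAt ℝ ∞ φ z) (v c : P) :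
    covAlong G φ (fun z ↦ fderiv ℝ φ z v) z c = covAlong G φ (fun z ↦ fderiv ℝ φ z c) z v := by
  have h : ∀ v c, fderiv ℝ (fun z ↦ fderiv ℝ φ z v) z c = fderiv ℝ (fderiv ℝ φ) z c v := by
    intro v c
    rw [fderiv_clm_apply_apply hφ.differentiableAt_fderiv (differentiableAt_const _)]
    simp
  rw [covAlong, covAlong, h, h, hφ.fderiv_fderiv_symm, hG.christoffel_symm hz]

lemma fderiv_christoffelMap_symm (hy : y ∈ O) (u v w : E) :
    fderiv ℝ (christoffelMap G) y u v w = fderiv ℝ (christoffelMap G) y u w v := by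
  have key : ∀ v w, fderiv ℝ (fun y ↦ christoffelMap G y v w) y u =
      fderiv ℝ (christoffelMap G) y u v w := fun v w ↦ by
    rw [fderiv_clm_apply₂ (hG.differentiableAt_christoffelMap hy) (differentiableAt_const _)
      (differentiableAt_const _)]
    simp
  rw [← key, ← key]
  have : (fun y ↦ christoffelMap G y v w) =ᶠ[𝓝 y] fun y ↦ christoffelMap G y w v :=
    (hG.eventually_mem hy).mono fun y' hy' ↦ hG.christoffel_symm hy' v w
  rw [this.fderiv_eq]

lemma riemann_bianchi (hy : y ∈ O) (u v w : E) :
    riemann G y u v w + riemann G y v w u + riemann G y w u v = 0 := by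
  simp only [riemann]
  rw [hG.fderiv_christoffelMap_symm hy u w v, hG.fderiv_christoffelMap_symm hy v w u,
    hG.fderiv_christoffelMap_symm hy w v u, hG.christoffel_symm hy w v,
    hG.christoffel_symm hy u v, hG.christoffel_symm hy w u]
  abel

omit [FiniteDimensional ℝ E] hG in
lemma riemann_swap (u v w : E) : riemann G y u v w = - riemann G y v u w := by
  simp only [riemann]
  abel

/-- The terms are grouped so that antisymmetrising in c and d leaves only the ∂Γ and ΓΓ terms, which
make up the curvature, and the last term, which produces the bracket. -/
lemma fderiv_covAlong {c : P → P} (hz : φ z ∈ O) (hφ : ContDiffAt ℝ ∞ φ z)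
    (ha : ContDiffAt ℝ ∞ a z) (hc : DifferentiableAt ℝ c z) (d : P) :
    covAlong G φ (fun z ↦ covAlong G φ a z (c z)) z d =
      fderiv ℝ (fderiv ℝ a) z d (c z) +
      fderiv ℝ (christoffelMap G) (φ z) (fderiv ℝ φ z d) (fderiv ℝ φ z (c z)) (a z) +
      christoffelMap G (φ z) (fderiv ℝ (fderiv ℝ φ) z d (c z)) (a z) +
      (christoffelMap G (φ z) (fderiv ℝ φ z (c z)) (fderiv ℝ a z d) +
      christoffelMap G (φ z) (fderiv ℝ φ z d) (fderiv ℝ a z (c z))) +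
      christoffelMap G (φ z) (fderiv ℝ φ z d) (christoffelMap G (φ z) (fderiv ℝ φ z (c z)) (a z)) +
      covAlong G φ a z (fderiv ℝ c z d) := by
  have hφ1 : DifferentiableAt ℝ φ z := hφ.differentiableAt (by simp)
  have ha1 : DifferentiableAt ℝ a z := ha.differentiableAt (by simp)
  have hΓ := hG.differentiableAt_christoffelMap hz
  have hΓ' : DifferentiableAt ℝ (fun z ↦ christoffelMap G (φ z)) z := hΓ.comp z hφ1
  have e1 := fderiv_clm_apply_apply ha.differentiableAt_fderiv hc d
  have e2 := fderiv_clm_apply₂ hΓ' (hφ.differentiableAt_fderiv.clm_apply hc) ha1 d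
  rw [fderiv_comp_apply hΓ hφ1, fderiv_clm_apply_apply hφ.differentiableAt_fderiv hc] at e2
  have e3 : fderiv ℝ (fun z ↦ covAlong G φ a z (c z)) z d =
      fderiv ℝ (fun z ↦ fderiv ℝ a z (c z)) z d +
      fderiv ℝ (fun z ↦ christoffelMap G (φ z) (fderiv ℝ φ z (c z)) (a z)) z d := by
    rw [← add_apply, ← fderiv_add (ha.differentiableAt_fderiv.clm_apply hc)
      ((hΓ'.clm_apply (hφ.differentiableAt_fderiv.clm_apply hc)).clm_apply ha1)]
    rfl
  rw [covAlong, e3, e1, e2, covAlong, covAlong]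
  simp only [map_add, add_apply]
  abel

/-- The curvature of the pull-back of the Levi-Civita connection. -/
lemma covAlong_covAlong_sub {c d : P → P} (hz : φ z ∈ O) (hφ : ContDiffAt ℝ ∞ φ z)
    (ha : ContDiffAt ℝ ∞ a z) (hc : DifferentiableAt ℝ c z) (hd : DifferentiableAt ℝ d z) :
    covAlong G φ (fun z ↦ covAlong G φ a z (d z)) z (c z) -
      covAlong G φ (fun z ↦ covAlong G φ a z (c z)) z (d z) -
      covAlong G φ a z (fderiv ℝ d z (c z) - fderiv ℝ c z (d z)) =
    riemann G (φ z) (fderiv ℝ φ z (c z)) (fderiv ℝ φ z (d z)) (a z) := by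
  rw [hG.fderiv_covAlong hz hφ ha hd, hG.fderiv_covAlong hz hφ ha hc, hφ.fderiv_fderiv_symm,
    ha.fderiv_fderiv_symm]
  simp only [covAlong, riemann, map_sub, sub_apply]
  abel

/-- The curvature is skew-symmetric for the metric. -/
lemma riemann_skew (hy : y ∈ O) (u v z w : E) :
    G y (riemann G y u v z) w + G y z (riemann G y u v w) = 0 := by
  -- D²G is computed by applying metric compatibility twice. Its symmetry in u and v then leaves
  -- exactly the skewness of the curvature.
  have key : ∀ u v, fderiv ℝ (fderiv ℝ G) y u v z w =
      G y (christoffelMap G y u (christoffelMap G y v z)) w +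
      G y (christoffelMap G y v z) (christoffelMap G y u w) +
      G y (fderiv ℝ (christoffelMap G) y u v z) w +
      G y (christoffelMap G y u z) (christoffelMap G y v w) +
      G y z (christoffelMap G y u (christoffelMap G y v w)) +
      G y z (fderiv ℝ (christoffelMap G) y u v w) := by
    intro u v
    have hΓ := hG.differentiableAt_christoffelMap hy
    have hGd := hG.differentiableAt hy
    have hΓ' : ∀ z, DifferentiableAt ℝ (fun y ↦ christoffelMap G y v z) y := fun z ↦
      (hΓ.clm_apply (differentiableAt_const _)).clm_apply (differentiableAt_const _)
    have hΓd : ∀ z, fderiv ℝ (fun y ↦ christoffelMap G y v z) y u =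
        fderiv ℝ (christoffelMap G) y u v z := fun z ↦ by
      rw [fderiv_clm_apply₂ hΓ (differentiableAt_const _) (differentiableAt_const _)]
      simp
    have e1 : fderiv ℝ (fun y ↦ fderiv ℝ G y v z w) y u = fderiv ℝ (fderiv ℝ G) y u v z w := by
      have h1 := (hG.contDiffAt hy).differentiableAt_fderiv
      rw [fderiv_clm_apply₂ (h1.clm_apply (differentiableAt_const _)) (differentiableAt_const _)
        (differentiableAt_const _), fderiv_clm_apply_apply h1 (differentiableAt_const _)]
      simp
    have e2 : (fun y ↦ fderiv ℝ G y v z w) =ᶠ[𝓝 y] fun y ↦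
        G y (christoffelMap G y v z) w + G y z (christoffelMap G y v w) :=
      (hG.eventually_mem hy).mono fun y' hy' ↦ hG.fderiv_apply hy' v z w
    rw [← e1, e2.fderiv_eq, fderiv_fun_add
      ((hGd.clm_apply (hΓ' z)).clm_apply (differentiableAt_const _))
      ((hGd.clm_apply (differentiableAt_const _)).clm_apply (hΓ' w)), add_apply,
      fderiv_clm_apply₂ hGd (hΓ' z) (differentiableAt_const _),
      fderiv_clm_apply₂ hGd (differentiableAt_const _) (hΓ' w), hΓd, hΓd, hG.fderiv_apply hy,
      hG.fderiv_apply hy]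
    simp
    ring
  have h1 := key u v
  have h2 := key v u
  rw [(hG.contDiffAt hy).fderiv_fderiv_symm] at h1
  simp only [riemann, map_add, map_sub, add_apply, sub_apply]
  linarith

/-- The classical octahedron argument: four instances of the first Bianchi identity, combined with
skewness in each pair of arguments. -/
lemma riemann_pair_symm (hy : y ∈ O) (u v z w : E) :
    G y (riemann G y u v z) w = G y (riemann G y z w u) v := by
  have hB : ∀ a b c d, G y (riemann G y a b c) d + G y (riemann G y b c a) d +
      G y (riemann G y c a b) d = 0 := fun a b c d ↦ by
    rw [← add_apply, ← add_apply, ← map_add, ← map_add, hG.riemann_bianchi hy]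
    simp
  have hS : ∀ a b c d, G y (riemann G y a b c) d = - G y (riemann G y a b d) c := fun a b c d ↦ by
    have := hG.riemann_skew hy a b c d
    rw [hG.symm y hy c] at this
    linarith
  have hA : ∀ a b c d, G y (riemann G y a b c) d = - G y (riemann G y b a c) d := fun a b c d ↦ by
    rw [riemann_swap, map_neg, neg_apply]
  have b1 := hB u v z w
  have b2 := hB v z w u
  have b3 := hB z w u v
  have b4 := hB w u v z
  have s1 := hS u v w z
  have s2 := hS v z u w
  have s3 := hS z w u v
  have s4 := hS w u v z
  have s5 := hS z u v w
  have s6 := hS v w z u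
  have a1 := hA v z w u
  have a2 := hA w u z v
  have a3 := hA z u v w
  have a4 := hA v w z u
  have a5 := hA w v z u
  have a6 := hA w v u z
  have a7 := hA u w v z
  have a8 := hA u w z v
  have a9 := hA z u w v
  linarith

section Homothetic

variable (hX : ContDiffAt ℝ ∞ X y)

/-- Metric compatibility removes the derivative of G from the Lie derivative, and torsion-freeness
turns Γ(X,·) into Γ(·,X). -/
lemma nabla_add_nabla (hy : y ∈ O) (h : IsHomothetic G X y) (v w : E) :
    G y (nabla G X y v) w + G y v (nabla G X y w) = 2 * G y v w := by
  have := h v w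
  rw [hG.fderiv_apply hy] at this
  rw [nabla_apply, nabla_apply, hG.christoffel_symm hy v, hG.christoffel_symm hy w]
  simp only [map_add, add_apply]
  linarith

include hX

/-- By `nabla_add_nabla` the endomorphism ∇X − id is skew, hence so is its covariant derivative. -/
lemma nablaSq_skew (hy : y ∈ O) (h : ∀ᶠ y' in 𝓝 y, IsHomothetic G X y') (u v w : E) :
    G y (nablaSq G X y u v) w + G y v (nablaSq G X y u w) = 0 := by
  have hN := (hG.contDiffAt_nabla hy hX).differentiableAt (by simp)
  have hN' : ∀ v, DifferentiableAt ℝ (fun y ↦ nabla G X y v) y := fun v ↦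
    hN.clm_apply (differentiableAt_const _)
  have hGd := hG.differentiableAt hy
  have e : (fun y ↦ G y (nabla G X y v) w + G y v (nabla G X y w)) =ᶠ[𝓝 y]
      fun y ↦ 2 * G y v w := (h.and (hG.eventually_mem hy)).mono fun y' hy' ↦
    hG.nabla_add_nabla hy'.2 hy'.1 v w
  have e1 := congrArg (fun L : E →L[ℝ] ℝ ↦ L u) e.fderiv_eq
  have m := fun a b ha hb ↦ hG.fderiv_metric_along (φ := fun y : E ↦ y) (a := a) (b := b) hy
    differentiableAt_id ha hb u
  have c := fun v ↦ hG.covAlong_nabla (φ := fun y : E ↦ y) (X := X) (a := fun _ ↦ v) hy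
    differentiableAt_id hX (differentiableAt_const _) u
  beta_reduce at e1
  rw [fderiv_fun_add ((hGd.clm_apply (hN' v)).clm_apply (differentiableAt_const _))
      ((hGd.clm_apply (differentiableAt_const _)).clm_apply (hN' w)), add_apply,
    fderiv_const_mul ((hGd.clm_apply (differentiableAt_const _)).clm_apply
      (differentiableAt_const _)), smul_apply, smul_eq_mul,
    m _ _ (hN' v) (differentiableAt_const _), m _ _ (differentiableAt_const _) (hN' w),
    m _ _ (differentiableAt_const _) (differentiableAt_const _), c, c] at e1
  have h1 := hG.nabla_add_nabla hy h.self_of_nhds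
    (covAlong G (fun y : E ↦ y) (fun _ ↦ v) y u) w
  have h2 := hG.nabla_add_nabla hy h.self_of_nhds v
    (covAlong G (fun y : E ↦ y) (fun _ ↦ w) y u)
  simp only [map_add, add_apply, fderiv_fun_id] at e1
  simp only [ContinuousLinearMap.id_apply] at e1
  linarith

lemma nablaSq_sub (hy : y ∈ O) (v w : E) :
    nablaSq G X y v w - nablaSq G X y w v = riemann G y v w (X y) := by
  have hXd : DifferentiableAt ℝ X y := hX.differentiableAt (by simp)
  have hΓ := hG.differentiableAt_christoffelMap hy
  have key : ∀ v w, fderiv ℝ (nabla G X) y v w = fderiv ℝ (fderiv ℝ X) y v w +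
      (fderiv ℝ (christoffelMap G) y v w (X y) + christoffelMap G y w (fderiv ℝ X y v)) := by
    intro v w
    have e : fderiv ℝ (fun y ↦ nabla G X y w) y v = fderiv ℝ (nabla G X) y v w := by
      rw [fderiv_clm_apply_apply ((hG.contDiffAt_nabla hy hX).differentiableAt (by simp))
        (differentiableAt_const _)]
      simp
    rw [← e]
    have : (fun y ↦ nabla G X y w) = fun y ↦ fderiv ℝ X y w + christoffelMap G y w (X y) := rfl
    rw [this, fderiv_fun_add (hX.differentiableAt_fderiv.clm_apply (differentiableAt_const _))
      ((hΓ.clm_apply (differentiableAt_const _)).clm_apply hXd), add_apply,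
      fderiv_clm_apply₂ hΓ (differentiableAt_const _) hXd,
      fderiv_clm_apply_apply hX.differentiableAt_fderiv (differentiableAt_const _)]
    simp
  simp only [nablaSq, key, nabla_apply, riemann, map_add]
  rw [hX.fderiv_fderiv_symm v w, hG.christoffel_symm hy w v]
  abel

/-- A homothetic vector field is affine. -/
lemma nablaSq_eq_riemann (hy : y ∈ O) (h : ∀ᶠ y' in 𝓝 y, IsHomothetic G X y') (v w : E) :
    nablaSq G X y v w = riemann G y v (X y) w := by
  refine hG.ext_of_apply hy fun u ↦ ?_
  -- A trilinear form skew in its last two slots is determined by its antisymmetrisation in the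
  -- first two, as in the Koszul formula. The latter is R(·,·)X by the Ricci identity, and the first
  -- Bianchi identity and pair symmetry collapse the resulting three curvature terms to one.
  have k1 := hG.nablaSq_skew hX hy h v w u
  have k2 := hG.nablaSq_skew hX hy h w v u
  have k3 := hG.nablaSq_skew hX hy h u v w
  rw [hG.symm y hy w] at k1
  rw [hG.symm y hy v] at k2 k3
  have r : ∀ a b c, G y (nablaSq G X y a b) c - G y (nablaSq G X y b a) c =
      G y (riemann G y a b (X y)) c := fun a b c ↦ by
    rw [← hG.nablaSq_sub hX hy, map_sub, sub_apply]
  have r1 := r v w u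
  have r2 := r w u v
  have r3 := r u v w
  have hB : G y (riemann G y v w u) (X y) + G y (riemann G y w u v) (X y) +
      G y (riemann G y u v w) (X y) = 0 := by
    rw [← add_apply, ← add_apply, ← map_add, ← map_add, hG.riemann_bianchi hy]
    simp
  have s : ∀ a b c, G y (riemann G y a b c) (X y) = - G y (riemann G y a b (X y)) c := by
    intro a b c
    have := hG.riemann_skew hy a b c (X y)
    rw [hG.symm y hy c] at this
    linarith
  rw [hG.riemann_pair_symm hy v (X y) w u, s]
  rw [s, s, s] at hB
  linarith

/-- In substance this is d(dα) = 0, because 2∇²X is the covariant derivative of dα. It is deduced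
from the first Bianchi identity by way of ∇²X = R(·,X) and pair symmetry. -/
lemma nablaSq_cyclic (hy : y ∈ O) (h : ∀ᶠ y' in 𝓝 y, IsHomothetic G X y') (u v w : E) :
    G y (nablaSq G X y u v) w + G y (nablaSq G X y v w) u + G y (nablaSq G X y w u) v = 0 := by
  simp only [hG.nablaSq_eq_riemann hX hy h]
  rw [hG.riemann_pair_symm hy u (X y) v w, hG.riemann_pair_symm hy v (X y) w u,
    hG.riemann_pair_symm hy w (X y) u v, add_comm, ← add_assoc,
    ← add_apply, ← add_apply, ← map_add, ← map_add, hG.riemann_bianchi hy]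
  simp

end Homothetic

end IsCoordMetric

end Along

/-! ### The homothetic field along a null cone -/

section Cone

variable {E : Type*} [NormedAddCommGroup E] [NormedSpace ℝ E]
  {P : Type*} [NormedAddCommGroup P] [NormedSpace ℝ P]

/-- `φ` is, near `z₀`, a parametrization of a hypersurface which is orthogonal to the homothetic
vector field `X`, which is null there. -/
structure IsNullCone (G : E → E →L[ℝ] E →L[ℝ] ℝ) (O : Set E) (X : E → E) (φ : P → E) (z₀ : P) :
    Prop where
  metric : IsCoordMetric G O
  contDiffOn : ContDiffOn ℝ ∞ X O
  homothetic : ∀ y ∈ O, IsHomothetic G X y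
  mem : φ z₀ ∈ O
  contDiffAt : ∀ᶠ z in 𝓝 z₀, ContDiffAt ℝ ∞ φ z
  tangent : ∀ᶠ z in 𝓝 z₀, ∀ v, G (φ z) (X (φ z)) (fderiv ℝ φ z v) = 0
  null : G (φ z₀) (X (φ z₀)) (X (φ z₀)) = 0
  mem_range : ∀ c, G (φ z₀) (X (φ z₀)) c = 0 → ∃ v, fderiv ℝ φ z₀ v = c

variable {G : E → E →L[ℝ] E →L[ℝ] ℝ} {O : Set E} {X : E → E} {φ : P → E} {z z₀ : P} {y : E}

lemma curl_add_left (u v w : E) : curl G X y (u + v) w = curl G X y u w + curl G X y v w := by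
  simp only [curl, map_add, add_apply]; ring

lemma curl_smul_left (c : ℝ) (v w : E) : curl G X y (c • v) w = c * curl G X y v w := by
  simp only [curl, map_smul, smul_apply, smul_eq_mul]; ring

lemma curl_sub_left (u v w : E) : curl G X y (u - v) w = curl G X y u w - curl G X y v w := by
  simp only [curl, map_sub, sub_apply]; ring

/-- The linear form `v ↦ dα(v, w)`. -/
def curlForm (G : E → E →L[ℝ] E →L[ℝ] ℝ) (X : E → E) (y w : E) : E →L[ℝ] ℝ :=
  (G y).flip w ∘L nabla G X y - (G y).flip (nabla G X y w)

lemma curlForm_apply (v w : E) : curlForm G X y w v = curl G X y v w := rfl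

/-- The linear map `v ↦ R(v, w) z`. -/
def riemannMap (G : E → E →L[ℝ] E →L[ℝ] ℝ) (y w z : E) : E →ₗ[ℝ] E where
  toFun v := riemann G y v w z
  map_add' u v := by
    simp only [riemann, map_add, add_apply]; abel
  map_smul' c v := by
    simp only [riemann, map_smul, smul_apply, smul_sub, smul_add, RingHom.id_apply]

lemma riemannMap_apply (v w z : E) : riemannMap G y w z v = riemann G y v w z := rfl

lemma riemann_self (v w : E) : riemann G y v v w = 0 := by simp [riemann]

variable [FiniteDimensional ℝ E]

/-- The trace of an endomorphism which has a simple form on a hyperplane. -/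
lemma trace_eq_of_forall_ker {T : E →ₗ[ℝ] E} {a l k : E →ₗ[ℝ] ℝ} {μ : ℝ} {N X B : E}
    (hN : a N = 1) (h : ∀ v, a v = 0 → T v = μ • v + l v • X - k v • B) :
    LinearMap.trace ℝ E T = μ * (Module.finrank ℝ E - 1) + l (X - a X • N) - k (B - a B • N) +
      a (T N) := by
  -- p projects onto ker a along N, so T = T ∘ p + a ⊗ T(N). The trace of p is dim E − 1, and every
  -- other summand has rank at most one.
  let p : E →ₗ[ℝ] E := LinearMap.id - a.smulRight N
  have hp : ∀ v, p v = v - a v • N := fun v ↦ rfl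
  have hap : ∀ v, a (p v) = 0 := fun v ↦ by simp [hp, hN]
  have hT : T = μ • p + (l ∘ₗ p).smulRight X - (k ∘ₗ p).smulRight B + a.smulRight (T N) := by
    ext v
    have e : v = p v + a v • N := by simp [hp]
    conv_lhs => rw [e]
    rw [map_add, h _ (hap v), map_smul]
    simp
  have htr : ∀ (f : E →ₗ[ℝ] ℝ) (x : E), LinearMap.trace ℝ E (f.smulRight x) = f x := fun f x ↦ by
    simp
  have htp : LinearMap.trace ℝ E p = Module.finrank ℝ E - 1 := by
    rw [map_sub, LinearMap.trace_id, htr, hN]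
  conv_lhs => rw [hT]
  rw [map_add, map_sub, map_add, map_smul, htr, htr, htr, htp]
  simp only [LinearMap.comp_apply, hp, smul_eq_mul]

namespace IsCoordMetric

variable (hG : IsCoordMetric G O)

include hG

lemma curl_swap (hy : y ∈ O) (v w : E) : curl G X y v w = - curl G X y w v := by
  rw [curl, curl, hG.symm y hy v, hG.symm y hy w]
  ring

/-- The symmetric part of ∇X is fixed by homothety; the skew part is half of dα. -/
lemma two_mul_apply_nabla (hy : y ∈ O) (h : IsHomothetic G X y) (v w : E) :
    2 * G y (nabla G X y v) w = 2 * G y v w + curl G X y v w := by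
  have := hG.nabla_add_nabla hy h v w
  rw [curl]
  linarith

/-- Skewness of ∇²X in its last two slots makes 2∇²X the covariant derivative of dα; this is the
product rule for dα along φ. -/
lemma fderiv_curl_along {a b : P → E} (hz : φ z ∈ O) (hφ : DifferentiableAt ℝ φ z)
    (hX : ContDiffAt ℝ ∞ X (φ z)) (h : ∀ᶠ y in 𝓝 (φ z), IsHomothetic G X y)
    (ha : DifferentiableAt ℝ a z) (hb : DifferentiableAt ℝ b z) (c : P) :
    fderiv ℝ (fun z ↦ curl G X (φ z) (a z) (b z)) z c =
      2 * G (φ z) (nablaSq G X (φ z) (fderiv ℝ φ z c) (a z)) (b z) +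
      curl G X (φ z) (covAlong G φ a z c) (b z) + curl G X (φ z) (a z) (covAlong G φ b z c) := by
  have hN := ((hG.contDiffAt_nabla hz hX).differentiableAt (by simp)).comp z hφ
  have hGd : DifferentiableAt ℝ (fun z ↦ G (φ z)) z := (hG.differentiableAt hz).comp z hφ
  have hNa : DifferentiableAt ℝ (fun z ↦ nabla G X (φ z) (a z)) z := hN.clm_apply ha
  have hNb : DifferentiableAt ℝ (fun z ↦ nabla G X (φ z) (b z)) z := hN.clm_apply hb
  simp only [curl]
  rw [fderiv_fun_sub ((hGd.clm_apply hNa).clm_apply hb) ((hGd.clm_apply ha).clm_apply hNb),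
    sub_apply, hG.fderiv_metric_along hz hφ hNa hb, hG.fderiv_metric_along hz hφ ha hNb,
    hG.covAlong_nabla hz hφ hX ha, hG.covAlong_nabla hz hφ hX hb]
  have := hG.nablaSq_skew hX hz h (fderiv ℝ φ z c) (a z) (b z)
  simp only [map_add, add_apply]
  linarith

end IsCoordMetric

namespace IsNullCone

variable (hC : IsNullCone G O X φ z₀) {N : E} (hN : G (φ z₀) (X (φ z₀)) N = 1)

include hC

lemma eventually_mem : ∀ᶠ z in 𝓝 z₀, φ z ∈ O :=
  hC.contDiffAt.self_of_nhds.continuousAt.eventually (hC.metric.eventually_mem hC.mem)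

lemma contDiffAt_field (hy : y ∈ O) : ContDiffAt ℝ ∞ X y :=
  hC.contDiffOn.contDiffAt (hC.metric.isOpen.mem_nhds hy)

lemma eventually_homothetic (hy : y ∈ O) : ∀ᶠ y' in 𝓝 y, IsHomothetic G X y' :=
  (hC.metric.eventually_mem hy).mono fun _ h ↦ hC.homothetic _ h

lemma differentiableAt : DifferentiableAt ℝ φ z₀ :=
  hC.contDiffAt.self_of_nhds.differentiableAt (by simp)

/-- The derivative along the cone of α(φ_*v) = 0. It expresses the transverse part of ∇_c(φ_*v)
through ∇X. -/
lemma eventually_tangent : ∀ᶠ z in 𝓝 z₀, ∀ v c,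
    G (φ z) (nabla G X (φ z) (fderiv ℝ φ z c)) (fderiv ℝ φ z v) +
      G (φ z) (X (φ z)) (covAlong G φ (fun z ↦ fderiv ℝ φ z v) z c) = 0 := by
  filter_upwards [hC.tangent.eventually_nhds, hC.contDiffAt, hC.eventually_mem] with z h1 h2 h3 v c
  have hφ : DifferentiableAt ℝ φ z := h2.differentiableAt (by simp)
  have hX : DifferentiableAt ℝ X (φ z) := (hC.contDiffAt_field h3).differentiableAt (by simp)
  have e : (fun z ↦ G (φ z) (X (φ z)) (fderiv ℝ φ z v)) =ᶠ[𝓝 z] fun _ ↦ 0 :=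
    h1.mono fun z hz ↦ hz v
  have e1 := hC.metric.fderiv_metric_along h3 hφ (a := fun z ↦ X (φ z)) (hX.comp z hφ)
    (h2.differentiableAt_fderiv.clm_apply (differentiableAt_const v)) c
  rw [e.fderiv_eq, covAlong_comp hX hφ] at e1
  simpa using e1.symm

/-- The pull-back of α vanishes, hence so does that of dα. Concretely, `eventually_tangent` is
antisymmetrised, and its second term drops out by torsion-freeness. -/
lemma eventually_curl_tangent : ∀ᶠ z in 𝓝 z₀, ∀ v w,
    curl G X (φ z) (fderiv ℝ φ z v) (fderiv ℝ φ z w) = 0 := by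
  filter_upwards [hC.eventually_tangent, hC.contDiffAt, hC.eventually_mem] with z h1 h2 h3 v w
  have e1 := h1 v w
  have e2 := h1 w v
  rw [hC.metric.covAlong_fderiv_symm h3 h2] at e1
  rw [curl, hC.metric.symm _ h3 (fderiv ℝ φ z v)]
  linarith

lemma curl_tangent {v w : E} (hv : G (φ z₀) (X (φ z₀)) v = 0) (hw : G (φ z₀) (X (φ z₀)) w = 0) :
    curl G X (φ z₀) v w = 0 := by
  obtain ⟨v, rfl⟩ := hC.mem_range v hv
  obtain ⟨w, rfl⟩ := hC.mem_range w hw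
  exact hC.eventually_curl_tangent.self_of_nhds v w

include hN

/-- The vector w − α(w)N is tangential, so only the N-component of w contributes. -/
lemma curl_tangent_left {v w : E} (hv : G (φ z₀) (X (φ z₀)) v = 0) :
    curl G X (φ z₀) v w = G (φ z₀) (X (φ z₀)) w * curl G X (φ z₀) v N := by
  have h := hC.curl_tangent (v := w - G (φ z₀) (X (φ z₀)) w • N) (by simp [hN]) hv
  rw [curl_sub_left, curl_smul_left, hC.metric.curl_swap hC.mem w,
    hC.metric.curl_swap hC.mem N] at h
  linarith

lemma nabla_tangent {v : E} (hv : G (φ z₀) (X (φ z₀)) v = 0) :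
    nabla G X (φ z₀) v = v + (1 / 2 * curl G X (φ z₀) v N) • X (φ z₀) := by
  refine hC.metric.ext_of_apply hC.mem fun w ↦ ?_
  have h1 := hC.metric.two_mul_apply_nabla hC.mem (hC.homothetic _ hC.mem) v w
  rw [hC.curl_tangent_left hN hv] at h1
  rw [map_add, map_smul, add_apply, smul_apply, smul_eq_mul]
  linarith

/-- The orthogonal complement of X^⊥ is the line through X; pairing with N reads off the
coefficient. -/
lemma eq_smul_of_orthogonal {u : E} (h : ∀ b, G (φ z₀) (X (φ z₀)) b = 0 → G (φ z₀) u b = 0) :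
    u = G (φ z₀) u N • X (φ z₀) := by
  refine hC.metric.ext_of_apply hC.mem fun w ↦ ?_
  have := h (w - G (φ z₀) (X (φ z₀)) w • N) (by simp [hN])
  rw [map_sub, map_smul, smul_eq_mul] at this
  rw [map_smul, smul_apply, smul_eq_mul]
  linarith

/-- Differentiate dα(a,b) = 0 along the cone, extending a and b by coordinate fields. Their
covariant derivatives need not be tangential, and `curl_tangent_left` sees them only through their
value under α. -/
lemma nablaSq_tangent {a b c : E} (ha : G (φ z₀) (X (φ z₀)) a = 0)
    (hb : G (φ z₀) (X (φ z₀)) b = 0) (hc : G (φ z₀) (X (φ z₀)) c = 0) :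
    2 * G (φ z₀) (nablaSq G X (φ z₀) c a) b =
      G (φ z₀) c b * curl G X (φ z₀) a N - G (φ z₀) c a * curl G X (φ z₀) b N := by
  obtain ⟨a', rfl⟩ := hC.mem_range a ha
  obtain ⟨b', rfl⟩ := hC.mem_range b hb
  obtain ⟨c', rfl⟩ := hC.mem_range c hc
  have hd : ∀ v, DifferentiableAt ℝ (fun z ↦ fderiv ℝ φ z v) z₀ := fun v ↦
    hC.contDiffAt.self_of_nhds.differentiableAt_fderiv.clm_apply (differentiableAt_const v)
  have h1 := hC.metric.fderiv_curl_along hC.mem hC.differentiableAt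
    (hC.contDiffAt_field hC.mem) (hC.eventually_homothetic hC.mem) (hd a') (hd b') c'
  have e : (fun z ↦ curl G X (φ z) (fderiv ℝ φ z a') (fderiv ℝ φ z b')) =ᶠ[𝓝 z₀] fun _ ↦ 0 :=
    hC.eventually_curl_tangent.mono fun z hz ↦ hz a' b'
  -- α(∇_c v) = −G(∇_cX, v), and this is −G(c,v) because dα(c,v) = 0.
  have key : ∀ v, G (φ z₀) (X (φ z₀)) (fderiv ℝ φ z₀ v) = 0 →
      G (φ z₀) (X (φ z₀)) (covAlong G φ (fun z ↦ fderiv ℝ φ z v) z₀ c') =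
      - G (φ z₀) (fderiv ℝ φ z₀ c') (fderiv ℝ φ z₀ v) := by
    intro v hv
    have h2 := hC.eventually_tangent.self_of_nhds v c'
    have h3 := hC.metric.two_mul_apply_nabla hC.mem (hC.homothetic _ hC.mem)
      (fderiv ℝ φ z₀ c') (fderiv ℝ φ z₀ v)
    rw [hC.curl_tangent hc hv] at h3
    linarith
  rw [e.fderiv_eq, hC.metric.curl_swap hC.mem (covAlong G φ (fun z ↦ fderiv ℝ φ z a') z₀ c'),
    hC.curl_tangent_left hN hb, hC.curl_tangent_left hN ha, key a' ha, key b' hb] at h1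
  simp only [fderiv_fun_const, Pi.zero_apply, zero_apply] at h1
  linarith

/-- Brings ∇²X(·,w) on the tangent hyperplane into the shape required by `trace_eq_of_forall_ker`.
Here B is dual to dα(·,N). The coefficient of X stays implicit, since the trace involves only its
value at v = X. -/
lemma nablaSq_eq_of_tangent {v w B : E} (hB : ∀ u, G (φ z₀) B u = curl G X (φ z₀) u N)
    (hv : G (φ z₀) (X (φ z₀)) v = 0) (hw : G (φ z₀) (X (φ z₀)) w = 0) :
    (2 : ℝ) • nablaSq G X (φ z₀) v w = curl G X (φ z₀) w N • v +
      G (φ z₀) ((2 : ℝ) • nablaSq G X (φ z₀) v w - curl G X (φ z₀) w N • v +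
        G (φ z₀) v w • B) N • X (φ z₀) - G (φ z₀) v w • B := by
  have h := hC.eq_smul_of_orthogonal hN (u := (2 : ℝ) • nablaSq G X (φ z₀) v w -
    curl G X (φ z₀) w N • v + G (φ z₀) v w • B) fun b hb ↦ by
      have := hC.nablaSq_tangent hN hw hb hv
      simp only [map_add, map_sub, map_smul, add_apply, sub_apply, smul_apply, smul_eq_mul, hB]
      linarith
  rw [← h]
  abel

/-- The trace formula for T = 2R(·,X)w. The multiple of the identity contributes dim E − 1 times
dα(w,N). The coefficient of X contributes −1 times it because R(X,X)w = 0, and G(B,w) another −1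
times it. The remaining two terms come from the complement N. -/
lemma two_mul_trace_riemannMap {w : E} (hw : G (φ z₀) (X (φ z₀)) w = 0) :
    2 * LinearMap.trace ℝ E (riemannMap G (φ z₀) (X (φ z₀)) w) =
      (Module.finrank ℝ E - 3) * curl G X (φ z₀) w N + curl G X (φ z₀) (X (φ z₀)) N *
        G (φ z₀) N w + 2 * G (φ z₀) (nablaSq G X (φ z₀) N w) (X (φ z₀)) := by
  have hX := hC.contDiffAt_field hC.mem
  have hR : ∀ v, nablaSq G X (φ z₀) v w = riemannMap G (φ z₀) (X (φ z₀)) w v :=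
    fun v ↦ hC.metric.nablaSq_eq_riemann hX hC.mem (hC.eventually_homothetic hC.mem) v w
  have hRX : riemannMap G (φ z₀) (X (φ z₀)) w (X (φ z₀)) = 0 := riemann_self _ _
  let B := (G (φ z₀)).inverse (curlForm G X (φ z₀) N)
  have hB : ∀ u, G (φ z₀) B u = curl G X (φ z₀) u N := fun u ↦ by
    rw [hC.metric.apply_inverse hC.mem, curlForm_apply]
  let T := (2 : ℝ) • riemannMap G (φ z₀) (X (φ z₀)) w
  let k : E →ₗ[ℝ] ℝ := ((G (φ z₀)).flip w : E →L[ℝ] ℝ)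
  let gN : E →ₗ[ℝ] ℝ := ((G (φ z₀)).flip N : E →L[ℝ] ℝ)
  let l : E →ₗ[ℝ] ℝ := gN ∘ₗ (T - curl G X (φ z₀) w N • LinearMap.id + k.smulRight B)
  have h := trace_eq_of_forall_ker (T := T) (a := (G (φ z₀) (X (φ z₀)) : E →ₗ[ℝ] ℝ)) (l := l)
    (k := k) (μ := curl G X (φ z₀) w N) (N := N) (X := X (φ z₀)) (B := B) hN fun v hv ↦ by
      have := hC.nablaSq_eq_of_tangent hN hB hv hw
      rw [hR] at this
      exact this
  have hlX : l (X (φ z₀)) = - curl G X (φ z₀) w N := by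
    have : l (X (φ z₀)) = G (φ z₀) ((2 : ℝ) • riemannMap G (φ z₀) (X (φ z₀)) w (X (φ z₀)) -
      curl G X (φ z₀) w N • X (φ z₀) + G (φ z₀) (X (φ z₀)) w • B) N := rfl
    rw [this, hRX, hw]
    simp [hN]
  have hk : ∀ v, k v = G (φ z₀) v w := fun v ↦ rfl
  have hTN : T N = (2 : ℝ) • nablaSq G X (φ z₀) N w := by rw [hR]; rfl
  rw [map_smul, smul_eq_mul, hTN] at h
  rw [h]
  simp only [ContinuousLinearMap.coe_coe, hC.null, zero_smul, sub_zero, hlX, map_sub, map_smul,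
    smul_eq_mul, hk]
  rw [sub_apply, smul_apply, smul_eq_mul, hB, hC.metric.symm _ hC.mem (X (φ z₀)) B, hB,
    hC.metric.symm _ hC.mem (X (φ z₀)) (nablaSq G X (φ z₀) N w)]
  ring

/-- For w = X the last term of the general formula vanishes by skewness of ∇²X, and G(N,X) = 1
raises the factor dim E − 3 to dim E − 2. -/
lemma two_mul_trace_riemannMap_self :
    2 * LinearMap.trace ℝ E (riemannMap G (φ z₀) (X (φ z₀)) (X (φ z₀))) =
      (Module.finrank ℝ E - 2) * curl G X (φ z₀) (X (φ z₀)) N := by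
  have h := hC.metric.nablaSq_skew (hC.contDiffAt_field hC.mem) hC.mem
    (hC.eventually_homothetic hC.mem) N (X (φ z₀)) (X (φ z₀))
  rw [hC.metric.symm _ hC.mem (X (φ z₀))] at h
  rw [hC.two_mul_trace_riemannMap hN hC.null, hC.metric.symm _ hC.mem N, hN]
  linarith

/-- Differentiating dα(X,N) = 0 in the direction w, with ∇_wX = w + ½dα(w,N)X, gives 2G(∇²X(w,X),N)
= −dα(w,N). In the cyclic identity ∇²X(X,N) = R(X,X)N vanishes, so the last term of the general
trace formula equals dα(w,N) and raises the factor to dim E − 2. -/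
lemma two_mul_trace_riemannMap_tangent {w : E} (hw : G (φ z₀) (X (φ z₀)) w = 0)
    (h : ∀ᶠ z in 𝓝 z₀, ∀ v, curl G X (φ z) (X (φ z)) v = 0) :
    2 * LinearMap.trace ℝ E (riemannMap G (φ z₀) (X (φ z₀)) w) =
      (Module.finrank ℝ E - 2) * curl G X (φ z₀) w N := by
  have hX := hC.contDiffAt_field hC.mem
  have h0 := h.self_of_nhds
  obtain ⟨w', hw'⟩ := hC.mem_range w hw
  have hXd : DifferentiableAt ℝ X (φ z₀) := hX.differentiableAt (by simp)
  have h1 := hC.metric.fderiv_curl_along hC.mem hC.differentiableAt hX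
    (hC.eventually_homothetic hC.mem) (hXd.comp z₀ hC.differentiableAt)
    (differentiableAt_const N) w'
  have e : (fun z ↦ curl G X (φ z) ((X ∘ φ) z) N) =ᶠ[𝓝 z₀] fun _ ↦ 0 := h.mono fun z hz ↦ hz N
  have h2 := hC.metric.nablaSq_cyclic hX hC.mem (hC.eventually_homothetic hC.mem) N w (X (φ z₀))
  have h3 : nablaSq G X (φ z₀) (X (φ z₀)) N = 0 := by
    rw [hC.metric.nablaSq_eq_riemann hX hC.mem (hC.eventually_homothetic hC.mem), riemann_self]
  have h4 : covAlong G φ (X ∘ φ) z₀ w' = nabla G X (φ z₀) w := by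
    rw [← hw']
    exact covAlong_comp hXd hC.differentiableAt w'
  rw [e.fderiv_eq, h4, hC.nabla_tangent hN hw, curl_add_left, curl_smul_left, hw'] at h1
  simp only [Function.comp_apply, h0, fderiv_fun_const, Pi.zero_apply, zero_apply] at h1
  rw [h3, map_zero, zero_apply] at h2
  rw [hC.two_mul_trace_riemannMap hN hw, h0]
  linarith

-- Along the cone dα vanishes on all vectors, hence its tangential covariant derivatives vanish, and
-- these are 2∇²X(c,·).
omit hN in
lemma nablaSq_eq_zero (h : ∀ᶠ z in 𝓝 z₀, ∀ v w, curl G X (φ z) v w = 0) {c : E}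
    (hc : G (φ z₀) (X (φ z₀)) c = 0) (a : E) : nablaSq G X (φ z₀) c a = 0 := by
  have h0 := h.self_of_nhds
  obtain ⟨c', rfl⟩ := hC.mem_range c hc
  refine hC.metric.nondegenerate _ hC.mem _ fun b ↦ ?_
  have h1 := hC.metric.fderiv_curl_along hC.mem hC.differentiableAt (hC.contDiffAt_field hC.mem)
    (hC.eventually_homothetic hC.mem) (differentiableAt_const a) (differentiableAt_const b) c'
  have e : (fun z ↦ curl G X (φ z) a b) =ᶠ[𝓝 z₀] fun _ ↦ 0 := h.mono fun z hz ↦ hz a b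
  rw [e.fderiv_eq] at h1
  simp only [h0, fderiv_fun_const, Pi.zero_apply, zero_apply] at h1
  linarith

omit hN in
/-- If `dα` vanishes along the cone, so does `R(v, w) X` for tangential `v`, `w`. -/
lemma riemann_field (h : ∀ᶠ z in 𝓝 z₀, ∀ v w, curl G X (φ z) v w = 0) {v w : E}
    (hv : G (φ z₀) (X (φ z₀)) v = 0) (hw : G (φ z₀) (X (φ z₀)) w = 0) :
    riemann G (φ z₀) v w (X (φ z₀)) = 0 := by
  rw [← hC.metric.nablaSq_sub (hC.contDiffAt_field hC.mem) hC.mem, hC.nablaSq_eq_zero h hv,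
    hC.nablaSq_eq_zero h hw, sub_zero]

-- R(X,w) = −R(w,X) = −∇²X(w,·), and the direction w is tangential.
omit hN in
lemma riemann_field_left (h : ∀ᶠ z in 𝓝 z₀, ∀ v w, curl G X (φ z) v w = 0) {w z : E}
    (hw : G (φ z₀) (X (φ z₀)) w = 0) :
    riemann G (φ z₀) (X (φ z₀)) w z = 0 := by
  rw [IsCoordMetric.riemann_swap, ← hC.metric.nablaSq_eq_riemann (hC.contDiffAt_field hC.mem) hC.mem
    (hC.eventually_homothetic hC.mem), hC.nablaSq_eq_zero h hw, neg_zero]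

omit hN in
/-- If `dα` vanishes along the cone, the curvature with one tangential argument maps tangential
vectors to tangential vectors. -/
lemma riemann_tangent (h : ∀ᶠ z in 𝓝 z₀, ∀ v w, curl G X (φ z) v w = 0) {v w z : E}
    (hw : G (φ z₀) (X (φ z₀)) w = 0) (hz : G (φ z₀) (X (φ z₀)) z = 0) :
    G (φ z₀) (X (φ z₀)) (riemann G (φ z₀) v w z) = 0 := by
  have hX := hC.contDiffAt_field hC.mem
  -- Skewness reduces the claim to G(R(v,w)X, z) = 0. As w is tangential, R(v,w)X = ∇²X(v,w); in the
  -- cyclic identity the other two terms vanish because w and z are tangential. The vector v is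
  -- arbitrary, as the Ricci trace requires.
  have hs := hC.metric.riemann_skew hC.mem v w (X (φ z₀)) z
  have hc := hC.metric.nablaSq_cyclic hX hC.mem (hC.eventually_homothetic hC.mem) v w z
  have h1 := hC.metric.nablaSq_sub hX hC.mem v w
  rw [hC.nablaSq_eq_zero h hw, sub_zero] at h1
  rw [hC.nablaSq_eq_zero h hw, hC.nablaSq_eq_zero h hz, h1] at hc
  simp only [map_zero, zero_apply, add_zero] at hc
  linarith

end IsNullCone

end Cone

/-! ### Tangent vectors and metrics in preferred charts -/

section Charts

variable {m : ℕ} {A : Type*} [TopologicalSpace A] [ChartedSpace (EuclideanSpace ℝ (Fin m)) A]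

/-- The derivative at `a` of the preferred chart at `u`. -/
def tangentChart (u a : A) : TangentSpace (𝓡 m) a →L[ℝ] EuclideanSpace ℝ (Fin m) :=
  mfderiv (𝓡 m) 𝓘(ℝ, EuclideanSpace ℝ (Fin m)) (extChartAt (𝓡 m) u) a

variable [IsManifold (𝓡 m) ∞ A] {u a : A} {y : EuclideanSpace ℝ (Fin m)}

lemma isManifold_one : IsManifold (𝓡 m) 1 A := IsManifold.of_le (n := ∞) (by simp)

/-- A tangent vector at u is its own coordinate vector in the preferred chart at u. Through this,
coordinate identities at the centre of a chart become identities between tensors. -/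
lemma tangentChart_self (u : A) (v : TangentSpace (𝓡 m) u) : tangentChart u u v = v := by
  have := isManifold_one (m := m) (A := A)
  have := mfderiv_extChartAt_self (I := 𝓡 m) (x := u)
  exact congrArg (fun L : EuclideanSpace ℝ (Fin m) →L[ℝ] EuclideanSpace ℝ (Fin m) ↦ L v) this

lemma trivializationAt_snd (ζ : TangentBundle (𝓡 m) A)
    (h : ζ.proj ∈ (extChartAt (𝓡 m) u).source) :
    (trivializationAt (EuclideanSpace ℝ (Fin m)) (TangentSpace (𝓡 m)) u ζ).2 =
      tangentChart u ζ.proj ζ.2 := by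
  have := isManifold_one (m := m) (A := A)
  rw [extChartAt_source] at h
  have := TangentBundle.continuousLinearMapAt_trivializationAt (I := 𝓡 m) h
  rw [tangentChart, ← this, Trivialization.continuousLinearMapAt_apply,
    Trivialization.linearMapAt_apply, if_pos]
  exact h

lemma mdifferentiableAt_extChartAt_symm (h : y ∈ (extChartAt (𝓡 m) u).target) :
    MDifferentiableAt 𝓘(ℝ, EuclideanSpace ℝ (Fin m)) (𝓡 m) (extChartAt (𝓡 m) u).symm y := by
  have := isManifold_one (m := m) (A := A)
  have := mdifferentiableWithinAt_extChartAt_symm (I := 𝓡 m) h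
  rwa [ModelWithCorners.range_eq_univ, mdifferentiableWithinAt_univ] at this

lemma tangentChart_chartFrame (h : y ∈ (extChartAt (𝓡 m) u).target)
    (v : EuclideanSpace ℝ (Fin m)) :
    tangentChart u ((extChartAt (𝓡 m) u).symm y) (chartFrame u y v) = v := by
  have := isManifold_one (m := m) (A := A)
  have := mfderiv_extChartAt_comp_mfderivWithin_extChartAt_symm (I := 𝓡 m) h
  rw [ModelWithCorners.range_eq_univ, mfderivWithin_univ] at this
  exact congrArg (fun L : EuclideanSpace ℝ (Fin m) →L[ℝ] EuclideanSpace ℝ (Fin m) ↦ L v) this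

lemma chartFrame_tangentChart (h : a ∈ (extChartAt (𝓡 m) u).source)
    (v : TangentSpace (𝓡 m) a) :
    (chartFrame u (extChartAt (𝓡 m) u a) (tangentChart u a v) : EuclideanSpace ℝ (Fin m)) = v := by
  have := isManifold_one (m := m) (A := A)
  have := mfderivWithin_extChartAt_symm_comp_mfderiv_extChartAt' (I := 𝓡 m) h
  rw [ModelWithCorners.range_eq_univ, mfderivWithin_univ] at this
  exact congrArg (fun L : EuclideanSpace ℝ (Fin m) →L[ℝ] EuclideanSpace ℝ (Fin m) ↦ L v) this

lemma chartMetric_apply (h : ∀ u : A, TangentSpace (𝓡 m) u →L[ℝ] TangentSpace (𝓡 m) u →L[ℝ] ℝ)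
    (y v w : EuclideanSpace ℝ (Fin m)) : chartMetric h u y v w =
      h ((extChartAt (𝓡 m) u).symm y) (chartFrame u y v) (chartFrame u y w) := rfl

/-- Tangent spaces at equal points are the same model space; this transports h along equalities of
points that are not definitional, such as those from `left_inv`. -/
lemma apply_congr_point
    (h : ∀ u : A, TangentSpace (𝓡 m) u →L[ℝ] TangentSpace (𝓡 m) u →L[ℝ] ℝ)
    {a b : A} (hab : a = b) (v w : EuclideanSpace ℝ (Fin m)) :
    h a (show TangentSpace (𝓡 m) a from v) (show TangentSpace (𝓡 m) a from w) =
    h b (show TangentSpace (𝓡 m) b from v) (show TangentSpace (𝓡 m) b from w) := by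
  subst hab; rfl

lemma chartMetric_tangentChart
    (h : ∀ u : A, TangentSpace (𝓡 m) u →L[ℝ] TangentSpace (𝓡 m) u →L[ℝ] ℝ)
    (ha : a ∈ (extChartAt (𝓡 m) u).source) (v w : TangentSpace (𝓡 m) a) :
    chartMetric h u (extChartAt (𝓡 m) u a) (tangentChart u a v) (tangentChart u a w) =
      h a v w := by
  rw [chartMetric_apply]
  have h1 := chartFrame_tangentChart ha v
  have h2 := chartFrame_tangentChart ha w
  have h3 := apply_congr_point h ((extChartAt (𝓡 m) u).left_inv ha)
    (chartFrame u (extChartAt (𝓡 m) u a) (tangentChart u a v))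
    (chartFrame u (extChartAt (𝓡 m) u a) (tangentChart u a w))
  refine h3.trans ?_
  rw [h1, h2]

lemma contMDiffAt_chartFrame (h : y ∈ (extChartAt (𝓡 m) u).target)
    (v : EuclideanSpace ℝ (Fin m)) :
    ContMDiffAt 𝓘(ℝ, EuclideanSpace ℝ (Fin m)) (𝓡 m).tangent ∞
      (fun y ↦ (⟨(extChartAt (𝓡 m) u).symm y, chartFrame u y v⟩ : TangentBundle (𝓡 m) A)) y := by
  have h1 : ContMDiffOn 𝓘(ℝ, EuclideanSpace ℝ (Fin m)) (𝓡 m) ∞ (extChartAt (𝓡 m) u).symm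
    (extChartAt (𝓡 m) u).target := contMDiffOn_extChartAt_symm u
  have hO : IsOpen (extChartAt (𝓡 m) u).target := isOpen_extChartAt_target u
  have h2 := h1.contMDiffOn_tangentMapWithin (m := ∞) (by simp) hO.uniqueMDiffOn
  have h3 : ContMDiff 𝓘(ℝ, EuclideanSpace ℝ (Fin m)) 𝓘(ℝ, EuclideanSpace ℝ (Fin m)).tangent ∞
      (fun y ↦ (⟨y, v⟩ : TangentBundle 𝓘(ℝ, EuclideanSpace ℝ (Fin m))
        (EuclideanSpace ℝ (Fin m)))) :=
    contMDiff_vectorSpace_iff_contDiff.2 contDiff_const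
  have h4 := h2.comp (s := (extChartAt (𝓡 m) u).target) h3.contMDiffOn fun y hy ↦ hy
  refine (h4.contMDiffAt (hO.mem_nhds h)).congr_of_eventuallyEq ?_
  filter_upwards [hO.mem_nhds h] with y hy
  simp only [Function.comp_apply, tangentMapWithin, chartFrame]
  rw [mfderivWithin_of_isOpen hO hy]
  rfl

variable {p q : ℕ} {h : ∀ u : A, TangentSpace (𝓡 m) u →L[ℝ] TangentSpace (𝓡 m) u →L[ℝ] ℝ}

/-- A smooth metric on a manifold is a smooth metric in every preferred chart. -/
lemma IsPseudoMetric.isCoordMetric (hh : IsPseudoMetric (𝓡 m) (EuclideanSpace ℝ (Fin m))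
    (TangentSpace (𝓡 m) : A → Type _) p q h) (u : A) :
    IsCoordMetric (chartMetric h u) (extChartAt (𝓡 m) u).target where
  isOpen := isOpen_extChartAt_target u
  contDiffOn := by
    refine contDiffOn_clm_apply.2 fun v ↦ contDiffOn_clm_apply.2 fun w y hy ↦
      ContDiffAt.contDiffWithinAt ?_
    have h1 : ContMDiffAt 𝓘(ℝ, EuclideanSpace ℝ (Fin m)) (𝓡 m) ∞ (extChartAt (𝓡 m) u).symm y :=
      (contMDiffOn_extChartAt_symm u).contMDiffAt ((isOpen_extChartAt_target u).mem_nhds hy)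
    have h2 := (hh.contMDiff ((extChartAt (𝓡 m) u).symm y)).comp y h1
    have h3 := ContMDiffAt.clm_bundle_apply₂ (F₁ := EuclideanSpace ℝ (Fin m))
      (F₂ := EuclideanSpace ℝ (Fin m)) (F₃ := ℝ) (E₃ := Trivial A ℝ)
      h2 (contMDiffAt_chartFrame hy v) (contMDiffAt_chartFrame hy w)
    rw [contMDiffAt_totalSpace] at h3
    exact h3.2.contDiffAt
  symm y _ v w := hh.symm _ _ _
  nondegenerate y hy v hv := by
    have h1 : ∀ w : TangentSpace (𝓡 m) ((extChartAt (𝓡 m) u).symm y),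
        h ((extChartAt (𝓡 m) u).symm y) (chartFrame u y v) w = 0 := by
      intro w
      have h2 := hv (tangentChart u ((extChartAt (𝓡 m) u).symm y) w)
      rw [chartMetric_apply] at h2
      have h3 := chartFrame_tangentChart ((extChartAt (𝓡 m) u).map_target hy) w
      rw [(extChartAt (𝓡 m) u).right_inv hy] at h3
      rw [← h2]
      exact congrArg _ h3.symm
    have h2 := hh.nondegenerate _ _ h1
    have h3 := tangentChart_chartFrame hy v
    rw [h2, map_zero] at h3
    exact h3.symm

end Charts

/-! ### Maps between manifolds in charts -/

section ChartMaps

variable {m m' : ℕ} {A : Type*} [TopologicalSpace A] [ChartedSpace (EuclideanSpace ℝ (Fin m)) A]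
  {B : Type*} [TopologicalSpace B] [ChartedSpace (EuclideanSpace ℝ (Fin m')) B]

/-- The expression of a map in the preferred charts at `u` and `v`. -/
def chartMap (ψ : A → B) (u : A) (v : B) (y : EuclideanSpace ℝ (Fin m)) :
    EuclideanSpace ℝ (Fin m') :=
  extChartAt (𝓡 m') v (ψ ((extChartAt (𝓡 m) u).symm y))

variable [IsManifold (𝓡 m) ∞ A] [IsManifold (𝓡 m') ∞ B] {ψ : A → B} {u a : A} {v : B}

lemma chartMap_apply (ha : a ∈ (extChartAt (𝓡 m) u).source) :
    chartMap (m := m) (m' := m') ψ u v (extChartAt (𝓡 m) u a) = extChartAt (𝓡 m') v (ψ a) := by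
  rw [chartMap, (extChartAt (𝓡 m) u).left_inv ha]

lemma contDiffAt_chartMap (ha : a ∈ (extChartAt (𝓡 m) u).source)
    (hv : ψ a ∈ (extChartAt (𝓡 m') v).source) (hψ : ContMDiffAt (𝓡 m) (𝓡 m') ∞ ψ a) :
    ContDiffAt ℝ ∞ (chartMap (m := m) (m' := m') ψ u v) (extChartAt (𝓡 m) u a) := by
  have hl := (extChartAt (𝓡 m) u).left_inv ha
  have h1 : ContMDiffAt (𝓡 m) (𝓡 m) ∞ (extChartAt (𝓡 m) u).symm (extChartAt (𝓡 m) u a) :=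
    (contMDiffOn_extChartAt_symm u).contMDiffAt
      ((isOpen_extChartAt_target u).mem_nhds ((extChartAt (𝓡 m) u).map_source ha))
  have h2 : ContMDiffAt (𝓡 m') (𝓡 m') ∞ (extChartAt (𝓡 m') v) (ψ a) := by
    rw [extChartAt_source] at hv
    exact contMDiffAt_extChartAt' hv
  have h3 : ContMDiffAt (𝓡 m) (𝓡 m') ∞ (chartMap (m := m) (m' := m') ψ u v) (extChartAt (𝓡 m) u a) := by
    refine ContMDiffAt.comp (g := extChartAt (𝓡 m') v) (I' := 𝓡 m') _ ?_
      (ContMDiffAt.comp (g := ψ) (I' := 𝓡 m) _ ?_ h1)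
    · rw [hl]
      exact h2
    · rw [hl]
      exact hψ
  exact h3.contDiffAt

lemma mfderiv_congr_base (ψ : A → B) {a b : A} (h : a = b) (v : EuclideanSpace ℝ (Fin m)) :
    (mfderiv (𝓡 m) (𝓡 m') ψ a (show TangentSpace (𝓡 m) a from v) : EuclideanSpace ℝ (Fin m')) =
      (mfderiv (𝓡 m) (𝓡 m') ψ b (show TangentSpace (𝓡 m) b from v) :
        EuclideanSpace ℝ (Fin m')) := by
  subst h; rfl

lemma mdifferentiableAt_extChartAt_of_mem (ha : a ∈ (extChartAt (𝓡 m) u).source) :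
    MDifferentiableAt (𝓡 m) 𝓘(ℝ, EuclideanSpace ℝ (Fin m)) (extChartAt (𝓡 m) u) a := by
  have := isManifold_one (m := m) (A := A)
  rw [extChartAt_source] at ha
  exact mdifferentiableAt_extChartAt ha

section General

variable {EN : Type*} [NormedAddCommGroup EN] [NormedSpace ℝ EN]
    {HN : Type*} [TopologicalSpace HN] {IN : ModelWithCorners ℝ EN HN}
    {N : Type*} [TopologicalSpace N] [ChartedSpace HN N]

section Vector

variable {F : Type*} [NormedAddCommGroup F] [NormedSpace ℝ F]
  {F' : Type*} [NormedAddCommGroup F'] [NormedSpace ℝ F']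

lemma mvfderiv_apply (f : N → F) (z : N) (w : TangentSpace IN z) :
    mvfderiv IN f z w = (mfderiv IN 𝓘(ℝ, F) f z w : F) := rfl

lemma mvfderiv_congr {f g : N → F} {z : N} (h : f =ᶠ[𝓝 z] g) : mvfderiv IN f z = mvfderiv IN g z :=
  congrArg (fun L : EN →L[ℝ] F ↦ L) (h.mfderiv_eq (I := IN) (I' := 𝓘(ℝ, F)))

lemma mvfderiv_eq_fderiv (f : F → F') (z : F) : mvfderiv 𝓘(ℝ, F) f z = fderiv ℝ f z :=
  congrArg (fun L : F →L[ℝ] F' ↦ L) (mfderiv_eq_fderiv (f := f) (x := z))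

lemma _root_.HasMFDerivAt.mvfderiv_apply {f : N → F} {z : N} {f' : EN →L[ℝ] F}
    (h : HasMFDerivAt IN 𝓘(ℝ, F) f z f') (w : TangentSpace IN z) : mvfderiv IN f z w = f' w :=
  congrArg (fun L : EN →L[ℝ] F ↦ L w) h.mfderiv

lemma mvfderiv_fderiv_comp {f : F → F'} {g : N → F} {z : N} (hf : DifferentiableAt ℝ f (g z))
    (hg : MDifferentiableAt IN 𝓘(ℝ, F) g z) (w : TangentSpace IN z) :
    mvfderiv IN (fun y ↦ f (g y)) z w = fderiv ℝ f (g z) (mvfderiv IN g z w) :=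
  (hf.hasFDerivAt.hasMFDerivAt.comp z hg.hasMFDerivAt).mvfderiv_apply w

lemma mvfderiv_fderiv_comp₂ {f : F × F → F'} {g k : N → F} {z : N}
    (hf : DifferentiableAt ℝ f (g z, k z))
    (hg : MDifferentiableAt IN 𝓘(ℝ, F) g z) (hk : MDifferentiableAt IN 𝓘(ℝ, F) k z)
    (w : TangentSpace IN z) :
    mvfderiv IN (fun y ↦ f (g y, k y)) z w =
      fderiv ℝ f (g z, k z) (mvfderiv IN g z w, mvfderiv IN k z w) := by
  have h : HasMFDerivAt IN 𝓘(ℝ, F × F) (fun y ↦ (g y, k y)) z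
      ((mvfderiv IN g z).prod (mvfderiv IN k z)) :=
    ⟨hg.hasMFDerivAt.1.prodMk hk.hasMFDerivAt.1, hg.hasMFDerivAt.2.prodMk hk.hasMFDerivAt.2⟩
  have h1 := mvfderiv_fderiv_comp (g := fun y ↦ (g y, k y)) hf (hg.prodMk_space hk) w
  refine h1.trans ?_
  rw [h.mvfderiv_apply]
  rfl

end Vector

lemma mvfderiv_extChartAt_comp {c : N → A} {z : N} (hz : c z ∈ (extChartAt (𝓡 m) u).source)
    (hc : MDifferentiableAt IN (𝓡 m) c z) (w : TangentSpace IN z) :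
    mvfderiv IN (fun y ↦ extChartAt (𝓡 m) u (c y)) z w = tangentChart u (c z) (mfderiv IN (𝓡 m) c z w) := by
  have := mfderiv_comp z (mdifferentiableAt_extChartAt_of_mem hz) hc
  exact congrArg (fun L : EN →L[ℝ] EuclideanSpace ℝ (Fin m) ↦ L w) this

end General

lemma fderiv_chartMap (ha : a ∈ (extChartAt (𝓡 m) u).source)
    (hv : ψ a ∈ (extChartAt (𝓡 m') v).source) (hψ : MDifferentiableAt (𝓡 m) (𝓡 m') ψ a)
    (w : TangentSpace (𝓡 m) a) :
    fderiv ℝ (chartMap (m := m) (m' := m') ψ u v) (extChartAt (𝓡 m) u a) (tangentChart u a w) =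
      tangentChart v (ψ a) (mfderiv (𝓡 m) (𝓡 m') ψ a w) := by
  have h0 : MDifferentiableAt (𝓡 m) 𝓘(ℝ, EuclideanSpace ℝ (Fin m')) (chartMap (m := m) (m' := m') ψ u v)
      (extChartAt (𝓡 m) u a) := by
    refine MDifferentiableAt.comp (g := extChartAt (𝓡 m') v) (I' := 𝓡 m') _ ?_
      (MDifferentiableAt.comp (g := ψ) (I' := 𝓡 m) _ ?_
        (mdifferentiableAt_extChartAt_symm ((extChartAt (𝓡 m) u).map_source ha)))
    · rw [(extChartAt (𝓡 m) u).left_inv ha]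
      exact mdifferentiableAt_extChartAt_of_mem hv
    · rw [(extChartAt (𝓡 m) u).left_inv ha]
      exact hψ
  have h1 := mfderiv_comp a h0 (mdifferentiableAt_extChartAt_of_mem (u := u) ha)
  have h2 : chartMap (m := m) (m' := m') ψ u v ∘ extChartAt (𝓡 m) u =ᶠ[𝓝 a]
      fun b ↦ extChartAt (𝓡 m') v (ψ b) := by
    filter_upwards [extChartAt_source_mem_nhds' ha] with b hb
    exact chartMap_apply hb
  rw [h2.mfderiv_eq] at h1
  have h3 := mvfderiv_extChartAt_comp hv hψ w
  rw [← h3, mvfderiv_apply, h1, mfderiv_eq_fderiv]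
  rfl

end ChartMaps

/-! ### Naturality of the covariant derivative along a map -/

section CovDeriv

variable {m : ℕ} {A : Type*} [TopologicalSpace A] [ChartedSpace (EuclideanSpace ℝ (Fin m)) A]
  [IsManifold (𝓡 m) ∞ A]
  (h : ∀ u : A, TangentSpace (𝓡 m) u →L[ℝ] TangentSpace (𝓡 m) u →L[ℝ] ℝ)
  {EN : Type*} [NormedAddCommGroup EN] [NormedSpace ℝ EN]
    {HN : Type*} [TopologicalSpace HN] (IN : ModelWithCorners ℝ EN HN)
    {N : Type*} [TopologicalSpace N] [ChartedSpace HN N]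

/-- The vector part of the coordinate expression of a tangent vector in the preferred chart
at `u`. -/
def vecCoord (u : A) (ζ : TangentBundle (𝓡 m) A) : EuclideanSpace ℝ (Fin m) :=
  (trivializationAt (EuclideanSpace ℝ (Fin m)) (TangentSpace (𝓡 m)) u ζ).2

/-- The coordinate expression of the covariant derivative along a map in the preferred chart
at `u`. -/
def covDerivIn (u : A) (σ : N → TangentBundle (𝓡 m) A) (z : N) (w : TangentSpace IN z) :
    EuclideanSpace ℝ (Fin m) :=
  mvfderiv IN (fun y ↦ vecCoord u (σ y)) z w +
    christoffelMap (chartMetric h u) (extChartAt (𝓡 m) u (σ z).proj)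
      (mvfderiv IN (fun y ↦ extChartAt (𝓡 m) u (σ y).proj) z w)
      (vecCoord u (σ z))

variable {h IN} {u : A} {σ : N → TangentBundle (𝓡 m) A} {z : N}

lemma vecCoord_eq {ζ : TangentBundle (𝓡 m) A} (hζ : ζ.proj ∈ (extChartAt (𝓡 m) u).source) :
    vecCoord u ζ = tangentChart u ζ.proj ζ.2 := trivializationAt_snd ζ hζ

lemma contMDiffAt_vecCoord {ζ : TangentBundle (𝓡 m) A}
    (hζ : ζ.proj ∈ (extChartAt (𝓡 m) u).source) :
    ContMDiffAt (𝓡 m).tangent 𝓘(ℝ, EuclideanSpace ℝ (Fin m)) ∞ (vecCoord u) ζ := by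
  let e := trivializationAt (EuclideanSpace ℝ (Fin m)) (TangentSpace (𝓡 m) : A → Type _) u
  have h1 : ContMDiffOn (𝓡 m).tangent ((𝓡 m).prod 𝓘(ℝ, EuclideanSpace ℝ (Fin m))) ∞ e e.source :=
    e.contMDiffOn
  have h2 : ζ ∈ e.source := by
    rw [e.mem_source, TangentBundle.trivializationAt_baseSet]
    rwa [extChartAt_source] at hζ
  exact contMDiffAt_snd.comp ζ (h1.contMDiffAt (e.open_source.mem_nhds h2))

lemma mdifferentiableAt_base (hσ : MDifferentiableAt IN (𝓡 m).tangent σ z) :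
    MDifferentiableAt IN (𝓡 m) (fun y ↦ (σ y).proj) z :=
  ((contMDiff_proj (IB := 𝓡 m) (n := 1) (TangentSpace (𝓡 m) : A → Type _)).mdifferentiableAt
    (by simp)).comp z hσ

lemma mdifferentiableAt_vecCoord (hσ : MDifferentiableAt IN (𝓡 m).tangent σ z)
    (hu : (σ z).proj ∈ (extChartAt (𝓡 m) u).source) :
    MDifferentiableAt IN 𝓘(ℝ, EuclideanSpace ℝ (Fin m)) (fun y ↦ vecCoord u (σ y)) z :=
  ((contMDiffAt_vecCoord hu).mdifferentiableAt (by simp)).comp z hσ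

lemma covDerivAlong_eq_covDerivIn (hσ : MDifferentiableAt IN (𝓡 m).tangent σ z)
    (w : TangentSpace IN z) :
    (covDerivAlong h IN σ z w : EuclideanSpace ℝ (Fin m)) = covDerivIn h IN (σ z).proj σ z w := by
  have h1 := mvfderiv_extChartAt_comp (c := fun y ↦ (σ y).proj) (z := z)
    (mem_extChartAt_source (I := 𝓡 m) (σ z).proj) (mdifferentiableAt_base hσ) w
  rw [tangentChart_self] at h1
  have h2 := vecCoord_eq (ζ := σ z) (mem_extChartAt_source (I := 𝓡 m) (σ z).proj)
  rw [tangentChart_self] at h2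
  rw [covDerivIn, h1, h2]
  rfl

lemma eventually_proj_mem (hσ : MDifferentiableAt IN (𝓡 m).tangent σ z)
    (hu : (σ z).proj ∈ (extChartAt (𝓡 m) u).source) :
    ∀ᶠ y in 𝓝 z, (σ y).proj ∈ (extChartAt (𝓡 m) u).source := by
  have hm : MDifferentiableAt IN (𝓡 m) (fun y ↦ (σ y).proj) z := mdifferentiableAt_base hσ
  have hc : ContinuousAt (fun y ↦ (σ y).proj) z := hm.continuousAt
  exact hc (extChartAt_source_mem_nhds' hu)

variable {p q : ℕ}

/-- The covariant derivative is natural under maps which are isometric up to a constant factor. -/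
lemma covDerivIn_tangentMap (hh : IsPseudoMetric (𝓡 m) (EuclideanSpace ℝ (Fin m))
    (TangentSpace (𝓡 m) : A → Type _) p q h) {ψ : A → A} (hψ : ContMDiff (𝓡 m) (𝓡 m) ∞ ψ) {l : ℝ}
    (hl : l ≠ 0) (hiso : ∀ a (v w : TangentSpace (𝓡 m) a), h (ψ a)
      (mfderiv (𝓡 m) (𝓡 m) ψ a v) (mfderiv (𝓡 m) (𝓡 m) ψ a w) = l * h a v w)
    (hσ : MDifferentiableAt IN (𝓡 m).tangent σ z)
    (hu : (σ z).proj ∈ (extChartAt (𝓡 m) u).source) {v : A}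
    (hv : ψ (σ z).proj ∈ (extChartAt (𝓡 m) v).source) (w : TangentSpace IN z) :
    covDerivIn h IN v (fun y ↦ tangentMap (𝓡 m) (𝓡 m) ψ (σ y)) z w =
      fderiv ℝ (chartMap (m := m) (m' := m) ψ u v) (extChartAt (𝓡 m) u (σ z).proj) (covDerivIn h IN u σ z w) := by
  have hψd : ∀ a, MDifferentiableAt (𝓡 m) (𝓡 m) ψ a := hψ.mdifferentiable (by simp)
  have hev : ∀ᶠ y in 𝓝 z, ψ (σ y).proj ∈ (extChartAt (𝓡 m) v).source := by
    exact (hψ.continuous.continuousAt.comp (mdifferentiableAt_base hσ).continuousAt)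
      (extChartAt_source_mem_nhds' hv)
  have e1 : (fun y ↦ extChartAt (𝓡 m) v (tangentMap (𝓡 m) (𝓡 m) ψ (σ y)).proj) =ᶠ[𝓝 z]
      fun y ↦ chartMap (m := m) (m' := m) ψ u v (extChartAt (𝓡 m) u (σ y).proj) := by
    filter_upwards [eventually_proj_mem hσ hu] with y hy
    exact (chartMap_apply hy).symm
  have e2 : (fun y ↦ vecCoord v (tangentMap (𝓡 m) (𝓡 m) ψ (σ y))) =ᶠ[𝓝 z]
      fun y ↦ fderiv ℝ (chartMap (m := m) (m' := m) ψ u v) (extChartAt (𝓡 m) u (σ y).proj) (vecCoord u (σ y)) := by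
    filter_upwards [eventually_proj_mem hσ hu, hev] with y hy hy'
    rw [vecCoord_eq hy, fderiv_chartMap hy hy' (hψd _)]
    exact vecCoord_eq (ζ := tangentMap (𝓡 m) (𝓡 m) ψ (σ y)) hy'
  have hc : MDifferentiableAt IN 𝓘(ℝ, EuclideanSpace ℝ (Fin m))
      (fun y ↦ extChartAt (𝓡 m) u (σ y).proj) z :=
    (mdifferentiableAt_extChartAt_of_mem hu).comp z (mdifferentiableAt_base hσ)
  have hb := mdifferentiableAt_vecCoord hσ hu
  have hΨ := contDiffAt_chartMap hu hv hψ.contMDiffAt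
  have d1 := mvfderiv_fderiv_comp (f := chartMap (m := m) (m' := m) ψ u v)
    (g := fun y ↦ extChartAt (𝓡 m) u (σ y).proj) (hΨ.differentiableAt (by simp)) hc w
  have d2 : mvfderiv IN
      (fun y ↦ fderiv ℝ (chartMap (m := m) (m' := m) ψ u v) (extChartAt (𝓡 m) u (σ y).proj)
        (vecCoord u (σ y))) z w =
      fderiv ℝ (fderiv ℝ (chartMap (m := m) (m' := m) ψ u v)) (extChartAt (𝓡 m) u (σ z).proj)
        (mvfderiv IN (fun y ↦ extChartAt (𝓡 m) u (σ y).proj) z w) (vecCoord u (σ z)) +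
      fderiv ℝ (chartMap (m := m) (m' := m) ψ u v) (extChartAt (𝓡 m) u (σ z).proj)
        (mvfderiv IN (fun y ↦ vecCoord u (σ y)) z w) := by
    have h0 : DifferentiableAt ℝ (fun x : EuclideanSpace ℝ (Fin m) × EuclideanSpace ℝ (Fin m) ↦
        fderiv ℝ (chartMap (m := m) (m' := m) ψ u v) x.1)
        (extChartAt (𝓡 m) u (σ z).proj, vecCoord u (σ z)) :=
      hΨ.differentiableAt_fderiv.comp
        (extChartAt (𝓡 m) u (σ z).proj, vecCoord u (σ z)) differentiableAt_fst
    have h1 := mvfderiv_fderiv_comp₂ (g := fun y ↦ extChartAt (𝓡 m) u (σ y).proj)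
      (k := fun y ↦ vecCoord u (σ y)) (h0.clm_apply differentiableAt_snd) hc hb w
    refine h1.trans ?_
    rw [fderiv_clm_apply_apply h0 differentiableAt_snd,
      fderiv_comp_apply (f := fderiv ℝ (chartMap (m := m) (m' := m) ψ u v)) (g := Prod.fst)
        hΨ.differentiableAt_fderiv differentiableAt_fst, fderiv_fst, fderiv_snd]
    rfl
  -- The metric in the chart at u is l⁻¹ times the pull-back of the one at v, whence the inverse
  -- factor. The inhomogeneous D²Ψ term in this law cancels the one that the product rule creates in
  -- `d2`.
  have hT := (hh.isCoordMetric v).fderiv_christoffelMap (hh.isCoordMetric u) (Ψ := chartMap (m := m) (m' := m) ψ u v)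
    (l := l⁻¹) (inv_ne_zero hl) ((extChartAt (𝓡 m) u).map_source hu)
    (by rw [chartMap_apply hu]; exact (extChartAt (𝓡 m) v).map_source hv) hΨ (by
      have hs : ∀ᶠ y in 𝓝 (extChartAt (𝓡 m) u (σ z).proj),
          ψ ((extChartAt (𝓡 m) u).symm y) ∈ (extChartAt (𝓡 m) v).source := by
        have hcont : ContinuousAt (fun y ↦ ψ ((extChartAt (𝓡 m) u).symm y))
            (extChartAt (𝓡 m) u (σ z).proj) :=
          hψ.continuous.continuousAt.comp (continuousAt_extChartAt_symm' hu)
        refine hcont ?_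
        beta_reduce
        rw [(extChartAt (𝓡 m) u).left_inv hu]
        exact extChartAt_source_mem_nhds' hv
      filter_upwards [hs, (isOpen_extChartAt_target (I := 𝓡 m) u).mem_nhds
        ((extChartAt (𝓡 m) u).map_source hu)] with y hy hy' v' w'
      obtain ⟨b, hb, rfl⟩ : ∃ b ∈ (extChartAt (𝓡 m) u).source, extChartAt (𝓡 m) u b = y :=
        ⟨_, (extChartAt (𝓡 m) u).map_target hy', (extChartAt (𝓡 m) u).right_inv hy'⟩
      rw [(extChartAt (𝓡 m) u).left_inv hb] at hy
      have hs := tangentChart_chartFrame hy'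
      have hsurj : ∀ x : EuclideanSpace ℝ (Fin m), ∃ x' : TangentSpace (𝓡 m) b,
          tangentChart u b x' = x := by
        intro x
        have h2 := hs x
        have h3 := (extChartAt (𝓡 m) u).left_inv hb
        generalize chartFrame u (extChartAt (𝓡 m) u b) x = x' at h2
        revert x' h2
        rw [h3]
        exact fun x' h2 ↦ ⟨x', h2⟩
      obtain ⟨v', rfl⟩ := hsurj v'
      obtain ⟨w', rfl⟩ := hsurj w'
      rw [chartMap_apply hb, fderiv_chartMap hb hy (hψd b), fderiv_chartMap hb hy (hψd b),
        chartMetric_tangentChart h hb, chartMetric_tangentChart h hy, hiso]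
      field_simp)
  have e1' := e1.self_of_nhds
  have e2' := e2.self_of_nhds
  beta_reduce at e1' e2'
  rw [covDerivIn, mvfderiv_congr e1, mvfderiv_congr e2, e1', e2', d1, d2, covDerivIn,
    map_add, hT]
  abel

end CovDeriv

/-! ### Chart independence, chain rule and Leibniz rule -/

section CovDeriv

variable {m : ℕ} {A : Type*} [TopologicalSpace A] [ChartedSpace (EuclideanSpace ℝ (Fin m)) A]
  [IsManifold (𝓡 m) ∞ A]
  {h : ∀ u : A, TangentSpace (𝓡 m) u →L[ℝ] TangentSpace (𝓡 m) u →L[ℝ] ℝ}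
  {EN : Type*} [NormedAddCommGroup EN] [NormedSpace ℝ EN]
    {HN : Type*} [TopologicalSpace HN] {IN : ModelWithCorners ℝ EN HN}
    {N : Type*} [TopologicalSpace N] [ChartedSpace HN N]
  {u : A} {σ : N → TangentBundle (𝓡 m) A} {z : N} {p q : ℕ}

/-- Naturality for the identity map with l = 1, read in the charts at the base point of σ z and at
u. -/
lemma covDerivIn_eq (hh : IsPseudoMetric (𝓡 m) (EuclideanSpace ℝ (Fin m))
    (TangentSpace (𝓡 m) : A → Type _) p q h)
    (hσ : MDifferentiableAt IN (𝓡 m).tangent σ z)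
    (hu : (σ z).proj ∈ (extChartAt (𝓡 m) u).source) (w : TangentSpace IN z) :
    covDerivIn h IN u σ z w = tangentChart u (σ z).proj (covDerivAlong h IN σ z w) := by
  have h0 := mem_extChartAt_source (I := 𝓡 m) (σ z).proj
  have h1 := covDerivIn_tangentMap hh (ψ := id) contMDiff_id one_ne_zero
    (fun a v w ↦ by rw [mfderiv_id, one_mul]; rfl) hσ h0 (v := u) hu w
  rw [← covDerivAlong_eq_covDerivIn hσ w, ← tangentChart_self (σ z).proj (covDerivAlong h IN σ z w),
    fderiv_chartMap h0 hu mdifferentiableAt_id] at h1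
  simp only [tangentMap_id, mfderiv_id] at h1
  exact h1

lemma covDerivAlong_tangentMap (hh : IsPseudoMetric (𝓡 m) (EuclideanSpace ℝ (Fin m))
    (TangentSpace (𝓡 m) : A → Type _) p q h) {ψ : A → A} (hψ : ContMDiff (𝓡 m) (𝓡 m) ∞ ψ) {l : ℝ}
    (hl : l ≠ 0) (hiso : ∀ a (v w : TangentSpace (𝓡 m) a), h (ψ a)
      (mfderiv (𝓡 m) (𝓡 m) ψ a v) (mfderiv (𝓡 m) (𝓡 m) ψ a w) = l * h a v w)
    (hσ : MDifferentiableAt IN (𝓡 m).tangent σ z) (w : TangentSpace IN z) :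
    (covDerivAlong h IN (fun y ↦ tangentMap (𝓡 m) (𝓡 m) ψ (σ y)) z w : EuclideanSpace ℝ (Fin m)) =
      mfderiv (𝓡 m) (𝓡 m) ψ (σ z).proj (covDerivAlong h IN σ z w) := by
  have h0 := mem_extChartAt_source (I := 𝓡 m) (σ z).proj
  have h2 := mem_extChartAt_source (I := 𝓡 m) (ψ (σ z).proj)
  have h1 := covDerivIn_tangentMap hh hψ hl hiso hσ h0 h2 w
  have h3 : MDifferentiableAt IN (𝓡 m).tangent (fun y ↦ tangentMap (𝓡 m) (𝓡 m) ψ (σ y)) z :=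
    ((hψ.contMDiff_tangentMap (m := ∞) (by simp)).mdifferentiable (by simp) _).comp z hσ
  rw [← covDerivAlong_eq_covDerivIn hσ w, ← tangentChart_self (σ z).proj (covDerivAlong h IN σ z w),
    fderiv_chartMap h0 h2 (hψ.mdifferentiable (by simp) _), tangentChart_self] at h1
  rw [covDerivAlong_eq_covDerivIn h3]
  exact h1

/-- Both sides use the chart at the same point of A, so only the chain rule for the two coordinate
derivatives is needed. -/
lemma covDerivAlong_comp {EN' : Type*} [NormedAddCommGroup EN'] [NormedSpace ℝ EN']
    {HN' : Type*} [TopologicalSpace HN'] {IN' : ModelWithCorners ℝ EN' HN'}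
    {N' : Type*} [TopologicalSpace N'] [ChartedSpace HN' N'] {k : N' → N} {z : N'}
    (hσ : MDifferentiableAt IN (𝓡 m).tangent σ (k z)) (hk : MDifferentiableAt IN' IN k z)
    (w : TangentSpace IN' z) :
    covDerivAlong h IN' (fun y ↦ σ (k y)) z w =
      covDerivAlong h IN σ (k z) (mfderiv IN' IN k z w) := by
  have h1 := mfderiv_comp z (mdifferentiableAt_vecCoord hσ
    (mem_extChartAt_source (I := 𝓡 m) (σ (k z)).proj)) hk
  have h2 := mfderiv_comp z (g := fun y ↦ (σ y).proj) (mdifferentiableAt_base hσ) hk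
  have h1' := congrArg (fun L : EN' →L[ℝ] EuclideanSpace ℝ (Fin m) ↦ L w) h1
  have h2' := congrArg (fun L : EN' →L[ℝ] EuclideanSpace ℝ (Fin m) ↦ L w) h2
  exact congrArg₂ (fun (a b : EuclideanSpace ℝ (Fin m)) ↦
    a + christoffel (chartMetric h (σ (k z)).proj)
      (extChartAt (𝓡 m) (σ (k z)).proj (σ (k z)).proj) b (σ (k z)).2) h1' h2'

section Sections

variable {f : N → A} {s t : ∀ x, TangentSpace (𝓡 m) (f x)}

lemma contMDiffAt_section_iff (hf : ContMDiffAt IN (𝓡 m) ∞ f z) :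
    ContMDiffAt IN (𝓡 m).tangent ∞ (fun x ↦ (⟨f x, s x⟩ : TangentBundle (𝓡 m) A)) z ↔
      ContMDiffAt IN 𝓘(ℝ, EuclideanSpace ℝ (Fin m)) ∞ (fun x ↦ vecCoord (f z) ⟨f x, s x⟩) z := by
  rw [contMDiffAt_totalSpace]
  exact ⟨fun h ↦ h.2, fun h ↦ ⟨hf, h⟩⟩

lemma mdifferentiableAt_section_iff (hf : MDifferentiableAt IN (𝓡 m) f z) :
    MDifferentiableAt IN (𝓡 m).tangent (fun x ↦ (⟨f x, s x⟩ : TangentBundle (𝓡 m) A)) z ↔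
      MDifferentiableAt IN 𝓘(ℝ, EuclideanSpace ℝ (Fin m)) (fun x ↦ vecCoord (f z) ⟨f x, s x⟩) z := by
  rw [mdifferentiableAt_totalSpace]
  exact ⟨fun h ↦ h.2, fun h ↦ ⟨hf, h⟩⟩

lemma vecCoord_add {a : A} (ha : a ∈ (extChartAt (𝓡 m) u).source) (v w : TangentSpace (𝓡 m) a) :
    vecCoord u ⟨a, v + w⟩ = vecCoord u ⟨a, v⟩ + vecCoord u ⟨a, w⟩ := by
  rw [vecCoord_eq ha, vecCoord_eq ha, vecCoord_eq ha]
  exact map_add _ _ _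

lemma vecCoord_smul {a : A} (ha : a ∈ (extChartAt (𝓡 m) u).source) (r : ℝ)
    (v : TangentSpace (𝓡 m) a) : vecCoord u ⟨a, r • v⟩ = r • vecCoord u ⟨a, v⟩ := by
  rw [vecCoord_eq ha, vecCoord_eq ha]
  exact map_smul _ _ _

lemma eventually_mem_source (hf : ContinuousAt f z) (hu : f z ∈ (extChartAt (𝓡 m) u).source) :
    ∀ᶠ y in 𝓝 z, f y ∈ (extChartAt (𝓡 m) u).source :=
  hf (extChartAt_source_mem_nhds' hu)

lemma contMDiffAt_section_iff_of_mem (hf : ContMDiffAt IN (𝓡 m) ∞ f z)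
    (hu : f z ∈ (extChartAt (𝓡 m) u).source) :
    ContMDiffAt IN (𝓡 m).tangent ∞ (fun x ↦ (⟨f x, s x⟩ : TangentBundle (𝓡 m) A)) z ↔
      ContMDiffAt IN 𝓘(ℝ, EuclideanSpace ℝ (Fin m)) ∞ (fun x ↦ vecCoord u ⟨f x, s x⟩) z := by
  refine ⟨fun h ↦ ?_, fun h ↦ ?_⟩
  · exact ContMDiffAt.comp (g := vecCoord u) z
      (contMDiffAt_vecCoord (ζ := (⟨f z, s z⟩ : TangentBundle (𝓡 m) A)) hu) h
  · have e := trivializationAt (EuclideanSpace ℝ (Fin m)) (TangentSpace (𝓡 m) : A → Type _) u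
    rw [Trivialization.contMDiffAt_iff (IB := 𝓡 m)
      (e := trivializationAt (EuclideanSpace ℝ (Fin m)) (TangentSpace (𝓡 m) : A → Type _) u)]
    · exact ⟨hf, h⟩
    · rw [Trivialization.mem_source, TangentBundle.trivializationAt_baseSet]
      rwa [extChartAt_source] at hu

lemma contMDiffAt_smul_section {a : N → ℝ} (hf : ContMDiffAt IN (𝓡 m) ∞ f z)
    (ha : ContMDiffAt IN 𝓘(ℝ, ℝ) ∞ a z)
    (hs : ContMDiffAt IN (𝓡 m).tangent ∞ (fun x ↦ (⟨f x, s x⟩ : TangentBundle (𝓡 m) A)) z) :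
    ContMDiffAt IN (𝓡 m).tangent ∞ (fun x ↦ (⟨f x, a x • s x⟩ : TangentBundle (𝓡 m) A)) z := by
  rw [contMDiffAt_section_iff hf] at hs ⊢
  refine (ha.smul hs).congr_of_eventuallyEq ?_
  filter_upwards [eventually_mem_source hf.continuousAt
    (mem_extChartAt_source (I := 𝓡 m) (f z))] with y hy
  exact vecCoord_smul hy _ _

lemma covDerivAlong_add
    (hs : MDifferentiableAt IN (𝓡 m).tangent (fun x ↦ (⟨f x, s x⟩ : TangentBundle (𝓡 m) A)) z)
    (ht : MDifferentiableAt IN (𝓡 m).tangent (fun x ↦ (⟨f x, t x⟩ : TangentBundle (𝓡 m) A)) z)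
    (w : TangentSpace IN z) :
    covDerivAlong h IN (fun x ↦ (⟨f x, s x + t x⟩ : TangentBundle (𝓡 m) A)) z w =
      (covDerivAlong h IN (fun x ↦ (⟨f x, s x⟩ : TangentBundle (𝓡 m) A)) z w :
        EuclideanSpace ℝ (Fin m)) +
      covDerivAlong h IN (fun x ↦ (⟨f x, t x⟩ : TangentBundle (𝓡 m) A)) z w := by
  have hf : MDifferentiableAt IN (𝓡 m) f z := mdifferentiableAt_base hs
  have hu := mem_extChartAt_source (I := 𝓡 m) (f z)
  have h1 := congrArg (fun L : EN →L[ℝ] EuclideanSpace ℝ (Fin m) ↦ L w)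
    (mvfderiv_add (mdifferentiableAt_vecCoord hs hu) (mdifferentiableAt_vecCoord ht hu))
  have h2 : (fun x ↦ vecCoord (f z) ⟨f x, s x + t x⟩) =ᶠ[𝓝 z]
      fun x ↦ vecCoord (f z) ⟨f x, s x⟩ + vecCoord (f z) ⟨f x, t x⟩ := by
    filter_upwards [eventually_mem_source hf.continuousAt hu] with y hy
    exact vecCoord_add hy _ _
  have h3 := (congrArg (fun L : EN →L[ℝ] EuclideanSpace ℝ (Fin m) ↦ L w)
    (mvfderiv_congr (IN := IN) h2)).trans h1
  change mvfderiv IN (fun x ↦ vecCoord (f z) ⟨f x, s x + t x⟩) z w +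
    christoffelMap (chartMetric h (f z)) (extChartAt (𝓡 m) (f z) (f z))
      (mfderiv IN (𝓡 m) f z w) (s z + t z) = _
  refine (congrArg₂ (· + ·) h3 (map_add _ _ _)).trans ?_
  exact add_add_add_comm _ _ _ _

lemma covDerivAlong_smul {a : N → ℝ} (ha : MDifferentiableAt IN 𝓘(ℝ, ℝ) a z)
    (hs : MDifferentiableAt IN (𝓡 m).tangent (fun x ↦ (⟨f x, s x⟩ : TangentBundle (𝓡 m) A)) z)
    (w : TangentSpace IN z) :
    covDerivAlong h IN (fun x ↦ (⟨f x, a x • s x⟩ : TangentBundle (𝓡 m) A)) z w =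
      a z • (covDerivAlong h IN (fun x ↦ (⟨f x, s x⟩ : TangentBundle (𝓡 m) A)) z w :
        EuclideanSpace ℝ (Fin m)) + mvfderiv IN a z w • s z := by
  have hf : MDifferentiableAt IN (𝓡 m) f z := mdifferentiableAt_base hs
  have hu := mem_extChartAt_source (I := 𝓡 m) (f z)
  have h1 := congrArg (fun L : EN →L[ℝ] EuclideanSpace ℝ (Fin m) ↦ L w)
    (mvfderiv_smul ha (mdifferentiableAt_vecCoord hs hu))
  have h2 : (fun x ↦ vecCoord (f z) ⟨f x, a x • s x⟩) =ᶠ[𝓝 z]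
      fun x ↦ a x • vecCoord (f z) ⟨f x, s x⟩ := by
    filter_upwards [eventually_mem_source hf.continuousAt hu] with y hy
    exact vecCoord_smul hy _ _
  have h3 := (congrArg (fun L : EN →L[ℝ] EuclideanSpace ℝ (Fin m) ↦ L w)
    (mvfderiv_congr (IN := IN) h2)).trans h1
  have h4 : vecCoord (f z) ⟨f z, s z⟩ = s z := by
    rw [vecCoord_eq hu]; exact tangentChart_self _ _
  change mvfderiv IN (fun x ↦ vecCoord (f z) ⟨f x, a x • s x⟩) z w +
    christoffelMap (chartMetric h (f z)) (extChartAt (𝓡 m) (f z) (f z))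
      (mfderiv IN (𝓡 m) f z w) (a z • s z) = _
  refine (congrArg₂ (· + ·) h3 (map_smul _ _ _)).trans ?_
  change a z • mvfderiv IN (fun x ↦ vecCoord (f z) ⟨f x, s x⟩) z w +
    mvfderiv IN a z w • vecCoord (f z) ⟨f z, s z⟩ + _ = a z •
    (mvfderiv IN (fun x ↦ vecCoord (f z) ⟨f x, s x⟩) z w + christoffelMap (chartMetric h (f z))
      (extChartAt (𝓡 m) (f z) (f z)) (mfderiv IN (𝓡 m) f z w) (s z)) + _
  rw [h4, smul_add]
  exact add_right_comm _ _ _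

end Sections

end CovDeriv

/-! ### Immersions have injective differential -/

section Immersion

variable {E E' H H' : Type*} [NormedAddCommGroup E] [NormedSpace ℝ E] [NormedAddCommGroup E']
  [NormedSpace ℝ E'] [TopologicalSpace H] [TopologicalSpace H'] {I : ModelWithCorners ℝ E H}
  {J : ModelWithCorners ℝ E' H'} {N N' : Type*} [TopologicalSpace N] [ChartedSpace H N]
  [TopologicalSpace N'] [ChartedSpace H' N'] [IsManifold I ∞ N] [IsManifold J ∞ N']

lemma mfderiv_extend_injective [I.Boundaryless] {e : OpenPartialHomeomorph N H}
    (he : e ∈ IsManifold.maximalAtlas I ∞ N) {x : N} (hx : x ∈ e.source) :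
    Function.Injective (mfderiv I 𝓘(ℝ, E) (e.extend I) x) := by
  have h0 : IsOpen (e.extend I).target := by
    exact e.isOpen_extend_target
  have h1 : ContMDiffAt I 𝓘(ℝ, E) ∞ (e.extend I) x :=
    (OpenPartialHomeomorph.contMDiffOn_extend he).contMDiffAt (e.open_source.mem_nhds hx)
  have hm : e.extend I x ∈ (e.extend I).target :=
    (e.extend I).map_source (by rwa [e.extend_source])
  have h2 : ContMDiffAt 𝓘(ℝ, E) I ∞ (e.extend I).symm (e.extend I x) := by
    have := contMDiffOn_extend_symm he
    rw [← e.extend_target'] at this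
    exact this.contMDiffAt (h0.mem_nhds hm)
  have h3 := mfderiv_comp x (h2.mdifferentiableAt (by simp)) (h1.mdifferentiableAt (by simp))
  have h4 : (e.extend I).symm ∘ e.extend I =ᶠ[𝓝 x] id := by
    filter_upwards [e.open_source.mem_nhds hx] with y hy
    exact (e.extend I).left_inv (by rwa [e.extend_source])
  rw [h4.mfderiv_eq, mfderiv_id] at h3
  intro v w hvw
  have hv := congrArg (fun L : E →L[ℝ] E ↦ L v) h3
  have hw := congrArg (fun L : E →L[ℝ] E ↦ L w) h3
  refine (hv.trans ?_).trans hw.symm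
  exact congrArg (mfderiv 𝓘(ℝ, E) I (e.extend I).symm (e.extend I x)) hvw

/-- In adapted charts f is v ↦ (v, 0) up to a linear equivalence. Projecting to the first factor
recovers the source chart, which thus factors through f near x and has injective derivative. -/
lemma _root_.Manifold.IsImmersionAt.mfderiv_injective [I.Boundaryless] {f : N → N'} {x : N}
    (hf : IsImmersionAt I J ∞ f x) : Function.Injective (mfderiv I J f x) := by
  have h1 := mfderiv_extend_injective hf.domChart_mem_maximalAtlas hf.mem_domChart_source
  have h2 : ContMDiffAt J 𝓘(ℝ, E') ∞ (hf.codChart.extend J) (f x) :=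
    (OpenPartialHomeomorph.contMDiffOn_extend hf.codChart_mem_maximalAtlas).contMDiffAt
      (hf.codChart.open_source.mem_nhds hf.mem_codChart_source)
  let L : E' →L[ℝ] E := (ContinuousLinearMap.fst ℝ E hf.complement).comp
    (hf.equiv.symm : E' →L[ℝ] E × hf.complement)
  have h3 : hf.domChart.extend I =ᶠ[𝓝 x] (L ∘ hf.codChart.extend J) ∘ f := by
    filter_upwards [hf.domChart.open_source.mem_nhds hf.mem_domChart_source] with y hy
    have hy' : y ∈ (hf.domChart.extend I).source := by rwa [hf.domChart.extend_source]
    have h4 := hf.writtenInCharts ((hf.domChart.extend I).map_source hy')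
    simp only [Function.comp_apply, (hf.domChart.extend I).left_inv hy'] at h4
    simp only [Function.comp_apply, h4, L, ContinuousLinearMap.comp_apply]
    simp
  have h4 : MDifferentiableAt J 𝓘(ℝ, E) (L ∘ hf.codChart.extend J) (f x) :=
    L.mdifferentiableAt.comp _ (h2.mdifferentiableAt (by simp))
  have h5 := mfderiv_comp x h4 (hf.contMDiffAt.mdifferentiableAt (by simp))
  rw [← h3.mfderiv_eq] at h5
  intro v w hvw
  refine h1 ?_
  have hv := congrArg (fun L : E →L[ℝ] E ↦ L v) h5
  have hw := congrArg (fun L : E →L[ℝ] E ↦ L w) h5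
  refine (hv.trans ?_).trans hw.symm
  exact congrArg (mfderiv J 𝓘(ℝ, E) (L ∘ hf.codChart.extend J) (f x)) hvw

end Immersion

/-! ### Homothetic fields from their flows -/

section Flow

variable {E : Type*} [NormedAddCommGroup E] [NormedSpace ℝ E]
  {G : E → E →L[ℝ] E →L[ℝ] ℝ} {O : Set E} {Φ : ℝ × E → E} {X : E → E} {y : E}

lemma contDiffAt_of_flow (hΦ : ContDiffAt ℝ ∞ Φ (0, y))
    (hX : ∀ᶠ y' in 𝓝 y, X y' = fderiv ℝ Φ (0, y') (1, 0)) : ContDiffAt ℝ ∞ X y := by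
  refine ContDiffAt.congr_of_eventuallyEq (f := fun y' ↦ fderiv ℝ Φ (0, y') (1, 0)) ?_ hX
  have h1 : ContDiffAt ℝ ∞ (fderiv ℝ Φ) (0, y) := hΦ.fderiv_right (by simp)
  have h2 : ContDiffAt ℝ ∞ (fun y' ↦ fderiv ℝ Φ (0, y')) y :=
    ContDiffAt.comp (g := fderiv ℝ Φ) y h1 (contDiffAt_const.prodMk contDiffAt_id)
  exact h2.clm_apply contDiffAt_const

/-- Differentiate Φ_t^*G = e^{2t}G at t = 0. Since X = ∂_tΦ, symmetry of D²Φ identifies ∂_t of the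
spatial derivative of Φ with DX. -/
lemma isHomothetic_of_flow (hG : DifferentiableAt ℝ G y) (hΦ : ContDiffAt ℝ ∞ Φ (0, y))
    (hX : ∀ᶠ y' in 𝓝 y, X y' = fderiv ℝ Φ (0, y') (1, 0)) (h0 : ∀ᶠ y' in 𝓝 y, Φ (0, y') = y')
    (hiso : ∀ᶠ t in 𝓝 (0 : ℝ), ∀ v w, G (Φ (t, y)) (fderiv ℝ Φ (t, y) (0, v))
      (fderiv ℝ Φ (t, y) (0, w)) = Real.exp t ^ 2 * G y v w) : IsHomothetic G X y := by
  intro v w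
  have hd : DifferentiableAt ℝ Φ (0, y) := hΦ.differentiableAt (by simp)
  have hd2 := hΦ.differentiableAt_fderiv
  have h0y := h0.self_of_nhds
  have hXy := hX.self_of_nhds
  have hc : DifferentiableAt ℝ (fun t : ℝ ↦ (t, y)) 0 := by fun_prop
  have hc' : fderiv ℝ (fun t : ℝ ↦ (t, y)) 0 1 = (1, 0) := by
    rw [DifferentiableAt.fderiv_prodMk (by fun_prop) (by fun_prop)]
    simp
  have hk : DifferentiableAt ℝ (fun y' : E ↦ ((0 : ℝ), y')) y := by fun_prop
  have hk' (v : E) : fderiv ℝ (fun y' : E ↦ ((0 : ℝ), y')) y v = (0, v) := by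
    rw [DifferentiableAt.fderiv_prodMk (by fun_prop) (by fun_prop)]
    simp
  have hid (v : E) : fderiv ℝ Φ (0, y) (0, v) = v := by
    have h1 := fderiv_comp_apply (f := Φ) (g := fun y' : E ↦ ((0 : ℝ), y')) hd hk v
    have h2 : (fun y' ↦ Φ (0, y')) =ᶠ[𝓝 y] id := h0
    rw [h2.fderiv_eq, fderiv_id, hk'] at h1
    exact h1.symm
  have hDX (v : E) : fderiv ℝ X y v = fderiv ℝ (fderiv ℝ Φ) (0, y) (0, v) (1, 0) := by
    have h2 : X =ᶠ[𝓝 y] fun y' ↦ fderiv ℝ Φ (0, y') (1, 0) := hX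
    rw [h2.fderiv_eq, fderiv_clm_apply_apply (A := fun y' ↦ fderiv ℝ Φ (0, y'))
      (V := fun _ ↦ ((1 : ℝ), (0 : E))) (hd2.comp y hk)
      (differentiableAt_const _), fderiv_comp_apply (f := fderiv ℝ Φ) hd2 hk, hk']
    simp
  have hDt (v : E) : fderiv ℝ (fun t ↦ fderiv ℝ Φ (t, y) (0, v)) 0 1 = fderiv ℝ X y v := by
    rw [fderiv_clm_apply_apply (A := fun t ↦ fderiv ℝ Φ (t, y))
      (V := fun _ ↦ ((0 : ℝ), v)) (hd2.comp (0 : ℝ) hc)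
      (differentiableAt_const _), fderiv_comp_apply (f := fderiv ℝ Φ) (g := fun t : ℝ ↦ (t, y)) hd2 hc, hc', hDX,
      hΦ.fderiv_fderiv_symm]
    simp
  have hda (v : E) : DifferentiableAt ℝ (fun t ↦ fderiv ℝ Φ (t, y) (0, v)) 0 :=
    (hd2.comp (0 : ℝ) hc).clm_apply (differentiableAt_const _)
  have h1 := fderiv_clm_apply₂ (B := fun t ↦ G (Φ (t, y))) (V := fun t ↦ fderiv ℝ Φ (t, y) (0, v))
    (W := fun t ↦ fderiv ℝ Φ (t, y) (0, w)) (p := (0 : ℝ))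
    (DifferentiableAt.comp (g := G) (0 : ℝ) (by rwa [h0y]) (hd.comp (0 : ℝ) hc)) (hda v) (hda w) 1
  rw [hDt, hDt, fderiv_comp_apply (f := G) (g := fun t ↦ Φ (t, y)) (by rwa [h0y])
    (hd.comp (0 : ℝ) hc), fderiv_comp_apply (f := Φ) (g := fun t : ℝ ↦ (t, y)) hd hc, hc', ← hXy, h0y, hid, hid] at h1
  rw [← h1]
  have h2 : (fun t ↦ G (Φ (t, y)) (fderiv ℝ Φ (t, y) (0, v)) (fderiv ℝ Φ (t, y) (0, w)))
    =ᶠ[𝓝 0] fun t ↦ Real.exp t ^ 2 * G y v w := hiso.mono fun t ht ↦ ht v w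
  have h3 : HasDerivAt (fun t ↦ Real.exp t ^ 2 * G y v w) (2 * G y v w) 0 := by
    have := ((Real.hasDerivAt_exp 0).pow 2).mul_const (G y v w)
    simpa using this
  rw [h2.fderiv_eq, h3.hasFDerivAt.fderiv]
  simp

end Flow

lemma expPos_zero : expPos 0 = 1 := Subtype.ext Real.exp_zero

lemma expPos_add (s t : ℝ) : expPos (s + t) = expPos s * expPos t := Subtype.ext (Real.exp_add s t)

lemma expPos_log (s : PosReal) : expPos (Real.log s) = s := Subtype.ext (Real.exp_log s.2)

/-- By metric compatibility and torsion-freeness the Christoffel symbols drop out of the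
antisymmetrised derivative of α, so dα is the antisymmetrised ∇X. -/
lemma IsCoordMetric.fderiv_apply_sub_eq_curl {E : Type*} [NormedAddCommGroup E] [NormedSpace ℝ E]
    [FiniteDimensional ℝ E] {G : E → E →L[ℝ] E →L[ℝ] ℝ} {O : Set E} (hG : IsCoordMetric G O)
    {X : E → E} {y : E} (hy : y ∈ O) (hX : DifferentiableAt ℝ X y) (v w : E) :
    fderiv ℝ (fun y ↦ G y (X y)) y v w - fderiv ℝ (fun y ↦ G y (X y)) y w v = curl G X y v w := by
  rw [fderiv_clm_apply_apply (hG.differentiableAt hy) hX,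
    fderiv_clm_apply_apply (hG.differentiableAt hy) hX, curl, nabla_apply, nabla_apply]
  simp only [add_apply, map_add]
  rw [hG.fderiv_apply hy, hG.fderiv_apply hy, hG.christoffel_symm hy w v,
    hG.symm _ hy v (fderiv ℝ X y w), hG.symm _ hy v (christoffelMap G y w (X y))]
  ring

/-! ### The dilations and their generator -/

section Action

variable {m : ℕ} {A : Type*} [TopologicalSpace A] [ChartedSpace (EuclideanSpace ℝ (Fin m)) A]
  [MulAction PosReal A] [IsManifold (𝓡 m) ∞ A]
  (hact : ContMDiff (𝓘(ℝ, ℝ).prod (𝓡 m)) (𝓡 m) ∞ (fun z : ℝ × A ↦ expPos z.1 • z.2))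

include hact

lemma contMDiff_smul (s : PosReal) : ContMDiff (𝓡 m) (𝓡 m) ∞ (fun u : A ↦ s • u) := by
  have := hact.comp (contMDiff_const (c := Real.log s).prodMk contMDiff_id)
  simpa [Function.comp_def, expPos_log] using this

lemma contMDiff_orbit (u : A) : ContMDiff 𝓘(ℝ, ℝ) (𝓡 m) ∞ (fun t : ℝ ↦ expPos t • u) :=
  hact.comp (contMDiff_id.prodMk contMDiff_const)

/-- ℝ₊ is commutative, so ρ^s carries the orbit curve of u to the orbit curve of s • u with the same
parameter. -/
lemma mfderiv_smul_generator (s : PosReal) (u : A) :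
    (mfderiv (𝓡 m) (𝓡 m) (fun u : A ↦ s • u) u (generator u) : EuclideanSpace ℝ (Fin m)) =
      (generator (s • u) : TangentSpace (𝓡 m) (s • u)) := by
  have h0 : expPos 0 • u = u := by rw [expPos_zero, one_smul]
  have h1 := mfderiv_comp (0 : ℝ) (g := fun u : A ↦ s • u) (f := fun t : ℝ ↦ expPos t • u)
    ((contMDiff_smul hact s).mdifferentiable (by simp) _)
    ((contMDiff_orbit hact u).mdifferentiable (by simp) _)
  have h2 : (fun u : A ↦ s • u) ∘ (fun t : ℝ ↦ expPos t • u) = fun t : ℝ ↦ expPos t • s • u := by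
    funext t
    simp [smul_smul, mul_comm]
  rw [h2] at h1
  have h3 := congrArg (fun L : ℝ →L[ℝ] EuclideanSpace ℝ (Fin m) ↦ L 1) h1
  refine Eq.symm (h3.trans ?_)
  exact mfderiv_congr_base _ h0 _

end Action

/-! ### The generator and its flow in charts -/

section Charts

variable {m : ℕ} {A : Type*} [TopologicalSpace A] [ChartedSpace (EuclideanSpace ℝ (Fin m)) A]
  [MulAction PosReal A]

/-- The generator in the preferred chart at `u`. -/
def chartGenerator (u : A) (y : EuclideanSpace ℝ (Fin m)) : EuclideanSpace ℝ (Fin m) :=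
  tangentChart u ((extChartAt (𝓡 m) u).symm y) (generator ((extChartAt (𝓡 m) u).symm y))

/-- The flow of the generator in the preferred chart at `u`. -/
def chartFlow (u : A) (z : ℝ × EuclideanSpace ℝ (Fin m)) : EuclideanSpace ℝ (Fin m) :=
  extChartAt (𝓡 m) u (expPos z.1 • (extChartAt (𝓡 m) u).symm z.2)

variable [IsManifold (𝓡 m) ∞ A] {u a : A} {y : EuclideanSpace ℝ (Fin m)}

lemma chartFlow_zero (hy : y ∈ (extChartAt (𝓡 m) u).target) : chartFlow u (0, y) = y := by
  rw [chartFlow, expPos_zero, one_smul, (extChartAt (𝓡 m) u).right_inv hy]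

lemma chartGenerator_apply (ha : a ∈ (extChartAt (𝓡 m) u).source) :
    chartGenerator u (extChartAt (𝓡 m) u a) = tangentChart u a (generator a) := by
  rw [chartGenerator, (extChartAt (𝓡 m) u).left_inv ha]

lemma vecCoord_generator (ha : a ∈ (extChartAt (𝓡 m) u).source) :
    vecCoord u ⟨a, generator a⟩ = chartGenerator u (extChartAt (𝓡 m) u a) := by
  rw [vecCoord_eq ha, chartGenerator_apply ha]

section Smooth

variable (hact : ContMDiff (𝓘(ℝ, ℝ).prod (𝓡 m)) (𝓡 m) ∞ (fun z : ℝ × A ↦ expPos z.1 • z.2))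

include hact

lemma contDiffAt_chartFlow (hy : y ∈ (extChartAt (𝓡 m) u).target) :
    ContDiffAt ℝ ∞ (chartFlow u) (0, y) := by
  have h1 : ContMDiffAt 𝓘(ℝ, ℝ × EuclideanSpace ℝ (Fin m)) (𝓡 m) ∞
      (fun z : ℝ × EuclideanSpace ℝ (Fin m) ↦ (extChartAt (𝓡 m) u).symm z.2) (0, y) := by
    refine ContMDiffAt.comp (g := (extChartAt (𝓡 m) u).symm) (0, y)
      ((contMDiffOn_extChartAt_symm u).contMDiffAt ((isOpen_extChartAt_target u).mem_nhds hy))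
      contDiffAt_snd.contMDiffAt
  have h2 : ContMDiffAt 𝓘(ℝ, ℝ × EuclideanSpace ℝ (Fin m)) 𝓘(ℝ, ℝ) ∞
      (fun z : ℝ × EuclideanSpace ℝ (Fin m) ↦ z.1) (0, y) := contDiffAt_fst.contMDiffAt
  have h3 : ContMDiffAt 𝓘(ℝ, ℝ × EuclideanSpace ℝ (Fin m)) (𝓡 m) ∞
      (fun z : ℝ × EuclideanSpace ℝ (Fin m) ↦ expPos z.1 • (extChartAt (𝓡 m) u).symm z.2) (0, y) :=
    ContMDiffAt.comp (g := fun z : ℝ × A ↦ expPos z.1 • z.2) (0, y) hact.contMDiffAt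
      (h2.prodMk h1)
  have h4 : ContMDiffAt (𝓡 m) (𝓡 m) ∞ (extChartAt (𝓡 m) u)
      (expPos 0 • (extChartAt (𝓡 m) u).symm y) := by
    rw [expPos_zero, one_smul]
    refine contMDiffAt_extChartAt' ?_
    rw [← extChartAt_source (𝓡 m)]
    exact (extChartAt (𝓡 m) u).map_target hy
  exact (ContMDiffAt.comp (g := extChartAt (𝓡 m) u) (0, y) h4 h3).contDiffAt

lemma chartGenerator_eq_fderiv (hy : y ∈ (extChartAt (𝓡 m) u).target) :
    chartGenerator u y = fderiv ℝ (chartFlow u) (0, y) (1, 0) := by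
  have h0 : expPos 0 • (extChartAt (𝓡 m) u).symm y = (extChartAt (𝓡 m) u).symm y := by
    rw [expPos_zero, one_smul]
  have h1 := mvfderiv_extChartAt_comp (u := u) (c := fun t ↦ expPos t • (extChartAt (𝓡 m) u).symm y)
    (z := (0 : ℝ)) (by rw [h0]; exact (extChartAt (𝓡 m) u).map_target hy)
    ((contMDiff_orbit hact _).mdifferentiable (by simp) 0) (1 : ℝ)
  have h2 := mvfderiv_eq_fderiv (fun t ↦ chartFlow u (t, y)) 0
  have h3 := fderiv_comp_apply (f := chartFlow u) (g := fun t : ℝ ↦ (t, y))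
    ((contDiffAt_chartFlow hact hy).differentiableAt (by simp)) (p := 0) (by fun_prop) 1
  rw [DifferentiableAt.fderiv_prodMk (by fun_prop) (by fun_prop)] at h3
  simp only [fderiv_fun_id, fderiv_fun_const] at h3
  refine Eq.trans ?_ (h1.symm.trans ((congrArg (fun L : ℝ →L[ℝ] EuclideanSpace ℝ (Fin m) ↦ L 1)
    h2).trans h3))
  rw [chartGenerator]
  have h4 (b : A) (hb : b = (extChartAt (𝓡 m) u).symm y) (v : EuclideanSpace ℝ (Fin m)) :
      tangentChart u ((extChartAt (𝓡 m) u).symm y) v = tangentChart u b v := by subst hb; rfl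
  exact h4 _ h0 _

lemma contDiffAt_chartGenerator (hy : y ∈ (extChartAt (𝓡 m) u).target) :
    ContDiffAt ℝ ∞ (chartGenerator u) y := by
  refine contDiffAt_of_flow (contDiffAt_chartFlow hact hy) ?_
  filter_upwards [(isOpen_extChartAt_target u).mem_nhds hy] with y' hy'
  exact chartGenerator_eq_fderiv hact hy'

lemma eventually_chartFlow (hy : y ∈ (extChartAt (𝓡 m) u).target) : ∀ᶠ t in 𝓝 (0 : ℝ),
    expPos t • (extChartAt (𝓡 m) u).symm y ∈ (extChartAt (𝓡 m) u).source ∧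
      DifferentiableAt ℝ (chartFlow u) (t, y) := by
  have h1 : ∀ᶠ t in 𝓝 (0 : ℝ), expPos t • (extChartAt (𝓡 m) u).symm y ∈
      (extChartAt (𝓡 m) u).source := by
    refine (contMDiff_orbit hact ((extChartAt (𝓡 m) u).symm y)).continuous.continuousAt
      (extChartAt_source_mem_nhds' ?_)
    rw [expPos_zero, one_smul]
    exact (extChartAt (𝓡 m) u).map_target hy
  have h3 : ∀ᶠ z in 𝓝 ((0 : ℝ), y), ContDiffAt ℝ 1 (chartFlow u) z :=
    ((contDiffAt_chartFlow hact hy).of_le (m := 1) (by simp)).eventually (by simp)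
  have h4 : ContinuousAt (fun t : ℝ ↦ (t, y)) 0 := by fun_prop
  filter_upwards [h1, h4 h3] with t ht ht'
  exact ⟨ht, ContDiffAt.differentiableAt (n := 1) ht' (by simp)⟩

lemma fderiv_chartFlow_fiber (hy : y ∈ (extChartAt (𝓡 m) u).target) {t : ℝ}
    (ht : expPos t • (extChartAt (𝓡 m) u).symm y ∈ (extChartAt (𝓡 m) u).source)
    (ht' : DifferentiableAt ℝ (chartFlow u) (t, y)) (v : EuclideanSpace ℝ (Fin m)) :
    fderiv ℝ (chartFlow u) (t, y) (0, v) =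
      tangentChart u (expPos t • (extChartAt (𝓡 m) u).symm y)
        (mfderiv (𝓡 m) (𝓡 m) (fun u' : A ↦ expPos t • u') ((extChartAt (𝓡 m) u).symm y)
          (chartFrame u y v)) := by
  have h6 := fderiv_chartMap (ψ := fun u' : A ↦ expPos t • u')
    ((extChartAt (𝓡 m) u).map_target hy) ht
    ((contMDiff_smul hact (expPos t)).mdifferentiable (by simp) _) (chartFrame u y v)
  rw [tangentChart_chartFrame hy, (extChartAt (𝓡 m) u).right_inv hy] at h6
  rw [← h6]
  have h7 := fderiv_comp_apply (f := chartFlow u) (g := fun y' ↦ (t, y')) (p := y) ht'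
    (by fun_prop) v
  rw [DifferentiableAt.fderiv_prodMk (by fun_prop) (by fun_prop)] at h7
  simp only [fderiv_fun_id, fderiv_fun_const] at h7
  exact h7.symm

lemma isHomothetic_chartGenerator
    {h : ∀ u : A, TangentSpace (𝓡 m) u →L[ℝ] TangentSpace (𝓡 m) u →L[ℝ] ℝ} {p q : ℕ}
    (hh : IsPseudoMetric (𝓡 m) (EuclideanSpace ℝ (Fin m)) (TangentSpace (𝓡 m) : A → Type _) p q h)
    (hhom : ∀ (s : PosReal) (u : A) (v w : TangentSpace (𝓡 m) u),
      h (s • u) (mfderiv (𝓡 m) (𝓡 m) (fun u' : A ↦ s • u') u v)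
        (mfderiv (𝓡 m) (𝓡 m) (fun u' : A ↦ s • u') u w) = (s : ℝ) ^ 2 * h u v w)
    (hy : y ∈ (extChartAt (𝓡 m) u).target) :
    IsHomothetic (chartMetric h u) (chartGenerator u) y := by
  have hmem := (isOpen_extChartAt_target (I := 𝓡 m) u).mem_nhds hy
  have hΦ := contDiffAt_chartFlow hact hy
  refine isHomothetic_of_flow ((hh.isCoordMetric u).differentiableAt hy) hΦ
    ?_ ?_ ?_
  · filter_upwards [hmem] with y' hy'
    exact chartGenerator_eq_fderiv hact hy'
  · filter_upwards [hmem] with y' hy'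
    exact chartFlow_zero hy'
  · filter_upwards [eventually_chartFlow hact hy] with t ht v w
    obtain ⟨ht, ht'⟩ := ht
    rw [fderiv_chartFlow_fiber hact hy ht ht', fderiv_chartFlow_fiber hact hy ht ht']
    have h8 := chartMetric_tangentChart h ht (mfderiv (𝓡 m) (𝓡 m) (fun u' : A ↦ expPos t • u')
      ((extChartAt (𝓡 m) u).symm y) (chartFrame u y v)) (mfderiv (𝓡 m) (𝓡 m)
      (fun u' : A ↦ expPos t • u') ((extChartAt (𝓡 m) u).symm y) (chartFrame u y w))
    exact h8.trans (hhom _ _ _ _)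

lemma contMDiff_generator :
    ContMDiff (𝓡 m) (𝓡 m).tangent ∞ (fun a ↦ (⟨a, generator a⟩ : TangentBundle (𝓡 m) A)) := by
  intro a
  have ha := mem_extChartAt_source (I := 𝓡 m) a
  rw [contMDiffAt_section_iff (f := fun a : A ↦ a) contMDiffAt_id]
  have h1 := (contDiffAt_chartGenerator hact
    ((extChartAt (𝓡 m) a).map_source ha)).contMDiffAt.comp a
    (contMDiffAt_extChartAt (I := 𝓡 m) (n := ∞) (x := a) :
      ContMDiffAt (𝓡 m) 𝓘(ℝ, EuclideanSpace ℝ (Fin m)) ∞ (extChartAt (𝓡 m) a) a)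
  refine h1.congr_of_eventuallyEq ?_
  filter_upwards [extChartAt_source_mem_nhds (I := 𝓡 m) a] with b hb
  exact vecCoord_generator hb

/-- The derivative of the generator is computed by `nabla` in every preferred chart. -/
lemma covDerivIn_generator
    (h : ∀ u : A, TangentSpace (𝓡 m) u →L[ℝ] TangentSpace (𝓡 m) u →L[ℝ] ℝ)
    (ha : a ∈ (extChartAt (𝓡 m) u).source) (w : TangentSpace (𝓡 m) a) :
    covDerivIn h (𝓡 m) u (fun a ↦ (⟨a, generator a⟩ : TangentBundle (𝓡 m) A)) a w =
      nabla (chartMetric h u) (chartGenerator u) (extChartAt (𝓡 m) u a) (tangentChart u a w) := by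
  have h1 : (fun a ↦ vecCoord u (⟨a, generator a⟩ : TangentBundle (𝓡 m) A)) =ᶠ[𝓝 a]
      fun a ↦ chartGenerator u (extChartAt (𝓡 m) u a) := by
    filter_upwards [extChartAt_source_mem_nhds' ha] with b hb
    exact vecCoord_generator hb
  have h2 := mvfderiv_extChartAt_comp (c := fun a : A ↦ a) ha mdifferentiableAt_id w
  have h2' : mvfderiv (𝓡 m) (fun y ↦ extChartAt (𝓡 m) u y) a w = tangentChart u a w := rfl
  have h3 := mvfderiv_fderiv_comp (g := fun a ↦ extChartAt (𝓡 m) u a)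
    ((contDiffAt_chartGenerator hact ((extChartAt (𝓡 m) u).map_source ha)).differentiableAt
      (by simp)) (mdifferentiableAt_extChartAt_of_mem ha) w
  rw [covDerivIn, mvfderiv_congr h1, h3, h2', vecCoord_generator ha]
  rfl

/-- `extDerivForm` at a is computed in the chart at a, while the null-cone argument moves a inside
one fixed chart. In either chart `curl` equals the chart-free expression h(∇_vX, w) − h(v, ∇_wX). -/
lemma extDerivForm_generator
    {h : ∀ u : A, TangentSpace (𝓡 m) u →L[ℝ] TangentSpace (𝓡 m) u →L[ℝ] ℝ} {p q : ℕ}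
    (hh : IsPseudoMetric (𝓡 m) (EuclideanSpace ℝ (Fin m)) (TangentSpace (𝓡 m) : A → Type _) p q h)
    (ha : a ∈ (extChartAt (𝓡 m) u).source) (v w : TangentSpace (𝓡 m) a) :
    extDerivForm (fun a ↦ h a (generator a)) a v w =
      curl (chartMetric h u) (chartGenerator u) (extChartAt (𝓡 m) u a) (tangentChart u a v)
        (tangentChart u a w) := by
  have hσ : MDifferentiableAt (𝓡 m) (𝓡 m).tangent
      (fun a ↦ (⟨a, generator a⟩ : TangentBundle (𝓡 m) A)) a :=
    (contMDiff_generator hact).mdifferentiable (by simp) a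
  have h0 := mem_extChartAt_source (I := 𝓡 m) a
  have ht := (extChartAt (𝓡 m) a).map_source h0
  have key {u : A} (ha : a ∈ (extChartAt (𝓡 m) u).source) :
      curl (chartMetric h u) (chartGenerator u) (extChartAt (𝓡 m) u a) (tangentChart u a v)
        (tangentChart u a w) =
      h a (covDerivAlong h (𝓡 m) (fun a ↦ (⟨a, generator a⟩ : TangentBundle (𝓡 m) A)) a v) w -
      h a v (covDerivAlong h (𝓡 m) (fun a ↦ (⟨a, generator a⟩ : TangentBundle (𝓡 m) A)) a w) := by
    have h1 := covDerivIn_generator hact h ha v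
    have h2 := covDerivIn_generator hact h ha w
    rw [covDerivIn_eq hh hσ ha] at h1 h2
    rw [curl, ← h1, ← h2]
    exact congrArg₂ _ (chartMetric_tangentChart h ha _ _) (chartMetric_tangentChart h ha _ _)
  rw [key ha, ← key h0, tangentChart_self, tangentChart_self]
  have hG := hh.isCoordMetric a
  have hd := hG.differentiableAt ht
  have hX := (contDiffAt_chartGenerator hact ht).differentiableAt (by simp)
  have h3 : chartForm (fun a ↦ h a (generator a)) a =ᶠ[𝓝 (extChartAt (𝓡 m) a a)]
      fun y ↦ chartMetric h a y (chartGenerator a y) := by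
    filter_upwards [(isOpen_extChartAt_target a).mem_nhds ht] with y hy
    ext v
    rw [chartMetric_apply]
    have h5 := chartFrame_tangentChart ((extChartAt (𝓡 m) a).map_target hy)
      (generator ((extChartAt (𝓡 m) a).symm y))
    rw [(extChartAt (𝓡 m) a).right_inv hy] at h5
    exact (congrArg (fun x : EuclideanSpace ℝ (Fin m) ↦
      h ((extChartAt (𝓡 m) a).symm y) x (chartFrame a y v)) h5).symm
  rw [extDerivForm, h3.fderiv_eq]
  exact hG.fderiv_apply_sub_eq_curl ht hX v w

end Smooth

end Charts

/-! ### The parametrization of 𝒬 and its tangent spaces -/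

section Param

variable {n p q : ℕ} {M : Type*} [TopologicalSpace M]
    [ChartedSpace (EuclideanSpace ℝ (Fin n)) M] [IsManifold (𝓡 n) ∞ M]
    {c : ConformalStructure n p q M}

namespace ConformalStructure

variable {g : ∀ x : M, TangentSpace (𝓡 n) x →L[ℝ] TangentSpace (𝓡 n) x →L[ℝ] ℝ}
    (hg : g ∈ c.metrics)

lemma dilate_mul (s t : PosReal) (b : c.RayBundle) : dilate (s * t) b = dilate s (dilate t b) := by
  refine RayBundle.ext rfl ?_
  change ((s : ℝ) * t) ^ 2 • b.form = (s : ℝ) ^ 2 • (t : ℝ) ^ 2 • b.form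
  rw [mul_pow]
  exact mul_smul _ _ b.form

lemma dilate_one (b : c.RayBundle) : dilate 1 b = b := by
  refine RayBundle.ext rfl ?_
  change (1 : ℝ) ^ 2 • b.form = b.form
  rw [one_pow]
  exact one_smul ℝ b.form

lemma triv_add (x : M) (s t : ℝ) : triv hg (x, s + t) = dilate (expPos s) (triv hg (x, t)) := by
  rw [triv, triv, expPos_add, dilate_mul]

lemma triv_zero (x : M) : triv hg (x, 0) = value hg x := by
  rw [triv, expPos_zero, dilate_one]

lemma triv_surjective (b : c.RayBundle) : ∃ t : ℝ, triv hg (b.base, t) = b := by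
  obtain ⟨g', hg', hb⟩ := b.mem
  obtain ⟨f, -, hf, h⟩ := (c.mem_iff g hg g').1 hg'
  -- The conformal factor f must equal e^{2t} at the base point.
  refine ⟨Real.log (f b.base) / 2, RayBundle.ext rfl ?_⟩
  change Real.exp (Real.log (f b.base) / 2) ^ 2 • g b.base = b.form
  rw [← hb, h, ← Real.exp_nat_mul]
  congr 1
  rw [show ((2 : ℕ) : ℝ) * (Real.log (f b.base) / 2) = Real.log (f b.base) by push_cast; ring,
    Real.exp_log (hf _)]

end ConformalStructure

open ConformalStructure

variable {A : Type*} [TopologicalSpace A] [ChartedSpace (EuclideanSpace ℝ (Fin (n + 2))) A]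
    [MulAction PosReal A] {ι : c.RayBundle → A} (hA : IsAmbientManifold ι)
    {g : ∀ x : M, TangentSpace (𝓡 n) x →L[ℝ] TangentSpace (𝓡 n) x →L[ℝ] ℝ}
    (hg : g ∈ c.metrics)

namespace IsAmbientManifold

include hA

lemma apply_triv_add (x : M) (s t : ℝ) :
    ι (triv hg (x, s + t)) = expPos s • ι (triv hg (x, t)) := by
  rw [triv_add, hA.equivariant]

lemma apply_triv (z : M × ℝ) : ι (triv hg z) = expPos z.2 • slice hA hg z.1 := hA.equivariant _ _

omit hA in
lemma exists_param {u : A} (hu : u ∈ Set.range ι) : ∃ z, ι (triv hg z) = u := by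
  obtain ⟨b, rfl⟩ := hu
  obtain ⟨t, ht⟩ := triv_surjective hg b
  exact ⟨(b.base, t), congrArg ι ht⟩

lemma contMDiff_param : ContMDiff ((𝓡 n).prod 𝓘(ℝ, ℝ)) (𝓡 (n + 2)) ∞
    (fun z : M × ℝ ↦ ι (triv hg z)) := (hA.embedding g hg).contMDiff

lemma mdifferentiableAt_param (z : M × ℝ) : MDifferentiableAt ((𝓡 n).prod 𝓘(ℝ, ℝ)) (𝓡 (n + 2))
    (fun z : M × ℝ ↦ ι (triv hg z)) z := (hA.contMDiff_param hg).mdifferentiable (by simp) z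

lemma param_injective : Function.Injective (fun z : M × ℝ ↦ ι (triv hg z)) :=
  (hA.embedding g hg).isEmbedding.injective

variable [IsManifold (𝓡 (n + 2)) ∞ A]

lemma mfderiv_param_injective (z : M × ℝ) : Function.Injective
    (mfderiv ((𝓡 n).prod 𝓘(ℝ, ℝ)) (𝓡 (n + 2)) (fun z : M × ℝ ↦ ι (triv hg z)) z) :=
  ((hA.embedding g hg).isImmersion.isImmersionAt z).mfderiv_injective

/-- In its second variable the parametrization runs along an orbit; translating by z.2 moves the
base point to parameter zero, where the generator is defined. -/
lemma mfderiv_param_vertical (z : M × ℝ) :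
    (mfderiv ((𝓡 n).prod 𝓘(ℝ, ℝ)) (𝓡 (n + 2)) (fun z : M × ℝ ↦ ι (triv hg z)) z
      ((0, 1) : EuclideanSpace ℝ (Fin n) × ℝ) : EuclideanSpace ℝ (Fin (n + 2))) =
      (generator (ι (triv hg z)) : TangentSpace (𝓡 (n + 2)) (ι (triv hg z))) := by
  have hk : HasMFDerivAt 𝓘(ℝ, ℝ) ((𝓡 n).prod 𝓘(ℝ, ℝ)) (fun t : ℝ ↦ (z.1, t + z.2)) 0
      ((0 : ℝ →L[ℝ] EuclideanSpace ℝ (Fin n)).prod (ContinuousLinearMap.id ℝ ℝ)) :=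
    (hasMFDerivAt_const z.1 (0 : ℝ)).prodMk
      (((hasFDerivAt_id (0 : ℝ)).add_const z.2).hasMFDerivAt)
  have h1 := ((hA.mdifferentiableAt_param hg (z.1, 0 + z.2)).hasMFDerivAt.comp (0 : ℝ) hk).mfderiv
  have h2 : (fun z : M × ℝ ↦ ι (triv hg z)) ∘ (fun t : ℝ ↦ (z.1, t + z.2)) =
      fun t ↦ expPos t • ι (triv hg z) := by
    funext t
    exact hA.apply_triv_add hg z.1 t z.2
  rw [h2] at h1
  have h3 := congrArg (fun L : ℝ →L[ℝ] EuclideanSpace ℝ (Fin (n + 2)) ↦ L 1) h1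
  refine Eq.trans ?_ h3.symm
  have h4 (z' : M × ℝ) (hz : z' = z) (v : EuclideanSpace ℝ (Fin n) × ℝ) :
      (mfderiv ((𝓡 n).prod 𝓘(ℝ, ℝ)) (𝓡 (n + 2)) (fun z : M × ℝ ↦ ι (triv hg z)) z v :
        EuclideanSpace ℝ (Fin (n + 2))) =
      (mfderiv ((𝓡 n).prod 𝓘(ℝ, ℝ)) (𝓡 (n + 2)) (fun z : M × ℝ ↦ ι (triv hg z)) z' v :
        EuclideanSpace ℝ (Fin (n + 2))) := by subst hz; rfl
  exact h4 (z.1, 0 + z.2) (Prod.ext rfl (zero_add _)) _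

end IsAmbientManifold

variable [IsManifold (𝓡 (n + 2)) ∞ A]
  {h : ∀ u : A, TangentSpace (𝓡 (n + 2)) u →L[ℝ] TangentSpace (𝓡 (n + 2)) u →L[ℝ] ℝ}
  (hh : IsAmbientMetric ι h)

namespace IsAmbientMetric

include hA hh

/-- X is the vertical direction, so its projection to M is zero and the tautological condition
yields α = 0 on T𝒬. -/
lemma dualForm_mfderiv_param (z : M × ℝ) (v : TangentSpace ((𝓡 n).prod 𝓘(ℝ, ℝ)) z) :
    h (ι (triv hg z)) (generator (ι (triv hg z)))
      (mfderiv ((𝓡 n).prod 𝓘(ℝ, ℝ)) (𝓡 (n + 2)) (fun z : M × ℝ ↦ ι (triv hg z)) z v) = 0 := by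
  have h1 := hh.tautological g hg z ((0, 1) : EuclideanSpace ℝ (Fin n) × ℝ) v
  have h2 := congrArg (fun x : EuclideanSpace ℝ (Fin (n + 2)) ↦ h (ι (triv hg z)) x
    (mfderiv ((𝓡 n).prod 𝓘(ℝ, ℝ)) (𝓡 (n + 2)) (fun z : M × ℝ ↦ ι (triv hg z)) z v))
    (hA.mfderiv_param_vertical hg z)
  refine h2.symm.trans (h1.trans ?_)
  rw [mfderiv_fst]
  exact (congrArg (fun L : EuclideanSpace ℝ (Fin n) →L[ℝ] ℝ ↦ L _)
    (map_zero (triv hg z).form)).trans rfl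

lemma generator_ne_zero (z : M × ℝ) :
    (generator (ι (triv hg z)) : TangentSpace (𝓡 (n + 2)) (ι (triv hg z))) ≠ 0 := by
  intro h0
  have h1 := hA.mfderiv_param_vertical hg z
  have h2 := (hA.mfderiv_param_injective hg z) ((h1.trans h0).trans (map_zero (mfderiv
    ((𝓡 n).prod 𝓘(ℝ, ℝ)) (𝓡 (n + 2)) (fun z : M × ℝ ↦ ι (triv hg z)) z)).symm)
  exact one_ne_zero (congrArg (fun x : EuclideanSpace ℝ (Fin n) × ℝ ↦ x.2) h2)

lemma exists_generator_eq_one (z : M × ℝ) : ∃ N : TangentSpace (𝓡 (n + 2)) (ι (triv hg z)),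
    h (ι (triv hg z)) (generator (ι (triv hg z))) N = 1 := by
  by_contra! hN
  refine hh.generator_ne_zero hA hg z (hh.isPseudoMetric.nondegenerate _ _ fun w ↦ ?_)
  by_contra hw
  refine hN ((h (ι (triv hg z)) (generator (ι (triv hg z))) w)⁻¹ • w) ?_
  rw [map_smul, smul_eq_mul, inv_mul_cancel₀ hw]

/-- T𝒬 ⊆ ker α, and both have dimension n + 1: the parametrization is an immersion and α ≠ 0 on 𝒬.
-/
lemma exists_mfderiv_param_eq (z : M × ℝ) (w : TangentSpace (𝓡 (n + 2)) (ι (triv hg z)))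
    (hw : h (ι (triv hg z)) (generator (ι (triv hg z))) w = 0) :
    ∃ v, mfderiv ((𝓡 n).prod 𝓘(ℝ, ℝ)) (𝓡 (n + 2)) (fun z : M × ℝ ↦ ι (triv hg z)) z v = w := by
  let T' : EuclideanSpace ℝ (Fin n) × ℝ →L[ℝ] EuclideanSpace ℝ (Fin (n + 2)) :=
    mfderiv ((𝓡 n).prod 𝓘(ℝ, ℝ)) (𝓡 (n + 2)) (fun z : M × ℝ ↦ ι (triv hg z)) z
  let a' : EuclideanSpace ℝ (Fin (n + 2)) →L[ℝ] ℝ :=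
    h (ι (triv hg z)) (generator (ι (triv hg z)))
  let T := (T' : EuclideanSpace ℝ (Fin n) × ℝ →ₗ[ℝ] EuclideanSpace ℝ (Fin (n + 2)))
  let a := (a' : EuclideanSpace ℝ (Fin (n + 2)) →ₗ[ℝ] ℝ)
  have hT : Function.Injective T := hA.mfderiv_param_injective hg z
  have hle : LinearMap.range T ≤ LinearMap.ker a := by
    rintro _ ⟨v, rfl⟩
    exact hh.dualForm_mfderiv_param hA hg z v
  have h1 : Module.finrank ℝ (LinearMap.range T) = n + 1 := by
    rw [LinearMap.finrank_range_of_inj hT]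
    simp
  have h2 : Module.finrank ℝ (LinearMap.ker a) = n + 1 := by
    obtain ⟨N, hN⟩ := hh.exists_generator_eq_one hA hg z
    have ha : a ≠ 0 := fun h0 ↦ by
      have : a N = 1 := hN
      rw [h0] at this
      exact zero_ne_one this
    have := Module.Dual.finrank_ker_add_one_of_ne_zero (f := a) ha
    rw [finrank_euclideanSpace, Fintype.card_fin] at this
    omega
  have h3 := Submodule.eq_of_le_of_finrank_eq hle (h1.trans h2.symm)
  have h4 : (w : EuclideanSpace ℝ (Fin (n + 2))) ∈ LinearMap.ker a := hw
  rw [← h3] at h4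
  exact h4

lemma mem_tangentQ_iff {u : A} (hu : u ∈ Set.range ι) (w : TangentSpace (𝓡 (n + 2)) u) :
    (⟨u, w⟩ : TangentBundle (𝓡 (n + 2)) A) ∈ tangentQ ι ↔ dualForm h u w = 0 := by
  constructor
  · rintro ⟨g, hg, ⟨z, v⟩, hz⟩
    have h1 := hh.dualForm_mfderiv_param hA hg z v
    rw [tangentMap] at hz
    cases hz
    exact h1
  · intro hw
    obtain ⟨g, hg⟩ := c.nonempty
    obtain ⟨z, rfl⟩ := IsAmbientManifold.exists_param hg hu
    obtain ⟨v, hv⟩ := hh.exists_mfderiv_param_eq hA hg z w hw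
    exact ⟨g, hg, ⟨z, v⟩, by rw [tangentMap, ← hv]⟩

end IsAmbientMetric

section ChartParam

/-- The parametrization of `𝒬` in the preferred charts at `x` and `u`. -/
def chartParam (ι : c.RayBundle → A) (hg : g ∈ c.metrics) (x : M) (u : A)
    (z : EuclideanSpace ℝ (Fin n) × ℝ) : EuclideanSpace ℝ (Fin (n + 2)) :=
  extChartAt (𝓡 (n + 2)) u (ι (triv hg ((extChartAt (𝓡 n) x).symm z.1, z.2)))

variable {x : M} {u : A} {z : EuclideanSpace ℝ (Fin n) × ℝ}

include hA

lemma contMDiffAt_chartParam_aux (hz : z.1 ∈ (extChartAt (𝓡 n) x).target) :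
    ContMDiffAt 𝓘(ℝ, EuclideanSpace ℝ (Fin n) × ℝ) (𝓡 (n + 2)) ∞
      (fun z : EuclideanSpace ℝ (Fin n) × ℝ ↦
        ι (triv hg ((extChartAt (𝓡 n) x).symm z.1, z.2))) z := by
  have h1 : ContMDiffAt 𝓘(ℝ, EuclideanSpace ℝ (Fin n) × ℝ) (𝓡 n) ∞
      (fun z : EuclideanSpace ℝ (Fin n) × ℝ ↦ (extChartAt (𝓡 n) x).symm z.1) z :=
    ContMDiffAt.comp (g := (extChartAt (𝓡 n) x).symm) z
      ((contMDiffOn_extChartAt_symm x).contMDiffAt ((isOpen_extChartAt_target x).mem_nhds hz))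
      contDiffAt_fst.contMDiffAt
  have h2 : ContMDiffAt 𝓘(ℝ, EuclideanSpace ℝ (Fin n) × ℝ) 𝓘(ℝ, ℝ) ∞
      (fun z : EuclideanSpace ℝ (Fin n) × ℝ ↦ z.2) z := contDiffAt_snd.contMDiffAt
  exact ContMDiffAt.comp (g := fun z : M × ℝ ↦ ι (triv hg z)) z
    (hA.contMDiff_param hg).contMDiffAt (h1.prodMk h2)

lemma contDiffAt_chartParam (hz : z.1 ∈ (extChartAt (𝓡 n) x).target)
    (hu : ι (triv hg ((extChartAt (𝓡 n) x).symm z.1, z.2)) ∈ (extChartAt (𝓡 (n + 2)) u).source) :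
    ContDiffAt ℝ ∞ (chartParam ι hg x u) z := by
  rw [extChartAt_source] at hu
  exact (ContMDiffAt.comp (g := extChartAt (𝓡 (n + 2)) u) z (contMDiffAt_extChartAt' hu)
    (contMDiffAt_chartParam_aux hA hg hz)).contDiffAt

lemma fderiv_chartParam (hz : z.1 ∈ (extChartAt (𝓡 n) x).target)
    (hu : ι (triv hg ((extChartAt (𝓡 n) x).symm z.1, z.2)) ∈ (extChartAt (𝓡 (n + 2)) u).source)
    (v : EuclideanSpace ℝ (Fin n) × ℝ) :
    fderiv ℝ (chartParam ι hg x u) z v =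
      tangentChart u (ι (triv hg ((extChartAt (𝓡 n) x).symm z.1, z.2)))
        (mfderiv ((𝓡 n).prod 𝓘(ℝ, ℝ)) (𝓡 (n + 2)) (fun z : M × ℝ ↦ ι (triv hg z))
          ((extChartAt (𝓡 n) x).symm z.1, z.2)
          ((chartFrame x z.1 v.1, v.2) : EuclideanSpace ℝ (Fin n) × ℝ)) := by
  have h1 := mvfderiv_extChartAt_comp (c := fun z : EuclideanSpace ℝ (Fin n) × ℝ ↦
    ι (triv hg ((extChartAt (𝓡 n) x).symm z.1, z.2))) (z := z) hu
    ((contMDiffAt_chartParam_aux hA hg hz).mdifferentiableAt (by simp)) v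
  have h2 : HasMFDerivAt 𝓘(ℝ, EuclideanSpace ℝ (Fin n) × ℝ) (𝓡 n)
      (fun z : EuclideanSpace ℝ (Fin n) × ℝ ↦ (extChartAt (𝓡 n) x).symm z.1) z
      (ContinuousLinearMap.comp (chartFrame x z.1 :
        EuclideanSpace ℝ (Fin n) →L[ℝ] EuclideanSpace ℝ (Fin n))
        (ContinuousLinearMap.fst ℝ (EuclideanSpace ℝ (Fin n)) ℝ)) :=
    HasMFDerivAt.comp (g := (extChartAt (𝓡 n) x).symm) z
      (mdifferentiableAt_extChartAt_symm hz).hasMFDerivAt hasFDerivAt_fst.hasMFDerivAt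
  have h3 : HasMFDerivAt 𝓘(ℝ, EuclideanSpace ℝ (Fin n) × ℝ) 𝓘(ℝ, ℝ)
      (fun z : EuclideanSpace ℝ (Fin n) × ℝ ↦ z.2) z
      (ContinuousLinearMap.snd ℝ (EuclideanSpace ℝ (Fin n)) ℝ) := hasFDerivAt_snd.hasMFDerivAt
  have h4 := ((hA.mdifferentiableAt_param hg
    ((extChartAt (𝓡 n) x).symm z.1, z.2)).hasMFDerivAt.comp z (h2.prodMk h3)).mfderiv
  have h5 := mvfderiv_eq_fderiv (chartParam ι hg x u) z
  rw [← h5]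
  refine h1.trans ?_
  exact congrArg (fun L : EuclideanSpace ℝ (Fin n) × ℝ →L[ℝ] EuclideanSpace ℝ (Fin (n + 2)) ↦
    (tangentChart u (ι (triv hg ((extChartAt (𝓡 n) x).symm z.1, z.2))) :
      EuclideanSpace ℝ (Fin (n + 2)) →L[ℝ] EuclideanSpace ℝ (Fin (n + 2))) (L v)) h4

omit hA in
lemma chartParam_apply {x' : M} (hx : x' ∈ (extChartAt (𝓡 n) x).source) (t : ℝ) :
    chartParam ι hg x u (extChartAt (𝓡 n) x x', t) =
      extChartAt (𝓡 (n + 2)) u (ι (triv hg (x', t))) := by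
  rw [chartParam, (extChartAt (𝓡 n) x).left_inv hx]

lemma eventually_chartParam_mem (hz : z.1 ∈ (extChartAt (𝓡 n) x).target)
    (hu : ι (triv hg ((extChartAt (𝓡 n) x).symm z.1, z.2)) ∈ (extChartAt (𝓡 (n + 2)) u).source) :
    ∀ᶠ z' in 𝓝 z, z'.1 ∈ (extChartAt (𝓡 n) x).target ∧
      ι (triv hg ((extChartAt (𝓡 n) x).symm z'.1, z'.2)) ∈ (extChartAt (𝓡 (n + 2)) u).source := by
  have h1 := (contMDiffAt_chartParam_aux hA hg hz).continuousAt (extChartAt_source_mem_nhds' hu)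
  have h2 : ContinuousAt (fun z : EuclideanSpace ℝ (Fin n) × ℝ ↦ z.1) z := continuousAt_fst
  filter_upwards [h1, h2 ((isOpen_extChartAt_target x).mem_nhds hz)] with z' h3 h4
  exact ⟨h4, h3⟩

include hh

/-- In charts, an ambient metric gives a null cone. -/
lemma IsAmbientMetric.isNullCone (x : M) (t : ℝ)
    (hu : ι (triv hg (x, t)) ∈ (extChartAt (𝓡 (n + 2)) u).source) :
    IsNullCone (chartMetric h u) (extChartAt (𝓡 (n + 2)) u).target (chartGenerator u)
      (chartParam ι hg x u) (extChartAt (𝓡 n) x x, t) := by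
  have hx := mem_extChartAt_source (I := 𝓡 n) x
  have hxt := (extChartAt (𝓡 n) x).map_source hx
  have hu' : ι (triv hg ((extChartAt (𝓡 n) x).symm (extChartAt (𝓡 n) x x), t)) ∈
      (extChartAt (𝓡 (n + 2)) u).source := by
    rwa [(extChartAt (𝓡 n) x).left_inv hx]
  have hev := eventually_chartParam_mem hA hg (z := (extChartAt (𝓡 n) x x, t)) hxt hu'
  have htan : ∀ᶠ z in 𝓝 (extChartAt (𝓡 n) x x, t), ∀ v,
      chartMetric h u (chartParam ι hg x u z) (chartGenerator u (chartParam ι hg x u z))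
        (fderiv ℝ (chartParam ι hg x u) z v) = 0 := by
    filter_upwards [hev] with z hz v
    rw [fderiv_chartParam hA hg hz.1 hz.2, chartParam, chartGenerator_apply hz.2]
    exact (chartMetric_tangentChart h hz.2 _ _).trans (hh.dualForm_mfderiv_param hA hg _ _)
  have hrange : ∀ w, chartMetric h u (chartParam ι hg x u (extChartAt (𝓡 n) x x, t))
      (chartGenerator u (chartParam ι hg x u (extChartAt (𝓡 n) x x, t))) w = 0 →
      ∃ v, fderiv ℝ (chartParam ι hg x u) (extChartAt (𝓡 n) x x, t) v = w := by
    intro w hw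
    let a := ι (triv hg ((extChartAt (𝓡 n) x).symm (extChartAt (𝓡 n) x x), t))
    have ha : a ∈ (extChartAt (𝓡 (n + 2)) u).source := hu'
    have hφ : chartParam ι hg x u (extChartAt (𝓡 n) x x, t) = extChartAt (𝓡 (n + 2)) u a := rfl
    obtain ⟨w', hw'⟩ : ∃ w' : TangentSpace (𝓡 (n + 2)) a, tangentChart u a w' = w := by
      have := tangentChart_chartFrame ((extChartAt (𝓡 (n + 2)) u).map_source ha) w
      rw [(extChartAt (𝓡 (n + 2)) u).left_inv ha] at this
      exact ⟨_, this⟩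
    rw [hφ, chartGenerator_apply ha, ← hw', chartMetric_tangentChart h ha] at hw
    obtain ⟨v, hv⟩ := hh.exists_mfderiv_param_eq hA hg _ w' hw
    refine ⟨(tangentChart x ((extChartAt (𝓡 n) x).symm (extChartAt (𝓡 n) x x)) v.1, v.2), ?_⟩
    rw [fderiv_chartParam hA hg hxt hu', ← hw']
    refine congrArg (tangentChart u a) (Eq.trans ?_ hv)
    have h5 := chartFrame_tangentChart ((extChartAt (𝓡 n) x).map_target hxt) v.1
    rw [(extChartAt (𝓡 n) x).right_inv hxt] at h5
    exact congrArg (mfderiv ((𝓡 n).prod 𝓘(ℝ, ℝ)) (𝓡 (n + 2)) (fun z : M × ℝ ↦ ι (triv hg z))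
          ((extChartAt (𝓡 n) x).symm (extChartAt (𝓡 n) x x), t)) (Prod.ext h5 rfl)
  refine ⟨hh.isPseudoMetric.isCoordMetric u, fun y hy ↦
    (contDiffAt_chartGenerator hA.smooth_action hy).contDiffWithinAt,
    fun y hy ↦ isHomothetic_chartGenerator hA.smooth_action hh.isPseudoMetric hh.homogeneous hy,
    ?_, ?_, htan, ?_, hrange⟩
  · rw [chartParam_apply hg hx]
    exact (extChartAt (𝓡 (n + 2)) u).map_source hu
  · filter_upwards [hev] with z hz
    exact contDiffAt_chartParam hA hg hz.1 hz.2
  -- X is itself tangent to 𝒬, so α(X) = 0.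
  · rw [chartParam_apply hg hx, chartGenerator_apply hu, chartMetric_tangentChart h hu]
    have h6 := hh.dualForm_mfderiv_param hA hg (x, t) ((0, 1) : EuclideanSpace ℝ (Fin n) × ℝ)
    exact (congrArg (fun w : EuclideanSpace ℝ (Fin (n + 2)) ↦ h (ι (triv hg (x, t)))
      (generator (ι (triv hg (x, t)))) w) (hA.mfderiv_param_vertical hg (x, t))).symm.trans h6

end ChartParam

end Param

/-! ### Zero sets of functions transverse to a parametrized hypersurface -/

section Flat

/-- The map Ψ(z',s) = φ(z') + sN has surjective derivative at (z,0), so images of small boxes are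
neighbourhoods of φ(z). On each line s ↦ Ψ(z',s) the function r vanishes at s = 0 and has non-zero
derivative, so Rolle's theorem excludes further zeros. The predicate S carries along a property of
nearby parameters, in the application that they stay inside the charts. -/
lemma eventually_mem_of_transverse {E P : Type*} [NormedAddCommGroup E] [NormedSpace ℝ E]
    [CompleteSpace E] [NormedAddCommGroup P] [NormedSpace ℝ P] [CompleteSpace P]
    {φ : P → E} {r : E → ℝ} {z : P} {N : E} (hφ : ContDiffAt ℝ 1 φ z) (hr : ContDiffAt ℝ 1 r (φ z))
    (h0 : ∀ᶠ z' in 𝓝 z, r (φ z') = 0) {S : P → Prop} (hS : ∀ᶠ z' in 𝓝 z, S z') (hN : fderiv ℝ r (φ z) N ≠ 0)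
    (hrange : ∀ w, fderiv ℝ r (φ z) w = 0 → ∃ v, fderiv ℝ φ z v = w) :
    ∀ᶠ y in 𝓝 (φ z), r y = 0 → ∃ z', S z' ∧ φ z' = y := by
  let Ψ : P × ℝ → E := fun p ↦ φ p.1 + p.2 • N
  have hΨ0 : Ψ (z, 0) = φ z := by simp [Ψ]
  have hΨ : ContDiffAt ℝ 1 Ψ (z, 0) :=
    (ContDiffAt.comp (g := φ) (z, (0 : ℝ)) hφ contDiffAt_fst).add
      (contDiffAt_snd.smul contDiffAt_const)
  have hD (v : P) (s : ℝ) : fderiv ℝ Ψ (z, 0) (v, s) = fderiv ℝ φ z v + s • N := by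
    have h1 : HasFDerivAt Ψ _ (z, (0 : ℝ)) :=
      (HasFDerivAt.comp (g := φ) (z, (0 : ℝ)) (hφ.differentiableAt (by simp)).hasFDerivAt
        hasFDerivAt_fst).add (hasFDerivAt_snd.smul_const N)
    rw [h1.fderiv]
    simp
  have hsurj : (fderiv ℝ Ψ (z, 0)).range = ⊤ := by
    refine LinearMap.range_eq_top.2 fun w ↦ ?_
    obtain ⟨v, hv⟩ := hrange (w - (fderiv ℝ r (φ z) w / fderiv ℝ r (φ z) N) • N) (by
      rw [map_sub, map_smul, smul_eq_mul, div_mul_cancel₀ _ hN, sub_self])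
    exact ⟨(v, fderiv ℝ r (φ z) w / fderiv ℝ r (φ z) N), by
      change fderiv ℝ Ψ (z, 0) _ = w
      rw [hD, hv, sub_add_cancel]⟩
  have hmap := (hΨ.hasStrictFDerivAt (by simp)).map_nhds_eq_of_surj hsurj
  have hc : ContinuousAt (fun p ↦ fderiv ℝ r (Ψ p) N) (z, 0) := by
    have h1 : ContinuousAt (fderiv ℝ r) (Ψ (z, 0)) := by
      rw [hΨ0]
      exact (hr.fderiv_right (m := 0) (by simp)).continuousAt
    exact (ContinuousAt.comp (g := fderiv ℝ r) h1 hΨ.continuousAt).clm_apply continuousAt_const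
  have hne : ∀ᶠ p in 𝓝 (z, (0 : ℝ)), fderiv ℝ r (Ψ p) N ≠ 0 :=
    hc.eventually_ne (by rwa [hΨ0])
  have hd : ∀ᶠ p in 𝓝 (z, (0 : ℝ)), DifferentiableAt ℝ r (Ψ p) := by
    have h1 : ∀ᶠ y in 𝓝 (Ψ (z, 0)), ContDiffAt ℝ 1 r y := by
      rw [hΨ0]
      exact hr.eventually (by simp)
    filter_upwards [hΨ.continuousAt h1] with p hp
    exact ContDiffAt.differentiableAt (n := 1) hp (by simp)
  have h0' : ∀ᶠ p in 𝓝 (z, (0 : ℝ)), r (φ p.1) = 0 ∧ S p.1 :=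
    (continuousAt_fst (p := (z, (0 : ℝ)))).eventually (h0.and hS)
  have hall := (hne.and hd).and h0'
  rw [nhds_prod_eq] at hall
  obtain ⟨U, hU, V, hV, hUV⟩ := Filter.eventually_prod_iff.1 hall
  obtain ⟨ε, hε, hball⟩ := Metric.eventually_nhds_iff.1 hV
  have hbox : ∀ᶠ p in 𝓝 (z, (0 : ℝ)), U p.1 ∧ dist p.2 0 < ε := by
    rw [nhds_prod_eq]
    exact hU.prod_mk (Metric.ball_mem_nhds (0 : ℝ) hε)
  have himg : Ψ '' {p | U p.1 ∧ dist p.2 0 < ε} ∈ 𝓝 (φ z) := by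
    rw [← hΨ0, ← hmap]
    exact image_mem_map hbox
  filter_upwards [himg] with y hy hry
  obtain ⟨⟨z', s⟩, ⟨hz', hs⟩, rfl⟩ := hy
  have h0V : V 0 := hball (by simpa using hε)
  have hderiv (t : ℝ) (ht : |t| < ε) :
      HasDerivAt (fun t ↦ r (Ψ (z', t))) (fderiv ℝ r (Ψ (z', t)) N) t := by
    have h1 := (hUV hz' (hball (y := t) (by simpa using ht))).1.2
    have h2 : HasDerivAt (fun t : ℝ ↦ Ψ (z', t)) N t := by
      have := ((hasDerivAt_id t).smul_const N).const_add (φ z')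
      simpa [Ψ] using this
    exact h1.hasFDerivAt.comp_hasDerivAt t h2
  have hrz : r (Ψ (z', 0)) = 0 := by
    have := (hUV hz' h0V).2.1
    simpa [Ψ] using this
  have hs' : |s| < ε := by simpa using hs
  rcases lt_trichotomy s 0 with hlt | rfl | hgt
  · exfalso
    have hsub : ∀ t ∈ Set.Icc s 0, |t| < ε := fun t ht ↦ by
      rw [abs_lt] at hs' ⊢
      constructor <;> linarith [ht.1, ht.2]
    obtain ⟨t, ht, h3⟩ := exists_hasDerivAt_eq_zero hlt
      (fun t ht ↦ (hderiv t (hsub t ht)).continuousAt.continuousWithinAt) (hry.trans hrz.symm)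
      (fun t ht ↦ hderiv t (hsub t (Set.Ioo_subset_Icc_self ht)))
    exact (hUV hz' (hball (y := t) (by simpa using hsub t (Set.Ioo_subset_Icc_self ht)))).1.1 h3
  · exact ⟨z', (hUV hz' h0V).2.2, by simp [Ψ]⟩
  · exfalso
    have hsub : ∀ t ∈ Set.Icc 0 s, |t| < ε := fun t ht ↦ by
      rw [abs_lt] at hs' ⊢
      constructor <;> linarith [ht.1, ht.2]
    obtain ⟨t, ht, h3⟩ := exists_hasDerivAt_eq_zero hgt
      (fun t ht ↦ (hderiv t (hsub t ht)).continuousAt.continuousWithinAt) (hrz.trans hry.symm)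
      (fun t ht ↦ hderiv t (hsub t (Set.Ioo_subset_Icc_self ht)))
    exact (hUV hz' (hball (y := t) (by simpa using hsub t (Set.Ioo_subset_Icc_self ht)))).1.1 h3

end Flat

/-! ### Ricci curvature as a trace -/

section Ricci

variable {m : ℕ}

lemma IsCoordMetric.coordRiemann_eq {G : EuclideanSpace ℝ (Fin m) →
    EuclideanSpace ℝ (Fin m) →L[ℝ] EuclideanSpace ℝ (Fin m) →L[ℝ] ℝ}
    {O : Set (EuclideanSpace ℝ (Fin m))} (hG : IsCoordMetric G O) {y : EuclideanSpace ℝ (Fin m)}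
    (hy : y ∈ O) (v w z : EuclideanSpace ℝ (Fin m)) :
    coordRiemann G y v w z = riemann G y v w z := by
  have h1 (v w : EuclideanSpace ℝ (Fin m)) : fderiv ℝ (fun y' ↦ christoffel G y' w z) y v =
      fderiv ℝ (christoffelMap G) y v w z := by
    have := fderiv_clm_apply₂ (V := fun _ ↦ w) (W := fun _ ↦ z) (hG.differentiableAt_christoffelMap hy)
      (differentiableAt_const _) (differentiableAt_const _) v
    simp only [fderiv_fun_const, Pi.zero_apply, zero_apply, map_zero, add_zero] at this
    exact this
  rw [coordRiemann, h1, h1]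
  rfl

lemma IsCoordMetric.coordRicci_eq {G : EuclideanSpace ℝ (Fin m) →
    EuclideanSpace ℝ (Fin m) →L[ℝ] EuclideanSpace ℝ (Fin m) →L[ℝ] ℝ}
    {O : Set (EuclideanSpace ℝ (Fin m))} (hG : IsCoordMetric G O) {y : EuclideanSpace ℝ (Fin m)}
    (hy : y ∈ O) (w z : EuclideanSpace ℝ (Fin m)) :
    coordRicci G y w z = LinearMap.trace ℝ _ (riemannMap G y w z) := by
  rw [LinearMap.trace_eq_matrix_trace ℝ (EuclideanSpace.basisFun (Fin m) ℝ).toBasis, Matrix.trace,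
    coordRicci]
  refine Finset.sum_congr rfl fun i _ ↦ ?_
  rw [hG.coordRiemann_eq hy]
  simp [LinearMap.toMatrix_apply, riemannMap_apply]

end Ricci

lemma extDerivForm_sub_smul {m : ℕ} {A : Type*} [TopologicalSpace A]
    [ChartedSpace (EuclideanSpace ℝ (Fin m)) A] (a : ∀ u : A, TangentSpace (𝓡 m) u →L[ℝ] ℝ) {u : A}
    (v N w : TangentSpace (𝓡 m) u) (r : ℝ) :
    extDerivForm a u (v - r • N) w = extDerivForm a u v w - r * extDerivForm a u N w := by
  have key (L : EuclideanSpace ℝ (Fin m) →L[ℝ] EuclideanSpace ℝ (Fin m) →L[ℝ] ℝ)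
      (v N w : EuclideanSpace ℝ (Fin m)) :
      L (v - r • N) w - L w (v - r • N) = L v w - L w v - r * (L N w - L w N) := by
    simp only [map_sub, map_smul, sub_apply, smul_apply, smul_eq_mul]
    ring
  exact key _ _ _ _

/-! ### Ricci curvature and dα along 𝒬 -/

section Main

variable {n p q : ℕ} {M : Type*} [TopologicalSpace M]
    [ChartedSpace (EuclideanSpace ℝ (Fin n)) M] [IsManifold (𝓡 n) ∞ M]
    {c : ConformalStructure n p q M}

open ConformalStructure

variable {A : Type*} [TopologicalSpace A] [ChartedSpace (EuclideanSpace ℝ (Fin (n + 2))) A]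
    [MulAction PosReal A] {ι : c.RayBundle → A} (hA : IsAmbientManifold ι)
    [IsManifold (𝓡 (n + 2)) ∞ A]
  {h : ∀ u : A, TangentSpace (𝓡 (n + 2)) u →L[ℝ] TangentSpace (𝓡 (n + 2)) u →L[ℝ] ℝ}
  (hh : IsAmbientMetric ι h) {u : A}

namespace IsAmbientMetric

include hA hh

lemma extDerivForm_eq {a : A} (ha : a ∈ (extChartAt (𝓡 (n + 2)) u).source)
    (v w : TangentSpace (𝓡 (n + 2)) a) : extDerivForm (dualForm h) a v w =
      curl (chartMetric h u) (chartGenerator u) (extChartAt (𝓡 (n + 2)) u a) (tangentChart u a v)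
        (tangentChart u a w) :=
  extDerivForm_generator hA.smooth_action hh.isPseudoMetric ha v w

lemma extDerivForm_self (v w : TangentSpace (𝓡 (n + 2)) u) : extDerivForm (dualForm h) u v w =
    curl (chartMetric h u) (chartGenerator u) (extChartAt (𝓡 (n + 2)) u u) v w := by
  have h1 := hh.extDerivForm_eq hA (mem_extChartAt_source (I := 𝓡 (n + 2)) u) v w
  rwa [tangentChart_self, tangentChart_self] at h1

omit hA in
lemma ricci_eq (v w : TangentSpace (𝓡 (n + 2)) u) :
    ricci h u v w = LinearMap.trace ℝ _
      (riemannMap (chartMetric h u) (extChartAt (𝓡 (n + 2)) u u) v w) :=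
  (hh.isPseudoMetric.isCoordMetric u).coordRicci_eq
    ((extChartAt (𝓡 (n + 2)) u).map_source (mem_extChartAt_source (I := 𝓡 (n + 2)) u)) v w

omit [IsManifold (𝓡 (n + 2)) ∞ A] hA hh in
lemma _root_.AmbientTractor.chartGenerator_self [IsManifold (𝓡 (n + 2)) ∞ A] (u : A) :
    chartGenerator u (extChartAt (𝓡 (n + 2)) u u) = (generator u : TangentSpace (𝓡 (n + 2)) u) := by
  rw [chartGenerator_apply (mem_extChartAt_source (I := 𝓡 (n + 2)) u)]
  exact tangentChart_self _ _

omit hA hh in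
lemma _root_.AmbientTractor.chartMetric_self (u : A) (v w : TangentSpace (𝓡 (n + 2)) u) :
    chartMetric h u (extChartAt (𝓡 (n + 2)) u u) v w = h u v w := by
  have h1 := chartMetric_tangentChart h (mem_extChartAt_source (I := 𝓡 (n + 2)) u) v w
  rwa [tangentChart_self, tangentChart_self] at h1

/-- Around each point of `𝒬`, the ambient metric is a null cone in the preferred chart. -/
lemma exists_isNullCone (hu : u ∈ Set.range ι) :
    ∃ (φ : EuclideanSpace ℝ (Fin n) × ℝ → EuclideanSpace ℝ (Fin (n + 2)))
      (z : EuclideanSpace ℝ (Fin n) × ℝ),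
      IsNullCone (chartMetric h u) (extChartAt (𝓡 (n + 2)) u).target (chartGenerator u) φ z ∧
      φ z = extChartAt (𝓡 (n + 2)) u u ∧ ∀ᶠ z' in 𝓝 z, ∃ a ∈ Set.range ι,
        a ∈ (extChartAt (𝓡 (n + 2)) u).source ∧ φ z' = extChartAt (𝓡 (n + 2)) u a := by
  obtain ⟨g, hg⟩ := c.nonempty
  obtain ⟨⟨x, t⟩, rfl⟩ := IsAmbientManifold.exists_param hg hu
  have hs := mem_extChartAt_source (I := 𝓡 (n + 2)) (ι (triv hg (x, t)))
  have hx := mem_extChartAt_source (I := 𝓡 n) x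
  refine ⟨_, _, hh.isNullCone hA hg x t hs, chartParam_apply hg hx t, ?_⟩
  filter_upwards [eventually_chartParam_mem hA hg (z := (extChartAt (𝓡 n) x x, t))
    (u := ι (triv hg (x, t))) ((extChartAt (𝓡 n) x).map_source hx) (by
      rwa [(extChartAt (𝓡 n) x).left_inv hx])] with z hz
  exact ⟨_, ⟨_, rfl⟩, hz.2, rfl⟩

lemma exists_dualForm_eq_one (hu : u ∈ Set.range ι) : ∃ N : TangentSpace (𝓡 (n + 2)) u,
    dualForm h u N = 1 := by
  obtain ⟨g, hg⟩ := c.nonempty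
  obtain ⟨z, rfl⟩ := IsAmbientManifold.exists_param hg hu
  exact hh.exists_generator_eq_one hA hg z

lemma dualForm_generator (hu : u ∈ Set.range ι) : dualForm h u (generator u) = 0 := by
  obtain ⟨φ, z, hC, hz, -⟩ := hh.exists_isNullCone hA hu
  have h1 := hC.null
  rw [hz, chartGenerator_self] at h1
  rw [← h1, chartMetric_self]
  rfl

lemma extDerivForm_tangent (hu : u ∈ Set.range ι) {v N : TangentSpace (𝓡 (n + 2)) u}
    (hN : dualForm h u N = 1) (hv : dualForm h u v = 0) (w : TangentSpace (𝓡 (n + 2)) u) :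
    extDerivForm (dualForm h) u v w = dualForm h u w * extDerivForm (dualForm h) u v N := by
  obtain ⟨φ, z, hC, hz, -⟩ := hh.exists_isNullCone hA hu
  have key (w : TangentSpace (𝓡 (n + 2)) u) :
      chartMetric h u (φ z) (chartGenerator u (φ z)) w = dualForm h u w := by
    rw [hz, chartGenerator_self, chartMetric_self]
    rfl
  have h1 := hC.curl_tangent_left ((key N).trans hN) ((key v).trans hv) (w := w)
  rw [key, hz] at h1
  rwa [hh.extDerivForm_self hA, hh.extDerivForm_self hA]

lemma extDerivForm_swap (v w : TangentSpace (𝓡 (n + 2)) u) :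
    extDerivForm (dualForm h) u v w = - extDerivForm (dualForm h) u w v := by
  rw [extDerivForm, extDerivForm]
  ring

lemma two_mul_ricci_generator (hu : u ∈ Set.range ι) {N : TangentSpace (𝓡 (n + 2)) u}
    (hN : dualForm h u N = 1) :
    2 * ricci h u (generator u) (generator u) =
      n * extDerivForm (dualForm h) u (generator u) N := by
  obtain ⟨φ, z, hC, hz, -⟩ := hh.exists_isNullCone hA hu
  have key (w : TangentSpace (𝓡 (n + 2)) u) :
      chartMetric h u (φ z) (chartGenerator u (φ z)) w = dualForm h u w := by
    rw [hz, chartGenerator_self, chartMetric_self]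
    rfl
  have h1 := hC.two_mul_trace_riemannMap_self ((key N).trans hN)
  rw [hz, chartGenerator_self, finrank_euclideanSpace, Fintype.card_fin] at h1
  rw [hh.ricci_eq, hh.extDerivForm_self hA, h1]
  push_cast
  ring

/-- 2Ric(X,X) = n dα(X,N), and dα(X,w) = α(w) dα(X,N) since X is tangential. -/
lemma ricci_generator_eq_zero_iff (hn : 0 < n) (hu : u ∈ Set.range ι) :
    ricci h u (generator u) (generator u) = 0 ↔
      ∀ w, extDerivForm (dualForm h) u (generator u) w = 0 := by
  obtain ⟨N, hN⟩ := hh.exists_dualForm_eq_one hA hu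
  have h1 := hh.two_mul_ricci_generator hA hu hN
  have hn' : (n : ℝ) ≠ 0 := by positivity
  constructor
  · intro h0 w
    rw [h0, mul_zero] at h1
    rw [hh.extDerivForm_tangent hA hu hN (hh.dualForm_generator hA hu),
      (mul_eq_zero.1 h1.symm).resolve_left hn', mul_zero]
  · intro h0
    rw [h0, mul_zero] at h1
    linarith

/-- The vanishing of i_X dα is needed on all of 𝒬 and not only at u, because it is differentiated
along 𝒬. -/
lemma two_mul_ricci_tangent (hu : u ∈ Set.range ι)
    (h0 : ∀ u ∈ Set.range ι, ∀ w, extDerivForm (dualForm h) u (generator u) w = 0)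
    {w N : TangentSpace (𝓡 (n + 2)) u} (hN : dualForm h u N = 1) (hw : dualForm h u w = 0) :
    2 * ricci h u (generator u) w = n * extDerivForm (dualForm h) u w N := by
  obtain ⟨φ, z, hC, hz, hev⟩ := hh.exists_isNullCone hA hu
  have key (w : TangentSpace (𝓡 (n + 2)) u) :
      chartMetric h u (φ z) (chartGenerator u (φ z)) w = dualForm h u w := by
    rw [hz, chartGenerator_self, chartMetric_self]
    rfl
  have h1 := hC.two_mul_trace_riemannMap_tangent ((key N).trans hN) ((key w).trans hw) (by
    filter_upwards [hev] with z' ⟨a, ha, has, hz'⟩ v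
    have h2 := tangentChart_chartFrame ((extChartAt (𝓡 (n + 2)) u).map_source has) v
    rw [(extChartAt (𝓡 (n + 2)) u).left_inv has] at h2
    rw [hz', chartGenerator_apply has, ← h2, ← hh.extDerivForm_eq hA has]
    exact h0 a ha _)
  rw [hz, chartGenerator_self, finrank_euclideanSpace, Fintype.card_fin] at h1
  rw [hh.ricci_eq, hh.extDerivForm_self hA, h1]
  push_cast
  ring

/-- X is tangential, so the hypothesis contains Ric(X,X) = 0 and hence i_X dα = 0, which unlocks the
formula for Ric(X,w). This settles dα(v,·) for tangential v; general vectors are split along N, and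
dα(N,N) = 0. -/
lemma ricci_tangent_eq_zero_iff (hn : 0 < n) :
    (∀ u ∈ Set.range ι, ∀ w : TangentSpace (𝓡 (n + 2)) u, dualForm h u w = 0 →
        ricci h u (generator u) w = 0) ↔
      ∀ u ∈ Set.range ι, ∀ v w : TangentSpace (𝓡 (n + 2)) u,
        extDerivForm (dualForm h) u v w = 0 := by
  have hn' : (n : ℝ) ≠ 0 := by positivity
  constructor
  · intro h0 u hu v w
    have h1 : ∀ u ∈ Set.range ι, ∀ w, extDerivForm (dualForm h) u (generator u) w = 0 :=
      fun u hu ↦ (hh.ricci_generator_eq_zero_iff hA hn hu).1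
        (h0 u hu _ (hh.dualForm_generator hA hu))
    obtain ⟨N, hN⟩ := hh.exists_dualForm_eq_one hA hu
    have hT (w : TangentSpace (𝓡 (n + 2)) u) (hw : dualForm h u w = 0)
        (v : TangentSpace (𝓡 (n + 2)) u) : extDerivForm (dualForm h) u w v = 0 := by
      have h2 := hh.two_mul_ricci_tangent hA hu h1 hN hw
      rw [h0 u hu w hw, mul_zero] at h2
      rw [hh.extDerivForm_tangent hA hu hN hw, (mul_eq_zero.1 h2.symm).resolve_left hn', mul_zero]
    have h3 (v : TangentSpace (𝓡 (n + 2)) u) :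
        dualForm h u (v - dualForm h u v • N) = 0 := by
      rw [map_sub, map_smul, hN, smul_eq_mul, mul_one, sub_self]
    have h4 := hT _ (h3 v) w
    have h5 := hT _ (h3 w) N
    rw [extDerivForm_sub_smul] at h4 h5
    have h6 : extDerivForm (dualForm h) u N N = 0 := by rw [extDerivForm, sub_self]
    rw [h6, mul_zero, sub_zero] at h5
    rw [hh.extDerivForm_swap hA N w, h5, neg_zero, mul_zero, sub_zero] at h4
    exact h4
  · intro h0 u hu w hw
    obtain ⟨N, hN⟩ := hh.exists_dualForm_eq_one hA hu
    have h2 := hh.two_mul_ricci_tangent hA hu (fun u hu ↦ h0 u hu _) hN hw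
    rw [h0 u hu, mul_zero] at h2
    linarith

end IsAmbientMetric

end Main

/-! ### The defining function -/

section DefiningFunction

variable {n p q : ℕ} {M : Type*} [TopologicalSpace M]
    [ChartedSpace (EuclideanSpace ℝ (Fin n)) M] [IsManifold (𝓡 n) ∞ M]
    {c : ConformalStructure n p q M}

open ConformalStructure

variable {A : Type*} [TopologicalSpace A] [ChartedSpace (EuclideanSpace ℝ (Fin (n + 2))) A]
    [MulAction PosReal A] {ι : c.RayBundle → A} (hA : IsAmbientManifold ι)
    [IsManifold (𝓡 (n + 2)) ∞ A]
  {h : ∀ u : A, TangentSpace (𝓡 (n + 2)) u →L[ℝ] TangentSpace (𝓡 (n + 2)) u →L[ℝ] ℝ}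
  (hh : IsAmbientMetric ι h) {u : A}

/-- Half the squared length of the generator in the preferred chart at `u`. -/
def chartHalfSq (h : ∀ u : A, TangentSpace (𝓡 (n + 2)) u →L[ℝ] TangentSpace (𝓡 (n + 2)) u →L[ℝ] ℝ)
    (u : A) (y : EuclideanSpace ℝ (Fin (n + 2))) : ℝ :=
  1 / 2 * chartMetric h u y (chartGenerator u y) (chartGenerator u y)

omit [IsManifold (𝓡 (n + 2)) ∞ A] in
lemma chartHalfSq_apply [IsManifold (𝓡 (n + 2)) ∞ A] {a : A}
    (ha : a ∈ (extChartAt (𝓡 (n + 2)) u).source) :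
    chartHalfSq h u (extChartAt (𝓡 (n + 2)) u a) = 1 / 2 * h a (generator a) (generator a) := by
  rw [chartHalfSq, chartGenerator_apply ha, chartMetric_tangentChart h ha]

namespace IsAmbientMetric

include hA hh

lemma contDiffAt_chartHalfSq {y : EuclideanSpace ℝ (Fin (n + 2))}
    (hy : y ∈ (extChartAt (𝓡 (n + 2)) u).target) : ContDiffAt ℝ ∞ (chartHalfSq h u) y := by
  have h1 := (hh.isPseudoMetric.isCoordMetric u).contDiffAt hy
  have h2 := contDiffAt_chartGenerator hA.smooth_action hy
  exact contDiffAt_const.mul ((h1.clm_apply h2).clm_apply h2)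

/-- Metric compatibility gives dr(v) = h(∇_vX, X), and ∇X is the identity plus half of dα. -/
lemma two_mul_fderiv_chartHalfSq {y : EuclideanSpace ℝ (Fin (n + 2))}
    (hy : y ∈ (extChartAt (𝓡 (n + 2)) u).target) (v : EuclideanSpace ℝ (Fin (n + 2))) :
    2 * fderiv ℝ (chartHalfSq h u) y v = 2 * chartMetric h u y v (chartGenerator u y) +
      curl (chartMetric h u) (chartGenerator u) y v (chartGenerator u y) := by
  have hG := hh.isPseudoMetric.isCoordMetric u
  have h2 := (contDiffAt_chartGenerator hA.smooth_action hy).differentiableAt (by simp)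
  have h1 := hG.fderiv_metric_along (φ := fun y ↦ y) hy differentiableAt_id h2 h2 v
  rw [covAlong_comp (φ := fun y ↦ y) h2 differentiableAt_id, fderiv_fun_id] at h1
  have h3 := hG.two_mul_apply_nabla hy (isHomothetic_chartGenerator hA.smooth_action
    hh.isPseudoMetric hh.homogeneous hy) v (chartGenerator u y)
  have h4 : DifferentiableAt ℝ
      (fun z ↦ chartMetric h u z (chartGenerator u z) (chartGenerator u z)) y :=
    ((hG.differentiableAt hy).clm_apply h2).clm_apply h2
  have h5 : fderiv ℝ (chartHalfSq h u) y v = 1 / 2 *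
      fderiv ℝ (fun z ↦ chartMetric h u z (chartGenerator u z) (chartGenerator u z)) y v := by
    unfold chartHalfSq
    rw [fderiv_const_mul h4]
    rfl
  rw [h5, h1, ← h3, hG.symm _ hy (chartGenerator u y)]
  simp only [ContinuousLinearMap.coe_id', id_eq]
  ring

lemma contMDiff_halfSq : ContMDiff (𝓡 (n + 2)) 𝓘(ℝ, ℝ) ∞
    (fun a ↦ 1 / 2 * h a (generator a) (generator a)) := by
  intro a
  have ha := mem_extChartAt_source (I := 𝓡 (n + 2)) a
  refine ContMDiffAt.congr_of_eventuallyEq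
    (f := fun b ↦ chartHalfSq h a (extChartAt (𝓡 (n + 2)) a b)) ?_ ?_
  · exact ContMDiffAt.comp (g := chartHalfSq h a) a (hh.contDiffAt_chartHalfSq hA
      ((extChartAt (𝓡 (n + 2)) a).map_source ha)).contMDiffAt contMDiffAt_extChartAt
  · filter_upwards [extChartAt_source_mem_nhds (I := 𝓡 (n + 2)) a] with b hb
    exact (chartHalfSq_apply hb).symm

lemma mfderiv_halfSq (v : TangentSpace (𝓡 (n + 2)) u) :
    (mfderiv (𝓡 (n + 2)) 𝓘(ℝ, ℝ) (fun a ↦ 1 / 2 * h a (generator a) (generator a)) u v : ℝ) =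
      fderiv ℝ (chartHalfSq h u) (extChartAt (𝓡 (n + 2)) u u) v := by
  have hu := mem_extChartAt_source (I := 𝓡 (n + 2)) u
  have h1 : (fun a ↦ 1 / 2 * h a (generator a) (generator a)) =ᶠ[𝓝 u]
      fun b ↦ chartHalfSq h u (extChartAt (𝓡 (n + 2)) u b) := by
    filter_upwards [extChartAt_source_mem_nhds (I := 𝓡 (n + 2)) u] with b hb
    exact (chartHalfSq_apply hb).symm
  have h2 := mvfderiv_fderiv_comp (IN := 𝓡 (n + 2)) (g := fun b ↦ extChartAt (𝓡 (n + 2)) u b)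
    ((hh.contDiffAt_chartHalfSq hA ((extChartAt (𝓡 (n + 2)) u).map_source hu)).differentiableAt
      (by simp)) (mdifferentiableAt_extChartAt_of_mem hu) v
  have h3 := congrArg (fun L : EuclideanSpace ℝ (Fin (n + 2)) →L[ℝ] ℝ ↦ L v)
    (mvfderiv_congr (IN := 𝓡 (n + 2)) h1)
  refine h3.trans (h2.trans ?_)
  exact congrArg _ (tangentChart_self u v)

lemma halfSq_eq_zero (hu : u ∈ Set.range ι) : 1 / 2 * h u (generator u) (generator u) = 0 := by
  have := hh.dualForm_generator hA hu
  rw [dualForm] at this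
  rw [this, mul_zero]

lemma mfderiv_halfSq_eq
    (h0 : ∀ w, extDerivForm (dualForm h) u (generator u) w = 0) (v : TangentSpace (𝓡 (n + 2)) u) :
    (mfderiv (𝓡 (n + 2)) 𝓘(ℝ, ℝ) (fun a ↦ 1 / 2 * h a (generator a) (generator a)) u v : ℝ) =
      h u (generator u) v := by
  have ht := (extChartAt (𝓡 (n + 2)) u).map_source (mem_extChartAt_source (I := 𝓡 (n + 2)) u)
  have h1 := hh.two_mul_fderiv_chartHalfSq hA ht v
  have h2 := h0 v
  rw [hh.extDerivForm_swap hA, hh.extDerivForm_self hA, neg_eq_zero] at h2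
  rw [chartGenerator_self, h2, add_zero, (chartMetric_self u v (generator u) :)] at h1
  exact (hh.mfderiv_halfSq hA v).trans ((mul_left_cancel₀ (two_ne_zero (α := ℝ)) h1).trans
    (hh.isPseudoMetric.symm u v (generator u)))

lemma isDefiningFunction
    (h0 : ∀ u ∈ Set.range ι, ∀ w, extDerivForm (dualForm h) u (generator u) w = 0) :
    IsDefiningFunction (n := n) (Set.range ι)
      (fun u ↦ 1 / 2 * h u (generator u) (generator u)) := by
  obtain ⟨g, hg⟩ := c.nonempty
  have hloc : ∀ u ∈ Set.range ι, ∀ᶠ a in 𝓝 u,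
      1 / 2 * h a (generator a) (generator a) = 0 → a ∈ Set.range ι := by
    intro u hu
    obtain ⟨⟨x, t⟩, rfl⟩ := IsAmbientManifold.exists_param hg hu
    set u := ι (triv hg (x, t)) with hudef
    have hs := mem_extChartAt_source (I := 𝓡 (n + 2)) u
    have hx := mem_extChartAt_source (I := 𝓡 n) x
    have hxt := (extChartAt (𝓡 n) x).map_source hx
    have ht := (extChartAt (𝓡 (n + 2)) u).map_source hs
    have hC := hh.isNullCone hA hg x t hs
    have hφ : chartParam ι hg x u (extChartAt (𝓡 n) x x, t) = extChartAt (𝓡 (n + 2)) u u :=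
      chartParam_apply hg hx t
    have hD (w : EuclideanSpace ℝ (Fin (n + 2))) :
        fderiv ℝ (chartHalfSq h u) (extChartAt (𝓡 (n + 2)) u u) w = h u (generator u) w :=
      (hh.mfderiv_halfSq hA w).symm.trans (hh.mfderiv_halfSq_eq hA (h0 u hu) w)
    obtain ⟨N, hN⟩ := hh.exists_dualForm_eq_one hA hu
    have hmem := eventually_chartParam_mem hA hg (z := (extChartAt (𝓡 n) x x, t)) (u := u) hxt
      (by rwa [(extChartAt (𝓡 n) x).left_inv hx])
    -- At u one has dr = α, so dr(N) = 1 and ker dr = T𝒬: the two transversality conditions.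
    have key := eventually_mem_of_transverse (φ := chartParam ι hg x u) (r := chartHalfSq h u)
      (z := (extChartAt (𝓡 n) x x, t)) (N := N) (hC.contDiffAt.self_of_nhds.of_le (by simp))
      (by rw [hφ]; exact (hh.contDiffAt_chartHalfSq hA ht).of_le (by simp))
      (by
        filter_upwards [hmem] with z hz
        rw [chartParam, chartHalfSq_apply hz.2]
        exact hh.halfSq_eq_zero hA ⟨_, rfl⟩) hmem
      (by rw [hφ]; exact ((hD N).trans hN).trans_ne one_ne_zero)
      (by
        intro w hw
        rw [hφ, hD] at hw
        refine hC.mem_range w ?_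
        rw [hφ, chartGenerator_self, (chartMetric_self u (generator u) w :)]
        exact hw)
    rw [hφ] at key
    filter_upwards [(continuousAt_extChartAt (I := 𝓡 (n + 2)) u).eventually key,
      extChartAt_source_mem_nhds (I := 𝓡 (n + 2)) u] with a ha has ha0
    obtain ⟨z, hz, hza⟩ := ha (by rw [chartHalfSq_apply has]; exact ha0)
    exact ⟨_, (extChartAt (𝓡 (n + 2)) u).injOn hz.2 has hza⟩
  -- The neighbourhood U consists of the interior points of the set where r = 0 forces membership in
  -- 𝒬; it contains 𝒬 by `hloc`.
  refine ⟨interior {a | 1 / 2 * h a (generator a) (generator a) = 0 → a ∈ Set.range ι},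
    isOpen_interior, fun u hu ↦ mem_interior_iff_mem_nhds.2 (hloc u hu),
    (hh.contMDiff_halfSq hA).contMDiffOn, fun u hu ↦ ⟨interior_subset hu, hh.halfSq_eq_zero hA⟩,
    fun u hu hd ↦ ?_⟩
  obtain ⟨N, hN⟩ := hh.exists_dualForm_eq_one hA hu
  have h1 := hh.mfderiv_halfSq_eq hA (h0 u hu) N
  have h2 := congrArg (fun L : EuclideanSpace ℝ (Fin (n + 2)) →L[ℝ] ℝ ↦ L N) hd
  exact zero_ne_one (α := ℝ) (h2.symm.trans (h1.trans hN))

end IsAmbientMetric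

end DefiningFunction

/-! ### The pull-back tractor bundle and its connection -/

section Tractor

variable {n : ℕ} {M : Type*} [TopologicalSpace M]
    [ChartedSpace (EuclideanSpace ℝ (Fin n)) M] [IsManifold (𝓡 n) ∞ M]
    {A : Type*} [TopologicalSpace A] [ChartedSpace (EuclideanSpace ℝ (Fin (n + 2))) A]
    [IsManifold (𝓡 (n + 2)) ∞ A] {f : ContMDiffMap (𝓡 n) (𝓡 (n + 2)) M A ∞}
    {σ : ∀ x, Tractor f x} {x : M}

lemma trivializationAt_tractor (x y : M) (v : Tractor f y) :
    (trivializationAt (EuclideanSpace ℝ (Fin (n + 2))) (Tractor f) x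
      (TotalSpace.mk' (EuclideanSpace ℝ (Fin (n + 2))) y v)).2 =
      vecCoord (f x) (⟨f y, v⟩ : TangentBundle (𝓡 (n + 2)) A) := rfl

/-- The vector field along `f` corresponding to a section of the tractor bundle. -/
def fieldAlong (σ : ∀ x, Tractor f x) (x : M) : TangentBundle (𝓡 (n + 2)) A := ⟨f x, σ x⟩

lemma contMDiffAt_fieldAlong_iff :
    ContMDiffAt (𝓡 n) (𝓡 (n + 2)).tangent ∞ (fieldAlong σ) x ↔
    ContMDiffAt (𝓡 n) ((𝓡 n).prod 𝓘(ℝ, EuclideanSpace ℝ (Fin (n + 2)))) ∞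
      (fun x ↦ TotalSpace.mk' (EuclideanSpace ℝ (Fin (n + 2))) x (σ x)) x := by
  rw [contMDiffAt_section]
  exact contMDiffAt_section_iff (f := f) f.contMDiff.contMDiffAt

lemma mdifferentiableAt_fieldAlong_iff :
    MDifferentiableAt (𝓡 n) (𝓡 (n + 2)).tangent (fieldAlong σ) x ↔
    MDifferentiableAt (𝓡 n) ((𝓡 n).prod 𝓘(ℝ, EuclideanSpace ℝ (Fin (n + 2))))
      (fun x ↦ TotalSpace.mk' (EuclideanSpace ℝ (Fin (n + 2))) x (σ x)) x := by
  rw [mdifferentiableAt_section]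
  exact mdifferentiableAt_section_iff (f := f) (f.contMDiff.mdifferentiable (by simp) x)

lemma isSmoothSection_iff :
    IsSmoothSection n σ ↔ ContMDiff (𝓡 n) (𝓡 (n + 2)).tangent ∞ (fieldAlong σ) :=
  forall_congr' fun _ ↦ contMDiffAt_fieldAlong_iff.symm

variable (h : ∀ u : A, TangentSpace (𝓡 (n + 2)) u →L[ℝ] TangentSpace (𝓡 (n + 2)) u →L[ℝ] ℝ)

/-- The covariant derivative of a field along `f` as a linear map. -/
def covDerivMap (σ : ∀ x, Tractor f x) (x : M) : EuclideanSpace ℝ (Fin n) →L[ℝ]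
    EuclideanSpace ℝ (Fin (n + 2)) :=
  mvfderiv (𝓡 n) (fun y ↦ vecCoord (f x) (fieldAlong σ y)) x +
    ((christoffelMap (chartMetric h (f x)) (extChartAt (𝓡 (n + 2)) (f x) (f x))).flip (σ x)).comp
      (mfderiv (𝓡 n) (𝓡 (n + 2)) f x)

/-- The connection on the tractor bundle induced by the Levi-Civita connection. -/
def tractorConnection (f : ContMDiffMap (𝓡 n) (𝓡 (n + 2)) M A ∞) :
    CovariantDerivative (𝓡 n) (EuclideanSpace ℝ (Fin (n + 2))) (Tractor f) where
  toFun σ x := covDerivMap h σ x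
  isCovariantDerivativeOnUniv :=
    { add := by
        intro σ τ x hσ hτ _
        rw [← mdifferentiableAt_fieldAlong_iff] at hσ hτ
        ext1 v
        -- `covDerivMap` unfolds to `covDerivAlong` of `fieldAlong σ`, so the rules for fields along
        -- maps apply directly.
        exact covDerivAlong_add hσ hτ v
      leibniz := by
        intro σ a x hσ ha _
        rw [← mdifferentiableAt_fieldAlong_iff] at hσ
        ext1 v
        exact covDerivAlong_smul ha hσ v }

/-- The coordinate expression of a section of the tractor bundle. -/
def chartSection (σ : ∀ x, Tractor f x) (x : M) (u : A) (y : EuclideanSpace ℝ (Fin n)) :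
    EuclideanSpace ℝ (Fin (n + 2)) := vecCoord u (fieldAlong σ ((extChartAt (𝓡 n) x).symm y))

variable {x₀ : M} {u : A} {h} {p q : ℕ}

lemma chartSection_apply (hx : x ∈ (extChartAt (𝓡 n) x₀).source) :
    chartSection σ x₀ u (extChartAt (𝓡 n) x₀ x) = vecCoord u (fieldAlong σ x) := by
  rw [chartSection, (extChartAt (𝓡 n) x₀).left_inv hx]

lemma contDiffAt_chartSection (hx : x ∈ (extChartAt (𝓡 n) x₀).source)
    (hu : f x ∈ (extChartAt (𝓡 (n + 2)) u).source)
    (hσ : ContMDiffAt (𝓡 n) (𝓡 (n + 2)).tangent ∞ (fieldAlong σ) x) :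
    ContDiffAt ℝ ∞ (chartSection σ x₀ u) (extChartAt (𝓡 n) x₀ x) := by
  have h1 : ContMDiffAt 𝓘(ℝ, EuclideanSpace ℝ (Fin n)) (𝓡 n) ∞ (extChartAt (𝓡 n) x₀).symm
      (extChartAt (𝓡 n) x₀ x) :=
    (contMDiffOn_extChartAt_symm x₀).contMDiffAt
      ((isOpen_extChartAt_target x₀).mem_nhds ((extChartAt (𝓡 n) x₀).map_source hx))
  have h2 : ContMDiffAt (𝓡 n) 𝓘(ℝ, EuclideanSpace ℝ (Fin (n + 2))) ∞
      (fun x ↦ vecCoord u (fieldAlong σ x)) x :=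
    (contMDiffAt_section_iff_of_mem f.contMDiff.contMDiffAt hu).1 hσ
  refine (ContMDiffAt.comp (g := fun x ↦ vecCoord u (fieldAlong σ x)) (extChartAt (𝓡 n) x₀ x)
    ?_ h1).contDiffAt
  rwa [(extChartAt (𝓡 n) x₀).left_inv hx]

/-- The tractor connection in charts. -/
lemma tangentChart_tractorConnection (hh : IsPseudoMetric (𝓡 (n + 2)) (EuclideanSpace ℝ (Fin (n + 2)))
      (TangentSpace (𝓡 (n + 2)) : A → Type _) p q h) (hx : x ∈ (extChartAt (𝓡 n) x₀).source)
    (hu : f x ∈ (extChartAt (𝓡 (n + 2)) u).source)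
    (hσ : ContMDiffAt (𝓡 n) (𝓡 (n + 2)).tangent ∞ (fieldAlong σ) x) (v : TangentSpace (𝓡 n) x) :
    tangentChart u (f x) (tractorConnection h f σ x v) =
      covAlong (chartMetric h u) (chartMap (m := n) (m' := n + 2) f x₀ u) (chartSection σ x₀ u)
        (extChartAt (𝓡 n) x₀ x) (tangentChart x₀ x v) := by
  have h1 := covDerivIn_eq hh (hσ.mdifferentiableAt (by simp)) hu v
  refine h1.symm.trans ?_
  have hxs := extChartAt_source_mem_nhds' (I := 𝓡 n) hx
  have e1 : (fun y ↦ vecCoord u (fieldAlong σ y)) =ᶠ[𝓝 x]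
      fun y ↦ chartSection σ x₀ u (extChartAt (𝓡 n) x₀ y) := by
    filter_upwards [hxs] with y hy
    exact (chartSection_apply hy).symm
  have e2 : (fun y ↦ extChartAt (𝓡 (n + 2)) u (fieldAlong σ y).proj) =ᶠ[𝓝 x]
      fun y ↦ chartMap (m := n) (m' := n + 2) f x₀ u (extChartAt (𝓡 n) x₀ y) := by
    filter_upwards [hxs] with y hy
    exact (chartMap_apply hy).symm
  have hd := mdifferentiableAt_extChartAt_of_mem hx
  have h2 := mvfderiv_fderiv_comp ((contDiffAt_chartSection hx hu hσ).differentiableAt (by simp))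
    hd v
  have h3 := mvfderiv_fderiv_comp ((contDiffAt_chartMap hx hu
    f.contMDiff.contMDiffAt).differentiableAt (by simp)) hd v
  have h4 : mvfderiv (𝓡 n) (fun y ↦ extChartAt (𝓡 n) x₀ y) x v = tangentChart x₀ x v := rfl
  rw [covDerivIn, mvfderiv_congr e1, mvfderiv_congr e2, h2, h3, h4, covAlong,
    chartSection_apply hx, chartMap_apply hx]
  rfl

end Tractor

/-! ### Smoothness of the tractor metric and connection -/

section Tractor

variable {n : ℕ} {M : Type*} [TopologicalSpace M]
    [ChartedSpace (EuclideanSpace ℝ (Fin n)) M] [IsManifold (𝓡 n) ∞ M]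
    {A : Type*} [TopologicalSpace A] [ChartedSpace (EuclideanSpace ℝ (Fin (n + 2))) A]
    [IsManifold (𝓡 (n + 2)) ∞ A] {f : ContMDiffMap (𝓡 n) (𝓡 (n + 2)) M A ∞}
    {σ : ∀ x, Tractor f x} {x x₀ : M}
    {h : ∀ u : A, TangentSpace (𝓡 (n + 2)) u →L[ℝ] TangentSpace (𝓡 (n + 2)) u →L[ℝ] ℝ} {p q : ℕ}

lemma mem_baseSet_tractor (hx : f x ∈ (extChartAt (𝓡 (n + 2)) (f x₀)).source) :
    x ∈ (trivializationAt (EuclideanSpace ℝ (Fin (n + 2))) (Tractor f) x₀).baseSet := by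
  rw [extChartAt_source] at hx
  exact hx

lemma tangentChart_trivializationAt_symm (hx : f x ∈ (extChartAt (𝓡 (n + 2)) (f x₀)).source)
    (v : EuclideanSpace ℝ (Fin (n + 2))) :
    tangentChart (f x₀) (f x)
      ((trivializationAt (EuclideanSpace ℝ (Fin (n + 2))) (Tractor f) x₀).symm x v) = v := by
  have h1 := (trivializationAt (EuclideanSpace ℝ (Fin (n + 2))) (Tractor f) x₀).apply_mk_symm
    (mem_baseSet_tractor hx) v
  have h2 := congrArg Prod.snd h1
  rw [trivializationAt_tractor, vecCoord_eq hx] at h2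
  exact h2

lemma continuousLinearMapAt_tractor (hx : f x ∈ (extChartAt (𝓡 (n + 2)) (f x₀)).source)
    (v : Tractor f x) :
    (trivializationAt (EuclideanSpace ℝ (Fin (n + 2))) (Tractor f) x₀).continuousLinearMapAt ℝ x v =
      tangentChart (f x₀) (f x) v := by
  rw [Trivialization.continuousLinearMapAt_apply, Trivialization.linearMapAt_apply,
    if_pos (mem_baseSet_tractor hx), trivializationAt_tractor, vecCoord_eq hx]

lemma tangentChart_trivializationAt_symmL (hx : x ∈ (extChartAt (𝓡 n) x₀).source)
    (v : EuclideanSpace ℝ (Fin n)) :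
    tangentChart x₀ x ((trivializationAt (EuclideanSpace ℝ (Fin n))
      (TangentSpace (𝓡 n) : M → Type _) x₀).symmL ℝ x v) = v := by
  have hx' : x ∈ (trivializationAt (EuclideanSpace ℝ (Fin n))
      (TangentSpace (𝓡 n) : M → Type _) x₀).baseSet := by
    rw [TangentBundle.trivializationAt_baseSet]
    rwa [extChartAt_source] at hx
  have h1 := (trivializationAt (EuclideanSpace ℝ (Fin n))
    (TangentSpace (𝓡 n) : M → Type _) x₀).apply_mk_symm hx' v
  have h2 := congrArg Prod.snd h1
  rw [← Trivialization.symmL_apply (R := ℝ) _ hx'] at h2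
  rwa [trivializationAt_snd _ hx] at h2

lemma eventually_slice_mem (x₀ : M) :
    ∀ᶠ x in 𝓝 x₀, f x ∈ (extChartAt (𝓡 (n + 2)) (f x₀)).source :=
  f.contMDiff.continuous.continuousAt (extChartAt_source_mem_nhds (I := 𝓡 (n + 2)) (f x₀))

lemma isPseudoMetric_tractorMetric (hh : IsPseudoMetric (𝓡 (n + 2)) (EuclideanSpace ℝ (Fin (n + 2)))
      (TangentSpace (𝓡 (n + 2)) : A → Type _) p q h) :
    IsPseudoMetric (𝓡 n) (EuclideanSpace ℝ (Fin (n + 2))) (Tractor f) p q (tractorMetric h f) where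
  symm x v w := hh.symm (f x) v w
  nondegenerate x v hv := hh.nondegenerate (f x) v hv
  sigPos_eq x := hh.sigPos_eq (f x)
  sigNeg_eq x := hh.sigNeg_eq (f x)
  contMDiff := by
    intro x₀
    rw [contMDiffAt_hom_bundle]
    refine ⟨contMDiffAt_id, ?_⟩
    have h1 : ContMDiffAt (𝓡 n) 𝓘(ℝ, EuclideanSpace ℝ (Fin (n + 2)) →L[ℝ]
        EuclideanSpace ℝ (Fin (n + 2)) →L[ℝ] ℝ) ∞
        (fun x ↦ chartMetric h (f x₀) (extChartAt (𝓡 (n + 2)) (f x₀) (f x))) x₀ := by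
      have h2 : ContMDiffAt (𝓡 n) 𝓘(ℝ, EuclideanSpace ℝ (Fin (n + 2))) ∞
          (fun x ↦ extChartAt (𝓡 (n + 2)) (f x₀) (f x)) x₀ :=
        ContMDiffAt.comp (g := extChartAt (𝓡 (n + 2)) (f x₀)) x₀
          (contMDiffAt_extChartAt (I := 𝓡 (n + 2))) f.contMDiff.contMDiffAt
      exact ContMDiffAt.comp (g := chartMetric h (f x₀)) x₀
        ((hh.isCoordMetric (f x₀)).contDiffAt (mem_extChartAt_target _)).contMDiffAt h2
    refine h1.congr_of_eventuallyEq ?_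
    filter_upwards [eventually_slice_mem (f := f) x₀] with x hx
    ext1 v
    ext1 w
    rw [inCoordinates_apply_eq₂ (mem_baseSet_tractor hx) (mem_baseSet_tractor hx)
      (Set.mem_univ x)]
    have h3 := chartMetric_tangentChart h hx
      ((trivializationAt (EuclideanSpace ℝ (Fin (n + 2))) (Tractor f) x₀).symm x v)
      ((trivializationAt (EuclideanSpace ℝ (Fin (n + 2))) (Tractor f) x₀).symm x w)
    rw [tangentChart_trivializationAt_symm hx, tangentChart_trivializationAt_symm hx] at h3
    rw [h3]
    simp only [Trivialization.linearMapAt_apply]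
    exact (if_pos (Set.mem_univ x)).trans rfl

/-- The definition uses a different chart at every point, which hides smoothness. In the fixed
charts at x₀ and f(x₀), `tangentChart_tractorConnection` exhibits the connection as the smooth
coordinate expression `L` below. -/
lemma contMDiffCovariantDerivative_tractorConnection
    (hh : IsPseudoMetric (𝓡 (n + 2)) (EuclideanSpace ℝ (Fin (n + 2)))
      (TangentSpace (𝓡 (n + 2)) : A → Type _) p q h) :
    CovariantDerivative.ContMDiffCovariantDerivative (tractorConnection h f) ∞ := by
  refine ⟨⟨fun {σ} hσ ↦ ?_⟩⟩
  have hσ' (x : M) : ContMDiffAt (𝓡 n) (𝓡 (n + 2)).tangent ∞ (fieldAlong σ) x :=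
    contMDiffAt_fieldAlong_iff.2 ((hσ.contMDiffAt univ_mem).of_le (by simp))
  intro x₀ _
  refine ContMDiffAt.contMDiffWithinAt ?_
  rw [contMDiffAt_hom_bundle]
  refine ⟨contMDiffAt_id, ?_⟩
  let u := f x₀
  have hx₀ := mem_extChartAt_source (I := 𝓡 n) x₀
  have hu₀ := mem_extChartAt_source (I := 𝓡 (n + 2)) (f x₀)
  let φ := chartMap (m := n) (m' := n + 2) f x₀ u
  let b := chartSection σ x₀ u
  have hφ : ContDiffAt ℝ ∞ φ (extChartAt (𝓡 n) x₀ x₀) :=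
    contDiffAt_chartMap hx₀ hu₀ f.contMDiff.contMDiffAt
  have hb : ContDiffAt ℝ ∞ b (extChartAt (𝓡 n) x₀ x₀) :=
    contDiffAt_chartSection hx₀ hu₀ (hσ' x₀)
  have hΓ : ContDiffAt ℝ ∞ (christoffelMap (chartMetric h u)) (φ (extChartAt (𝓡 n) x₀ x₀)) := by
    refine (hh.isCoordMetric u).contDiffAt_christoffelMap ?_
    change chartMap (m := n) (m' := n + 2) f x₀ u _ ∈ _
    rw [chartMap_apply hx₀]
    exact mem_extChartAt_target _
  let L : EuclideanSpace ℝ (Fin n) → EuclideanSpace ℝ (Fin n) →L[ℝ] EuclideanSpace ℝ (Fin (n + 2)) :=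
    fun z ↦ fderiv ℝ b z +
      ((ContinuousLinearMap.flipₗᵢ ℝ _ _ _ (christoffelMap (chartMetric h u) (φ z))) (b z)).comp
        (fderiv ℝ φ z)
  have hL : ContDiffAt ℝ ∞ L (extChartAt (𝓡 n) x₀ x₀) := by
    have h1 : ContDiffAt ℝ ∞ (fun z ↦ ContinuousLinearMap.flipₗᵢ ℝ (EuclideanSpace ℝ (Fin (n + 2)))
        (EuclideanSpace ℝ (Fin (n + 2))) (EuclideanSpace ℝ (Fin (n + 2)))
        (christoffelMap (chartMetric h u) (φ z))) (extChartAt (𝓡 n) x₀ x₀) :=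
      (ContinuousLinearMap.flipₗᵢ ℝ (EuclideanSpace ℝ (Fin (n + 2)))
        (EuclideanSpace ℝ (Fin (n + 2))) (EuclideanSpace ℝ (Fin (n + 2)))).contDiff.contDiffAt.comp
        _ (ContDiffAt.comp (g := christoffelMap (chartMetric h u)) _ hΓ hφ)
    exact (hb.fderiv_right (by simp)).add ((h1.clm_apply hb).clm_comp (hφ.fderiv_right (by simp)))
  have hLM : ContMDiffAt (𝓡 n) 𝓘(ℝ, EuclideanSpace ℝ (Fin n) →L[ℝ] EuclideanSpace ℝ (Fin (n + 2))) ∞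
      (fun x ↦ L (extChartAt (𝓡 n) x₀ x)) x₀ :=
    ContMDiffAt.comp (g := L) x₀ hL.contMDiffAt (contMDiffAt_extChartAt (I := 𝓡 n))
  refine hLM.congr_of_eventuallyEq ?_
  filter_upwards [eventually_slice_mem (f := f) x₀,
    extChartAt_source_mem_nhds (I := 𝓡 n) x₀] with x hx hxs
  ext1 v
  have h1 := tangentChart_tractorConnection hh hxs hx (hσ' x)
    ((trivializationAt (EuclideanSpace ℝ (Fin n))
      (TangentSpace (𝓡 n) : M → Type _) x₀).symmL ℝ x v)
  rw [tangentChart_trivializationAt_symmL hxs] at h1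
  refine Eq.trans ?_ h1
  exact continuousLinearMapAt_tractor hx _

end Tractor

/-! ### The weighted action on tangent vectors -/

section Action

variable {n : ℕ} {A : Type*} [TopologicalSpace A] [ChartedSpace (EuclideanSpace ℝ (Fin (n + 2))) A]
  [MulAction PosReal A] [IsManifold (𝓡 (n + 2)) ∞ A]

omit [MulAction PosReal A] [IsManifold (𝓡 (n + 2)) ∞ A] in
lemma tangentBundle_ext {ζ η : TangentBundle (𝓡 (n + 2)) A} (h1 : ζ.proj = η.proj)
    (h2 : (ζ.2 : EuclideanSpace ℝ (Fin (n + 2))) = η.2) : ζ = η := by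
  obtain ⟨a, v⟩ := ζ
  obtain ⟨b, w⟩ := η
  obtain rfl : a = b := h1
  exact congrArg (TotalSpace.mk a) h2

lemma tractorAction_one (ζ : TangentBundle (𝓡 (n + 2)) A) : tractorAction 1 ζ = ζ := by
  refine tangentBundle_ext (one_smul _ _) ?_
  have h1 : (fun u : A ↦ (1 : PosReal) • u) = id := funext fun u ↦ one_smul _ u
  change ((1 : ℝ)⁻¹ • mfderiv (𝓡 (n + 2)) (𝓡 (n + 2)) (fun u : A ↦ (1 : PosReal) • u) ζ.proj ζ.2 :
    EuclideanSpace ℝ (Fin (n + 2))) = ζ.2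
  rw [h1, mfderiv_id, inv_one]
  exact one_smul ℝ (ζ.2 : EuclideanSpace ℝ (Fin (n + 2)))

section Smooth

variable (hact : ContMDiff (𝓘(ℝ, ℝ).prod (𝓡 (n + 2))) (𝓡 (n + 2)) ∞
  (fun z : ℝ × A ↦ expPos z.1 • z.2))

include hact

lemma tractorAction_mul (s t : PosReal) (ζ : TangentBundle (𝓡 (n + 2)) A) :
    tractorAction (s * t) ζ = tractorAction s (tractorAction t ζ) := by
  refine tangentBundle_ext (mul_smul _ _ _) ?_
  have h1 : (fun u : A ↦ (s * t) • u) = (fun u : A ↦ s • u) ∘ fun u : A ↦ t • u :=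
    funext fun u ↦ mul_smul s t u
  have hd (s : PosReal) (u : A) := (contMDiff_smul hact s).mdifferentiable (by simp) u
  have h2 := mfderiv_comp ζ.proj (hd s _) (hd t ζ.proj)
  rw [← h1] at h2
  have h3 := congrArg (fun L : EuclideanSpace ℝ (Fin (n + 2)) →L[ℝ]
    EuclideanSpace ℝ (Fin (n + 2)) ↦ L ζ.2) h2
  have h4 : (((s * t : PosReal) : ℝ))⁻¹ = (s : ℝ)⁻¹ * (t : ℝ)⁻¹ := by
    rw [← mul_inv]
    rfl
  have h5 (L K : EuclideanSpace ℝ (Fin (n + 2)) →L[ℝ] EuclideanSpace ℝ (Fin (n + 2)))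
      (v : EuclideanSpace ℝ (Fin (n + 2))) :
      ((s * t : PosReal) : ℝ)⁻¹ • (L.comp K) v = (s : ℝ)⁻¹ • L ((t : ℝ)⁻¹ • K v) := by
    rw [h4, map_smul, mul_smul]
    rfl
  exact (congrArg (fun v : EuclideanSpace ℝ (Fin (n + 2)) ↦
    (((s * t : PosReal) : ℝ))⁻¹ • v) h3).trans (h5 (mfderiv (𝓡 (n + 2)) (𝓡 (n + 2))
      (fun u : A ↦ s • u) (t • ζ.proj)) (mfderiv (𝓡 (n + 2)) (𝓡 (n + 2))
      (fun u : A ↦ t • u) ζ.proj) ζ.2)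

lemma tractorAction_inv (s : PosReal) (ζ : TangentBundle (𝓡 (n + 2)) A) :
    tractorAction s⁻¹ (tractorAction s ζ) = ζ := by
  rw [← tractorAction_mul hact, inv_mul_cancel, tractorAction_one]

lemma mfderiv_action_fiber (t : ℝ) (a : A) (v : EuclideanSpace ℝ (Fin (n + 2))) :
    (mfderiv (𝓘(ℝ, ℝ).prod (𝓡 (n + 2))) (𝓡 (n + 2)) (fun z : ℝ × A ↦ expPos z.1 • z.2) (t, a)
      ((0, v) : ℝ × EuclideanSpace ℝ (Fin (n + 2))) : EuclideanSpace ℝ (Fin (n + 2))) =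
    mfderiv (𝓡 (n + 2)) (𝓡 (n + 2)) (fun u : A ↦ expPos t • u) a v := by
  have hk : HasMFDerivAt (𝓡 (n + 2)) (𝓘(ℝ, ℝ).prod (𝓡 (n + 2))) (fun a : A ↦ (t, a)) a
      ((0 : EuclideanSpace ℝ (Fin (n + 2)) →L[ℝ] ℝ).prod
        (ContinuousLinearMap.id ℝ (EuclideanSpace ℝ (Fin (n + 2))))) :=
    (hasMFDerivAt_const t a).prodMk (hasMFDerivAt_id a)
  have h1 := ((hact.mdifferentiable (by simp) (t, a)).hasMFDerivAt.comp a hk).mfderiv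
  exact (congrArg (fun L : EuclideanSpace ℝ (Fin (n + 2)) →L[ℝ]
    EuclideanSpace ℝ (Fin (n + 2)) ↦ L v) h1).symm

/-- Tρ^{e^t}ζ is the tangent map of the joint action (t,u) ↦ e^t u applied to (0,ζ), hence smooth in
t and ζ together; the factor e^{-t} is a smooth rescaling. -/
lemma contMDiff_tractorAction :
    ContMDiff (𝓘(ℝ, ℝ).prod (𝓡 (n + 2)).tangent) (𝓡 (n + 2)).tangent ∞
      (fun z : ℝ × TangentBundle (𝓡 (n + 2)) A ↦ tractorAction (expPos z.1) z.2) := by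
  have := isManifold_one (m := n + 2) (A := A)
  have h0 : ContMDiff 𝓘(ℝ, ℝ) 𝓘(ℝ, ℝ).tangent ∞
      (fun t : ℝ ↦ (⟨t, 0⟩ : TangentBundle 𝓘(ℝ, ℝ) ℝ)) :=
    contMDiff_vectorSpace_iff_contDiff.2 contDiff_const
  have h1 : ContMDiff (𝓘(ℝ, ℝ).prod (𝓡 (n + 2)).tangent) (𝓘(ℝ, ℝ).prod (𝓡 (n + 2))).tangent ∞
      (fun z : ℝ × TangentBundle (𝓡 (n + 2)) A ↦
        (equivTangentBundleProd 𝓘(ℝ, ℝ) ℝ (𝓡 (n + 2)) A).symm (⟨z.1, 0⟩, z.2)) :=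
    contMDiff_equivTangentBundleProd_symm.comp
      ((h0.comp contMDiff_fst).prodMk contMDiff_snd)
  have h2 := (hact.contMDiff_tangentMap (m := ∞) (by simp)).comp h1
  intro z
  have h3 : ContMDiffAt (𝓘(ℝ, ℝ).prod (𝓡 (n + 2)).tangent) (𝓡 (n + 2)) ∞
      (fun z : ℝ × TangentBundle (𝓡 (n + 2)) A ↦ expPos z.1 • z.2.proj) z := by
    have h4 : ContMDiff (𝓘(ℝ, ℝ).prod (𝓡 (n + 2)).tangent) (𝓡 (n + 2)) ∞
        (fun z : ℝ × TangentBundle (𝓡 (n + 2)) A ↦ z.2.proj) :=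
      (contMDiff_proj (IB := 𝓡 (n + 2)) (n := ∞) (TangentSpace (𝓡 (n + 2)) : A → Type _)).comp
        contMDiff_snd
    exact (hact.comp (contMDiff_fst.prodMk h4)) z
  have h5 : ContMDiffAt (𝓘(ℝ, ℝ).prod (𝓡 (n + 2)).tangent) 𝓘(ℝ, ℝ) ∞
      (fun z : ℝ × TangentBundle (𝓡 (n + 2)) A ↦ (Real.exp z.1)⁻¹) z := by
    have h6 : ContMDiff 𝓘(ℝ, ℝ) 𝓘(ℝ, ℝ) ∞ (fun t : ℝ ↦ (Real.exp t)⁻¹) :=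
      (Real.contDiff_exp.inv fun t ↦ (Real.exp_pos t).ne').contMDiff
    exact (h6.comp contMDiff_fst) z
  refine (contMDiffAt_smul_section h3 h5 (h2 z)).congr_of_eventuallyEq (Eventually.of_forall ?_)
  intro z
  refine tangentBundle_ext rfl ?_
  exact congrArg (fun v : EuclideanSpace ℝ (Fin (n + 2)) ↦ (Real.exp z.1)⁻¹ • v)
    (mfderiv_action_fiber hact z.1 z.2.proj z.2.2).symm

end Smooth

end Action

/-! ### The tractor bundle as a quotient -/

section Quotient

variable {n p q : ℕ} {M : Type*} [TopologicalSpace M]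
    [ChartedSpace (EuclideanSpace ℝ (Fin n)) M] [IsManifold (𝓡 n) ∞ M]
    {c : ConformalStructure n p q M}

open ConformalStructure

variable {A : Type*} [TopologicalSpace A] [ChartedSpace (EuclideanSpace ℝ (Fin (n + 2))) A]
    [MulAction PosReal A] {ι : c.RayBundle → A} (hA : IsAmbientManifold ι)
    {g : ∀ x : M, TangentSpace (𝓡 n) x →L[ℝ] TangentSpace (𝓡 n) x →L[ℝ] ℝ}
    (hg : g ∈ c.metrics) [IsManifold (𝓡 (n + 2)) ∞ A]
  {h : ∀ u : A, TangentSpace (𝓡 (n + 2)) u →L[ℝ] TangentSpace (𝓡 (n + 2)) u →L[ℝ] ℝ}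
  (hh : IsAmbientMetric ι h)

lemma density_dilate (φ : ∀ x, c.density (-1) x) (s : PosReal) (b : c.RayBundle) :
    densityFun φ (dilate s b) = (s : ℝ)⁻¹ * densityFun φ b := by
  have := (φ b.base).2 s ⟨b, rfl⟩
  rw [Real.rpow_neg_one] at this
  exact this

include hh

lemma isQuotientBundle : IsQuotientBundle hA h hg where
  orbit := by
    intro ζ hζ
    have hact := hA.smooth_action
    obtain ⟨z, hz⟩ := IsAmbientManifold.exists_param hg hζ
    rw [hA.apply_triv hg] at hz
    have h1 : (tractorAction (expPos z.2)⁻¹ ζ).proj = slice hA hg z.1 := by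
      change (expPos z.2)⁻¹ • ζ.proj = _
      rw [← hz, inv_smul_smul]
    refine ⟨⟨z.1, (tractorAction (expPos z.2)⁻¹ ζ).2⟩, ⟨expPos z.2, ?_⟩, ?_⟩
    · have h2 : (⟨slice hA hg z.1, (tractorAction (expPos z.2)⁻¹ ζ).2⟩ :
          TangentBundle (𝓡 (n + 2)) A) = tractorAction (expPos z.2)⁻¹ ζ :=
        tangentBundle_ext h1.symm rfl
      have h3 := tractorAction_inv hact (expPos z.2)⁻¹ ζ
      rw [inv_inv] at h3
      exact h3.symm.trans (congrArg (tractorAction (expPos z.2)) h2.symm)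
    · rintro ⟨x, v⟩ ⟨s, hs⟩
      have h2 : (s : PosReal) • slice hA hg x = expPos z.2 • slice hA hg z.1 := by
        rw [hz, hs]
        rfl
      -- Both parameters describe the same point of 𝒬; injectivity of the parametrization determines
      -- the orbit and the dilation at once.
      have h3 : (x, Real.log s) = z := by
        refine hA.param_injective hg ?_
        change ι (triv hg (x, Real.log s)) = ι (triv hg z)
        rw [hA.apply_triv hg, hA.apply_triv hg, ← h2, expPos_log]
      have h4 : s = expPos z.2 := by rw [← h3, expPos_log]
      obtain rfl : x = z.1 := by rw [← h3]
      have h5 : tractorAction (expPos z.2)⁻¹ ζ = ⟨slice hA hg z.1, v⟩ := by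
        rw [hs, h4]
        exact tractorAction_inv hact _ _
      have h6 : (v : EuclideanSpace ℝ (Fin (n + 2))) = (tractorAction (expPos z.2)⁻¹ ζ).2 := by
        rw [h5]
      exact congrArg (TotalSpace.mk z.1) h6
  smooth := by
    intro U hU σ
    have hact := hA.smooth_action
    constructor
    · intro hσ z hz
      have h1 : ContMDiffAt (𝓡 n) (𝓡 (n + 2)).tangent ∞ (fieldAlong σ) z.1 :=
        contMDiffAt_fieldAlong_iff.2 (hσ.contMDiffAt (hU.mem_nhds hz.1))
      have h2 : ContMDiffAt ((𝓡 n).prod 𝓘(ℝ, ℝ)) (𝓘(ℝ, ℝ).prod (𝓡 (n + 2)).tangent) ∞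
          (fun z : M × ℝ ↦ (z.2, fieldAlong σ z.1)) z :=
        contMDiffAt_snd.prodMk (ContMDiffAt.comp (g := fieldAlong σ) z h1 contMDiffAt_fst)
      exact (ContMDiffAt.comp (g := fun z : ℝ × TangentBundle (𝓡 (n + 2)) A ↦
        tractorAction (expPos z.1) z.2) z (contMDiff_tractorAction hact).contMDiffAt
          h2).contMDiffWithinAt
    -- Restricting the homogeneous lift to t = 0 recovers σ.
    · intro hσ x hx
      have h1 : ContMDiffAt ((𝓡 n).prod 𝓘(ℝ, ℝ)) (𝓡 (n + 2)).tangent ∞ (homogeneousLift σ)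
          (x, 0) := hσ.contMDiffAt ((hU.prod isOpen_univ).mem_nhds ⟨hx, Set.mem_univ _⟩)
      have h2 : ContMDiffAt (𝓡 n) (𝓡 (n + 2)).tangent ∞ (fun x ↦ homogeneousLift σ (x, 0)) x :=
        ContMDiffAt.comp (g := homogeneousLift σ) x h1 (contMDiffAt_id.prodMk contMDiffAt_const)
      refine (contMDiffAt_fieldAlong_iff.1 (h2.congr_of_eventuallyEq
        (Eventually.of_forall fun x ↦ ?_))).contMDiffWithinAt
      change fieldAlong σ x = tractorAction (expPos 0) (fieldAlong σ x)
      rw [expPos_zero, tractorAction_one]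
  metric := by
    intro σ τ z
    have h1 := hh.homogeneous (expPos z.2) (slice hA hg z.1) (σ z.1) (τ z.1)
    have h2 (L : EuclideanSpace ℝ (Fin (n + 2)) →L[ℝ] EuclideanSpace ℝ (Fin (n + 2)) →L[ℝ] ℝ)
        (s : ℝ) (v w : EuclideanSpace ℝ (Fin (n + 2))) : L (s • v) (s • w) = s ^ 2 * L v w := by
      simp only [map_smul, smul_apply, smul_eq_mul]
      ring
    refine (h2 (h (expPos z.2 • slice hA hg z.1)) (expPos z.2 : ℝ)⁻¹ _ _).trans ?_
    refine (congrArg (fun r : ℝ ↦ (expPos z.2 : ℝ)⁻¹ ^ 2 * r) h1).trans ?_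
    rw [← mul_assoc, ← mul_pow, inv_mul_cancel₀ (expPos z.2).2.ne', one_pow, one_mul]
    rfl
  inclusion := by
    intro φ z
    refine tangentBundle_ext (hA.apply_triv hg z).symm ?_
    -- The generator is invariant under Tρ^s, so the factor s⁻¹ of the action is exactly the weight
    -- −1 of φ.
    have h1 := mfderiv_smul_generator hA.smooth_action (expPos z.2) (slice hA hg z.1)
    have h2 : densityFun φ (triv hg z) = (expPos z.2 : ℝ)⁻¹ * densityFun φ (value hg z.1) :=
      density_dilate φ _ _
    have h3 (L : EuclideanSpace ℝ (Fin (n + 2)) →L[ℝ] EuclideanSpace ℝ (Fin (n + 2)))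
        (s r : ℝ) (v : EuclideanSpace ℝ (Fin (n + 2))) : s • L (r • v) = (s * r) • L v := by
      rw [map_smul, mul_smul]
    have h4 (a b : A) (hab : a = b) :
        (generator a : EuclideanSpace ℝ (Fin (n + 2))) =
          (generator b : TangentSpace (𝓡 (n + 2)) b) := by subst hab; rfl
    refine (h3 _ (expPos z.2 : ℝ)⁻¹ (densityFun φ (value hg z.1)) _).trans ?_
    rw [← h2]
    refine congrArg (fun v : EuclideanSpace ℝ (Fin (n + 2)) ↦ densityFun φ (triv hg z) • v) ?_
    exact h1.trans (h4 _ _ (hA.apply_triv hg z).symm)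

end Quotient

/-! ### Derivatives of homogeneous fields -/

section Action

variable {n : ℕ} {A : Type*} [TopologicalSpace A] [ChartedSpace (EuclideanSpace ℝ (Fin (n + 2))) A]
  [MulAction PosReal A] [IsManifold (𝓡 (n + 2)) ∞ A]
  {h : ∀ u : A, TangentSpace (𝓡 (n + 2)) u →L[ℝ] TangentSpace (𝓡 (n + 2)) u →L[ℝ] ℝ} {p q : ℕ}
  {EN : Type*} [NormedAddCommGroup EN] [NormedSpace ℝ EN]
  {HN : Type*} [TopologicalSpace HN] {IN : ModelWithCorners ℝ EN HN}
  {N : Type*} [TopologicalSpace N] [ChartedSpace HN N]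
  {σ : N → TangentBundle (𝓡 (n + 2)) A} {z : N}

omit [MulAction PosReal A] in
lemma covDerivAlong_add_right (v w : EN) :
    (covDerivAlong h IN σ z (show EN from v + w) : EuclideanSpace ℝ (Fin (n + 2))) =
      covDerivAlong h IN σ z (show EN from v) + (covDerivAlong h IN σ z (show EN from w) :
        EuclideanSpace ℝ (Fin (n + 2))) := by
  let L : EN →L[ℝ] EuclideanSpace ℝ (Fin (n + 2)) :=
    mvfderiv IN (fun y ↦ vecCoord (σ z).proj (σ y)) z +
      ((christoffelMap (chartMetric h (σ z).proj)
        (extChartAt (𝓡 (n + 2)) (σ z).proj (σ z).proj)).flip (σ z).2).comp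
        (mfderiv IN (𝓡 (n + 2)) (fun y ↦ (σ y).proj) z)
  exact map_add L v w

omit [MulAction PosReal A] in
lemma covDerivAlong_smul_right (r : ℝ) (v : EN) :
    (covDerivAlong h IN σ z (show EN from r • v) : EuclideanSpace ℝ (Fin (n + 2))) =
      r • (covDerivAlong h IN σ z (show EN from v) : EuclideanSpace ℝ (Fin (n + 2))) := by
  let L : EN →L[ℝ] EuclideanSpace ℝ (Fin (n + 2)) :=
    mvfderiv IN (fun y ↦ vecCoord (σ z).proj (σ y)) z +
      ((christoffelMap (chartMetric h (σ z).proj)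
        (extChartAt (𝓡 (n + 2)) (σ z).proj (σ z).proj)).flip (σ z).2).comp
        (mfderiv IN (𝓡 (n + 2)) (fun y ↦ (σ y).proj) z)
  exact map_smul L r v

/-- ρ^s is isometric up to the constant s², which the Levi-Civita connection does not see, and the
factor s⁻¹ is constant as well. -/
lemma covDerivAlong_tractorAction
    (hact : ContMDiff (𝓘(ℝ, ℝ).prod (𝓡 (n + 2))) (𝓡 (n + 2)) ∞
      (fun z : ℝ × A ↦ expPos z.1 • z.2))
    (hh : IsPseudoMetric (𝓡 (n + 2)) (EuclideanSpace ℝ (Fin (n + 2)))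
      (TangentSpace (𝓡 (n + 2)) : A → Type _) p q h)
    (hhom : ∀ (s : PosReal) (u : A) (v w : TangentSpace (𝓡 (n + 2)) u),
      h (s • u) (mfderiv (𝓡 (n + 2)) (𝓡 (n + 2)) (fun u' : A ↦ s • u') u v)
        (mfderiv (𝓡 (n + 2)) (𝓡 (n + 2)) (fun u' : A ↦ s • u') u w) = (s : ℝ) ^ 2 * h u v w)
    (s : PosReal) (hσ : MDifferentiableAt IN (𝓡 (n + 2)).tangent σ z) (w : TangentSpace IN z) :
    (covDerivAlong h IN (fun y ↦ tractorAction s (σ y)) z w : EuclideanSpace ℝ (Fin (n + 2))) =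
      (tractorAction s ⟨(σ z).proj, covDerivAlong h IN σ z w⟩).2 := by
  have h1 := covDerivAlong_tangentMap hh (contMDiff_smul hact s)
    (pow_ne_zero 2 s.2.ne') (hhom s) hσ w
  have h2 : MDifferentiableAt IN (𝓡 (n + 2)).tangent
      (fun y ↦ tangentMap (𝓡 (n + 2)) (𝓡 (n + 2)) (fun u : A ↦ s • u) (σ y)) z :=
    (((contMDiff_smul hact s).contMDiff_tangentMap (m := ∞) (by simp)).mdifferentiable
      (by simp) _).comp z hσ
  have h3 := covDerivAlong_smul (h := h) (a := fun _ : N ↦ (s : ℝ)⁻¹) (f := fun y ↦ s • (σ y).proj)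
    (s := fun y ↦ mfderiv (𝓡 (n + 2)) (𝓡 (n + 2)) (fun u : A ↦ s • u) (σ y).proj (σ y).2)
    mdifferentiableAt_const h2 w
  refine h3.trans ?_
  have h4 : mvfderiv IN (fun _ : N ↦ (s : ℝ)⁻¹) z w = 0 :=
    (hasMFDerivAt_const (I := IN) (I' := 𝓘(ℝ, ℝ)) (s : ℝ)⁻¹ z).mvfderiv_apply w
  rw [h4]
  have h5 (r : ℝ) (a b c : EuclideanSpace ℝ (Fin (n + 2))) (hab : a = b) :
      r • a + (0 : ℝ) • c = r • b := by rw [hab, zero_smul, add_zero]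
  exact h5 _ _ _ _ h1

section Orbit

variable (hact : ContMDiff (𝓘(ℝ, ℝ).prod (𝓡 (n + 2))) (𝓡 (n + 2)) ∞
      (fun z : ℝ × A ↦ expPos z.1 • z.2)) {u : A} {y : EuclideanSpace ℝ (Fin (n + 2))}

lemma chartFrame_self (u : A) (v : EuclideanSpace ℝ (Fin (n + 2))) :
    (chartFrame u (extChartAt (𝓡 (n + 2)) u u) v : EuclideanSpace ℝ (Fin (n + 2))) = v :=
  (congrArg (fun w : EuclideanSpace ℝ (Fin (n + 2)) ↦
    (chartFrame u (extChartAt (𝓡 (n + 2)) u u) w : EuclideanSpace ℝ (Fin (n + 2))))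
      (tangentChart_self u v)).symm.trans
        (chartFrame_tangentChart (mem_extChartAt_source (I := 𝓡 (n + 2)) u) v)

include hact

/-- Mixed derivatives commute, and X is the time derivative of the flow at time zero. -/
lemma fderiv_fderiv_chartFlow (hy : y ∈ (extChartAt (𝓡 (n + 2)) u).target)
    (b : EuclideanSpace ℝ (Fin (n + 2))) :
    fderiv ℝ (fderiv ℝ (chartFlow u)) (0, y) (1, 0) (0, b) = fderiv ℝ (chartGenerator u) y b := by
  have hΦ := contDiffAt_chartFlow hact hy
  rw [hΦ.fderiv_fderiv_symm]
  have h6 : chartGenerator u =ᶠ[𝓝 y] fun y ↦ fderiv ℝ (chartFlow u) (0, y) (1, 0) := by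
    filter_upwards [(isOpen_extChartAt_target u).mem_nhds hy] with y hy'
    exact chartGenerator_eq_fderiv hact hy'
  have h7 : HasFDerivAt (fun y : EuclideanSpace ℝ (Fin (n + 2)) ↦ ((0 : ℝ), y))
      (ContinuousLinearMap.inr ℝ ℝ _) y := hasFDerivAt_prodMk_right 0 y
  have h8 := (HasFDerivAt.comp (g := fderiv ℝ (chartFlow u)) y
    hΦ.differentiableAt_fderiv.hasFDerivAt h7).clm_apply
    (hasFDerivAt_const ((1 : ℝ), (0 : EuclideanSpace ℝ (Fin (n + 2)))) y)
  rw [h6.fderiv_eq]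
  refine Eq.trans ?_ (congrArg (fun L : EuclideanSpace ℝ (Fin (n + 2)) →L[ℝ] _ ↦ L b)
    h8.fderiv).symm
  simp

/-- The factor e^{-t}, that is the weight −1, produces the term subtracted here; it later cancels
∇_bX = b. -/
lemma hasDerivAt_chartFlow (hy : y ∈ (extChartAt (𝓡 (n + 2)) u).target)
    (b : EuclideanSpace ℝ (Fin (n + 2))) :
    HasDerivAt (fun t : ℝ ↦ (Real.exp t)⁻¹ • fderiv ℝ (chartFlow u) (t, y) (0, b))
      (fderiv ℝ (chartGenerator u) y b - fderiv ℝ (chartFlow u) (0, y) (0, b)) 0 := by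
  have hΦ := contDiffAt_chartFlow hact hy
  have h1 : HasDerivAt (fun t : ℝ ↦ (t, y)) ((1 : ℝ), (0 : EuclideanSpace ℝ (Fin (n + 2)))) 0 :=
    (hasDerivAt_id (0 : ℝ)).prodMk (hasDerivAt_const _ _)
  have h2 := (HasFDerivAt.comp_hasDerivAt (l := fderiv ℝ (chartFlow u)) (0 : ℝ)
    hΦ.differentiableAt_fderiv.hasFDerivAt h1).clm_apply
    (hasDerivAt_const (0 : ℝ) ((0 : ℝ), b))
  have h3 : HasDerivAt (fun t : ℝ ↦ (Real.exp t)⁻¹) (-1) 0 := by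
    refine ((Real.hasDerivAt_exp 0).inv (Real.exp_ne_zero 0)).congr_deriv ?_
    simp
  have h4 := h3.smul h2
  rw [fderiv_fderiv_chartFlow hact hy] at h4
  refine h4.congr_deriv ?_
  simp only [Real.exp_zero, inv_one, one_smul, map_zero, add_zero, neg_smul, Function.comp_apply]
  exact (sub_eq_add_neg _ _).symm

lemma vecCoord_tractorAction (u : A) (b : EuclideanSpace ℝ (Fin (n + 2))) :
    (fun t : ℝ ↦ vecCoord u (tractorAction (expPos t) ⟨u, b⟩)) =ᶠ[𝓝 0]
      fun t ↦ (Real.exp t)⁻¹ • fderiv ℝ (chartFlow u) (t, extChartAt (𝓡 (n + 2)) u u) (0, b) := by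
  have hu := mem_extChartAt_source (I := 𝓡 (n + 2)) u
  have hy := (extChartAt (𝓡 (n + 2)) u).map_source hu
  have hsymm := (extChartAt (𝓡 (n + 2)) u).left_inv hu
  filter_upwards [eventually_chartFlow hact hy] with t ht
  rw [fderiv_chartFlow_fiber hact hy ht.1 ht.2]
  have ht' : expPos t • u ∈ (extChartAt (𝓡 (n + 2)) u).source := by
    have := ht.1
    rwa [hsymm] at this
  refine (vecCoord_smul ht' (Real.exp t)⁻¹ _).trans ?_
  rw [vecCoord_eq (by exact ht')]
  have h1 (a : A) (ha : a = u) (v : EuclideanSpace ℝ (Fin (n + 2))) (hv : v = b) :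
      (tangentChart u (expPos t • u)
        (mfderiv (𝓡 (n + 2)) (𝓡 (n + 2)) (fun u' : A ↦ expPos t • u') u b)) =
      tangentChart u (expPos t • a)
        (mfderiv (𝓡 (n + 2)) (𝓡 (n + 2)) (fun u' : A ↦ expPos t • u') a v) := by
    subst ha hv; rfl
  exact congrArg (fun v : EuclideanSpace ℝ (Fin (n + 2)) ↦ (Real.exp t)⁻¹ • v)
    (h1 _ hsymm _ (chartFrame_self u b))

lemma mvfderiv_vecCoord_tractorAction (u : A) (b : EuclideanSpace ℝ (Fin (n + 2))) :
    (mvfderiv 𝓘(ℝ, ℝ) (fun t : ℝ ↦ vecCoord u (tractorAction (expPos t) ⟨u, b⟩)) 0 (1 : ℝ) :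
      EuclideanSpace ℝ (Fin (n + 2))) =
      fderiv ℝ (chartGenerator u) (extChartAt (𝓡 (n + 2)) u u) b - b := by
  have hu := mem_extChartAt_source (I := 𝓡 (n + 2)) u
  have h9 : fderiv ℝ (chartFlow u) (0, extChartAt (𝓡 (n + 2)) u u) (0, b) = b := by
    have h1 := (vecCoord_tractorAction hact u b).self_of_nhds
    simp only [expPos_zero, tractorAction_one, Real.exp_zero, inv_one, one_smul] at h1
    rw [← h1, vecCoord_eq (by exact hu)]
    exact tangentChart_self u b
  rw [mvfderiv_congr (vecCoord_tractorAction hact u b)]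
  have h2 := hasDerivAt_chartFlow hact ((extChartAt (𝓡 (n + 2)) u).map_source hu) b
  rw [h9] at h2
  exact (h2.hasFDerivAt.hasMFDerivAt.mvfderiv_apply (1 : ℝ)).trans (by simp)

lemma mvfderiv_extChartAt_orbit (u : A) :
    mvfderiv 𝓘(ℝ, ℝ) (fun t : ℝ ↦ extChartAt (𝓡 (n + 2)) u (expPos t • u)) 0 (1 : ℝ) =
      chartGenerator u (extChartAt (𝓡 (n + 2)) u u) := by
  have hproj : (expPos 0 • u : A) = u := by rw [expPos_zero, one_smul]
  have h1 := mvfderiv_extChartAt_comp (u := u) (c := fun t : ℝ ↦ expPos t • u) (z := (0 : ℝ))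
    (by rw [hproj]; exact mem_extChartAt_source (I := 𝓡 (n + 2)) u)
    ((contMDiff_orbit hact u).mdifferentiable (by simp) 0) (1 : ℝ)
  refine h1.trans ?_
  have h2 (a : A) (ha : a = u) (v : EuclideanSpace ℝ (Fin (n + 2))) :
      tangentChart u a v = v := by subst ha; exact tangentChart_self a v
  exact (h2 _ hproj _).trans (chartGenerator_self u).symm

/-- The derivative of a homogeneous field in the direction of an orbit. -/
lemma covDerivAlong_orbit (u : A) (b : EuclideanSpace ℝ (Fin (n + 2))) :
    (covDerivAlong h 𝓘(ℝ, ℝ) (fun t : ℝ ↦ tractorAction (expPos t)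
      (⟨u, b⟩ : TangentBundle (𝓡 (n + 2)) A)) 0 (1 : ℝ) : EuclideanSpace ℝ (Fin (n + 2))) =
      fderiv ℝ (chartGenerator u) (extChartAt (𝓡 (n + 2)) u u) b - b +
        christoffelMap (chartMetric h u) (extChartAt (𝓡 (n + 2)) u u)
          (chartGenerator u (extChartAt (𝓡 (n + 2)) u u)) b := by
  let γ : ℝ → TangentBundle (𝓡 (n + 2)) A := fun t ↦ tractorAction (expPos t) ⟨u, b⟩
  have hγ : MDifferentiableAt 𝓘(ℝ, ℝ) (𝓡 (n + 2)).tangent γ 0 :=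
    ((contMDiff_tractorAction hact).comp
      (contMDiff_id.prodMk contMDiff_const)).mdifferentiable (by simp) (0 : ℝ)
  have h0 : γ 0 = ⟨u, b⟩ := by
    change tractorAction (expPos 0) _ = _
    rw [expPos_zero, tractorAction_one]
  -- The chart used by `covDerivAlong` depends on γ 0, which equals ⟨u, b⟩ only propositionally.
  -- Abstracting that point allows all its occurrences to be rewritten together.
  let F (ζ : TangentBundle (𝓡 (n + 2)) A) : EuclideanSpace ℝ (Fin (n + 2)) :=
    mvfderiv 𝓘(ℝ, ℝ) (fun t : ℝ ↦ vecCoord ζ.proj (γ t)) 0 (1 : ℝ) +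
    christoffelMap (chartMetric h ζ.proj) (extChartAt (𝓡 (n + 2)) ζ.proj ζ.proj)
      (mvfderiv 𝓘(ℝ, ℝ) (fun t : ℝ ↦ extChartAt (𝓡 (n + 2)) ζ.proj (γ t).proj) 0 (1 : ℝ))
      (vecCoord ζ.proj ζ)
  refine (covDerivAlong_eq_covDerivIn hγ (1 : ℝ)).trans ?_
  change F (γ 0) = _
  rw [h0]
  have h1 : vecCoord u (⟨u, b⟩ : TangentBundle (𝓡 (n + 2)) A) = b := by
    rw [vecCoord_eq (by exact mem_extChartAt_source (I := 𝓡 (n + 2)) u)]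
    exact tangentChart_self u b
  exact congrArg₂ (· + ·) (mvfderiv_vecCoord_tractorAction hact u b)
    (congrArg₂ (fun v w ↦ christoffelMap (chartMetric h u) (extChartAt (𝓡 (n + 2)) u u) v w)
      (mvfderiv_extChartAt_orbit hact u) h1)

end Orbit

end Action

/-! ### Descent of the Levi-Civita connection -/

section Induced

variable {n p q : ℕ} {M : Type*} [TopologicalSpace M]
    [ChartedSpace (EuclideanSpace ℝ (Fin n)) M] [IsManifold (𝓡 n) ∞ M]
    {c : ConformalStructure n p q M}

open ConformalStructure

variable {A : Type*} [TopologicalSpace A] [ChartedSpace (EuclideanSpace ℝ (Fin (n + 2))) A]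
    [MulAction PosReal A] {ι : c.RayBundle → A} (hA : IsAmbientManifold ι)
    {g : ∀ x : M, TangentSpace (𝓡 n) x →L[ℝ] TangentSpace (𝓡 n) x →L[ℝ] ℝ}
    (hg : g ∈ c.metrics) [IsManifold (𝓡 (n + 2)) ∞ A]
  {h : ∀ u : A, TangentSpace (𝓡 (n + 2)) u →L[ℝ] TangentSpace (𝓡 (n + 2)) u →L[ℝ] ℝ}
  (hh : IsAmbientMetric ι h)

include hA hh

lemma IsAmbientMetric.nabla_chartGenerator {u : A}
    (h0 : ∀ v w : TangentSpace (𝓡 (n + 2)) u, extDerivForm (dualForm h) u v w = 0)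
    (v : EuclideanSpace ℝ (Fin (n + 2))) :
    nabla (chartMetric h u) (chartGenerator u) (extChartAt (𝓡 (n + 2)) u u) v = v := by
  have hy := (extChartAt (𝓡 (n + 2)) u).map_source (mem_extChartAt_source (I := 𝓡 (n + 2)) u)
  have hG := hh.isPseudoMetric.isCoordMetric u
  refine sub_eq_zero.1 (hG.nondegenerate _ hy _ fun w ↦ ?_)
  have h1 := hG.two_mul_apply_nabla hy (isHomothetic_chartGenerator hA.smooth_action
    hh.isPseudoMetric hh.homogeneous hy) v w
  have h2 : curl (chartMetric h u) (chartGenerator u) (extChartAt (𝓡 (n + 2)) u u) v w = 0 :=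
    (hh.extDerivForm_self hA v w).symm.trans (h0 v w)
  rw [h2, add_zero] at h1
  rw [map_sub, sub_apply, mul_left_cancel₀ (two_ne_zero (α := ℝ)) h1, sub_self]

lemma IsAmbientMetric.covDerivAlong_generator {u : A}
    (h0 : ∀ v w : TangentSpace (𝓡 (n + 2)) u, extDerivForm (dualForm h) u v w = 0)
    (v : TangentSpace (𝓡 (n + 2)) u) :
    covDerivAlong h (𝓡 (n + 2)) (fun a ↦ (⟨a, generator a⟩ : TangentBundle (𝓡 (n + 2)) A)) u v =
      v := by
  refine (covDerivAlong_eq_covDerivIn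
    ((contMDiff_generator hA.smooth_action).mdifferentiable (by simp) u) v).trans ?_
  refine (covDerivIn_generator hA.smooth_action h
    (mem_extChartAt_source (I := 𝓡 (n + 2)) u) v).trans ?_
  rw [tangentChart_self]
  exact hh.nabla_chartGenerator hA h0 v

/-- By symmetry of Γ the derivative along the orbit is ∇_bX − b, and ∇X = id where dα = 0. This is
why homogeneity −1 makes the connection descend. -/
lemma IsAmbientMetric.covDerivAlong_orbit_eq_zero {u : A}
    (h0 : ∀ v w : TangentSpace (𝓡 (n + 2)) u, extDerivForm (dualForm h) u v w = 0)
    (b : EuclideanSpace ℝ (Fin (n + 2))) :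
    (covDerivAlong h 𝓘(ℝ, ℝ) (fun t : ℝ ↦ tractorAction (expPos t)
      (⟨u, b⟩ : TangentBundle (𝓡 (n + 2)) A)) 0 (1 : ℝ) : EuclideanSpace ℝ (Fin (n + 2))) = 0 := by
  refine (covDerivAlong_orbit hA.smooth_action u b).trans ?_
  have h2 := hh.nabla_chartGenerator hA h0 b
  rw [nabla_apply] at h2
  rw [(hh.isPseudoMetric.isCoordMetric u).christoffel_symm (mem_extChartAt_target u),
    sub_add_eq_add_sub]
  exact sub_eq_zero.2 h2

omit hh in
lemma contMDiff_homogeneousLift {σ : ∀ x, Tractor (slice hA hg) x} (hσ : IsSmoothSection n σ) :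
    ContMDiff ((𝓡 n).prod 𝓘(ℝ, ℝ)) (𝓡 (n + 2)).tangent ∞ (homogeneousLift σ) := by
  rw [isSmoothSection_iff] at hσ
  exact (contMDiff_tractorAction hA.smooth_action).comp
    (contMDiff_snd.prodMk (hσ.comp contMDiff_fst))

/-- A vector tangent to 𝒬 splits into a slice direction, handled by naturality under ρ^{e^t}, and an
orbit direction, in which homogeneous fields are parallel. -/
lemma isInducedConnection
    (h0 : ∀ u ∈ Set.range ι, ∀ v w : TangentSpace (𝓡 (n + 2)) u,
      extDerivForm (dualForm h) u v w = 0) :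
    IsInducedConnection h (slice hA hg) (tractorConnection h (slice hA hg)) := by
  rintro σ hσ ⟨x, t⟩ ⟨w₁, w₂⟩
  have hact := hA.smooth_action
  have hl := (contMDiff_homogeneousLift hA hg hσ).mdifferentiable (by simp) (x, t)
  rw [isSmoothSection_iff] at hσ
  have hx : covDerivAlong h ((𝓡 n).prod 𝓘(ℝ, ℝ)) (homogeneousLift σ) (x, t)
      ((w₁, 0) : EuclideanSpace ℝ (Fin n) × ℝ) =
      (tractorAction (expPos t) ⟨slice hA hg x, tractorConnection h (slice hA hg) σ x w₁⟩).2 := by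
    have hk : HasMFDerivAt (𝓡 n) ((𝓡 n).prod 𝓘(ℝ, ℝ)) (fun x : M ↦ (x, t)) x
        ((ContinuousLinearMap.id ℝ (EuclideanSpace ℝ (Fin n))).prod
          (0 : EuclideanSpace ℝ (Fin n) →L[ℝ] ℝ)) :=
      (hasMFDerivAt_id x).prodMk (hasMFDerivAt_const t x)
    have h1 := covDerivAlong_comp (h := h) (σ := homogeneousLift σ) (k := fun x : M ↦ (x, t)) hl
      hk.mdifferentiableAt w₁
    rw [hk.mfderiv] at h1
    exact h1.symm.trans (covDerivAlong_tractorAction hact hh.isPseudoMetric hh.homogeneous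
      (expPos t) (hσ.mdifferentiable (by simp) x) w₁)
  have ht : (covDerivAlong h ((𝓡 n).prod 𝓘(ℝ, ℝ)) (homogeneousLift σ) (x, t)
      ((0, 1) : EuclideanSpace ℝ (Fin n) × ℝ) : EuclideanSpace ℝ (Fin (n + 2))) = 0 := by
    have h1 : (covDerivAlong h 𝓘(ℝ, ℝ) (fun τ : ℝ ↦ tractorAction (expPos τ) (fieldAlong σ x)) 0
        (1 : ℝ) : EuclideanSpace ℝ (Fin (n + 2))) = 0 := by
      exact hh.covDerivAlong_orbit_eq_zero hA (h0 (slice hA hg x) ⟨value hg x, rfl⟩) (σ x)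
    have hγ : MDifferentiableAt 𝓘(ℝ, ℝ) (𝓡 (n + 2)).tangent
        (fun τ : ℝ ↦ tractorAction (expPos τ) (fieldAlong σ x)) 0 :=
      ((contMDiff_tractorAction hact).comp
        (contMDiff_id.prodMk contMDiff_const)).mdifferentiable (by simp) (0 : ℝ)
    have h2 := covDerivAlong_tractorAction hact hh.isPseudoMetric hh.homogeneous (expPos t) hγ
      (1 : ℝ)
    have hk : HasMFDerivAt 𝓘(ℝ, ℝ) ((𝓡 n).prod 𝓘(ℝ, ℝ)) (fun τ : ℝ ↦ (x, t + τ)) 0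
        ((0 : ℝ →L[ℝ] EuclideanSpace ℝ (Fin n)).prod (ContinuousLinearMap.id ℝ ℝ)) :=
      (hasMFDerivAt_const x (0 : ℝ)).prodMk
        (((hasFDerivAt_id (0 : ℝ)).const_add t).hasMFDerivAt)
    have h3 := covDerivAlong_comp (h := h) (σ := homogeneousLift σ)
      (k := fun τ : ℝ ↦ (x, t + τ)) (z := 0)
      ((contMDiff_homogeneousLift hA hg (isSmoothSection_iff.2 hσ)).mdifferentiable (by simp) _)
      hk.mdifferentiableAt (1 : ℝ)
    rw [hk.mfderiv] at h3
    -- The orbit derivative at (x,t) is the image under ρ^{e^t} of the one at (x,0), where it is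
    -- known to vanish.
    have h4 : (fun τ : ℝ ↦ homogeneousLift σ (x, t + τ)) =
        fun τ ↦ tractorAction (expPos t) (tractorAction (expPos τ) (fieldAlong σ x)) := by
      funext τ
      rw [← tractorAction_mul hact, ← expPos_add]
      rfl
    rw [h4] at h3
    have h5 (s : ℝ) (hs : s = t) (h6 : (covDerivAlong h ((𝓡 n).prod 𝓘(ℝ, ℝ)) (homogeneousLift σ)
        (x, s) ((0, 1) : EuclideanSpace ℝ (Fin n) × ℝ) : EuclideanSpace ℝ (Fin (n + 2))) = 0) :
        (covDerivAlong h ((𝓡 n).prod 𝓘(ℝ, ℝ)) (homogeneousLift σ)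
        (x, t) ((0, 1) : EuclideanSpace ℝ (Fin n) × ℝ) : EuclideanSpace ℝ (Fin (n + 2))) = 0 := by
      subst hs; exact h6
    refine h5 (t + 0) (add_zero t) (h3.symm.trans (h2.trans ?_))
    have h7 (L : EuclideanSpace ℝ (Fin (n + 2)) →L[ℝ] EuclideanSpace ℝ (Fin (n + 2))) (r : ℝ)
        (v : EuclideanSpace ℝ (Fin (n + 2))) (hv : v = 0) : r • L v = 0 := by
      rw [hv, map_zero, smul_zero]
    exact h7 (mfderiv (𝓡 (n + 2)) (𝓡 (n + 2)) (fun u : A ↦ expPos t • u) _) _ _ h1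
  have hw : (((w₁, w₂) : EuclideanSpace ℝ (Fin n) × ℝ)) =
      (w₁, 0) + w₂ • ((0, 1) : EuclideanSpace ℝ (Fin n) × ℝ) :=
    Prod.ext (by simp) (by simp)
  have h8 := covDerivAlong_add_right (h := h) (IN := (𝓡 n).prod 𝓘(ℝ, ℝ)) (σ := homogeneousLift σ)
    (z := (x, t)) ((w₁, 0) : EuclideanSpace ℝ (Fin n) × ℝ)
    (w₂ • ((0, 1) : EuclideanSpace ℝ (Fin n) × ℝ))
  have h9 := covDerivAlong_smul_right (h := h) (IN := (𝓡 n).prod 𝓘(ℝ, ℝ)) (σ := homogeneousLift σ)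
    (z := (x, t)) w₂ ((0, 1) : EuclideanSpace ℝ (Fin n) × ℝ)
  have h10 (a b c d : EuclideanSpace ℝ (Fin (n + 2))) (hab : a = b + c) (hc : c = w₂ • d)
      (hd : d = 0) : a = b := by
    rw [hab, hc, hd, smul_zero, add_zero]
  have h11 := h10 _ _ _ _ h8 h9 ht
  rw [← hw] at h11
  refine h11.trans (hx.trans ?_)
  rw [mfderiv_fst]
  rfl

end Induced

/-! ### Densities of weight −1 -/

section Density

variable {n p q : ℕ} {M : Type*} [TopologicalSpace M]
    [ChartedSpace (EuclideanSpace ℝ (Fin n)) M] [IsManifold (𝓡 n) ∞ M]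
    {c : ConformalStructure n p q M}
    {g : ∀ x : M, TangentSpace (𝓡 n) x →L[ℝ] TangentSpace (𝓡 n) x →L[ℝ] ℝ}
    (hg : g ∈ c.metrics)

namespace ConformalStructure

lemma density_triv (φ : ∀ x, c.density (-1) x) (z : M × ℝ) :
    densityFun φ (triv hg z) = (Real.exp z.2)⁻¹ * densityFun φ (value hg z.1) :=
  density_dilate φ _ _

variable {hg} in
lemma IsSmoothDensity.contMDiff_value {φ : ∀ x, c.density (-1) x} (hφ : c.IsSmoothDensity φ) :
    ContMDiff (𝓡 n) 𝓘(ℝ, ℝ) ∞ (fun x ↦ densityFun φ (value hg x)) := by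
  have h1 := (hφ g hg).comp (contMDiff_id.prodMk contMDiff_const :
    ContMDiff (𝓡 n) ((𝓡 n).prod 𝓘(ℝ, ℝ)) ∞ (fun x : M ↦ (x, (0 : ℝ))))
  refine h1.congr fun x ↦ ?_
  change _ = densityFun φ (triv hg (x, 0))
  rw [triv_zero]

/-- Each fibre of 𝒬 is a single orbit, so a density is determined by its value at g_x. -/
lemma density_ext {x : M} {φ ψ : c.density (-1) x}
    (h : φ.1 ⟨value hg x, rfl⟩ = ψ.1 ⟨value hg x, rfl⟩) : φ = ψ := by
  refine Subtype.ext (funext ?_)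
  rintro ⟨b, rfl⟩
  obtain ⟨t, ht⟩ := triv_surjective hg b
  have h1 (φ : c.density (-1) b.base) :
      φ.1 ⟨b, rfl⟩ = (Real.exp t) ^ (-1 : ℝ) * φ.1 ⟨value hg b.base, rfl⟩ := by
    have h2 : (⟨b, rfl⟩ : {b' : c.RayBundle // b'.base = b.base}) =
        ⟨dilate (expPos t) (value hg b.base), rfl⟩ := Subtype.ext ht.symm
    rw [h2]
    exact φ.2 (expPos t) ⟨value hg b.base, rfl⟩
  rw [h1 φ, h1 ψ, h]

/-- The density of weight `-1` which is equal to one on a given metric of the conformal class. -/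
def unitDensity (hinj : Function.Injective (triv hg)) (x : M) : c.density (-1) x where
  -- The point e^{2t}g_x receives the value e^{-t}. Injectivity of `triv` pins down the chosen t and
  -- gives homogeneity.
  val b := (Real.exp (triv_surjective hg b.1).choose)⁻¹
  property := by
    rintro s ⟨b, rfl⟩
    have h1 := (triv_surjective hg b).choose_spec
    have h2 := (triv_surjective hg (dilate s b)).choose_spec
    have h3 : triv hg (b.base, Real.log s + (triv_surjective hg b).choose) = dilate s b := by
      rw [triv_add, expPos_log, h1]
    have h4 : (triv_surjective hg (dilate s b)).choose = _ :=
      congrArg Prod.snd (hinj (h2.trans h3.symm))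
    change (Real.exp (triv_surjective hg (dilate s b)).choose)⁻¹ =
      (s : ℝ) ^ (-1 : ℝ) * (Real.exp (triv_surjective hg b).choose)⁻¹
    rw [h4, Real.exp_add, Real.exp_log s.2, mul_inv, Real.rpow_neg_one]

variable {hg} (hinj : Function.Injective (triv hg))

lemma densityFun_unitDensity (x : M) (t : ℝ) :
    densityFun (unitDensity hg hinj) (triv hg (x, t)) = (Real.exp t)⁻¹ := by
  have h1 := (triv_surjective hg (triv hg (x, t))).choose_spec
  have h2 := congrArg Prod.snd (hinj h1)
  exact congrArg (fun t ↦ (Real.exp t)⁻¹) h2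

lemma isSmoothDensity_unitDensity : c.IsSmoothDensity (unitDensity hg hinj) := by
  intro g' hg'
  obtain ⟨f, hf, hpos, h⟩ := (c.mem_iff g hg g').1 hg'
  -- For g' = f g the parameter t is determined by e^{2t} = f(x).
  have h1 (x : M) : value hg' x = triv hg (x, Real.log (f x) / 2) := by
    refine RayBundle.ext rfl ?_
    change g' x = Real.exp (Real.log (f x) / 2) ^ 2 • g x
    rw [h, ← Real.exp_nat_mul]
    congr 1
    rw [show ((2 : ℕ) : ℝ) * (Real.log (f x) / 2) = Real.log (f x) by push_cast; ring,
      Real.exp_log (hpos _)]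
  have h2 (z : M × ℝ) : densityFun (unitDensity hg hinj) (triv hg' z) =
      (Real.exp z.2)⁻¹ * (Real.exp (Real.log (f z.1) / 2))⁻¹ := by
    rw [density_triv, h1, densityFun_unitDensity]
  refine ContMDiff.congr (f := fun z : M × ℝ ↦ (Real.exp z.2)⁻¹ *
    (Real.exp (Real.log (f z.1) / 2))⁻¹) ?_ h2
  intro z
  have h3 : ContDiffAt ℝ ∞ (fun y : ℝ × ℝ ↦ (Real.exp y.2)⁻¹ * (Real.exp (Real.log y.1 / 2))⁻¹)
      (f z.1, z.2) := by
    refine ((Real.contDiff_exp.contDiffAt.comp _ contDiffAt_snd).inv (Real.exp_ne_zero _)).mul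
      ((Real.contDiff_exp.contDiffAt.comp _ ((contDiffAt_fst.log (hpos _).ne').div_const 2)).inv
        (Real.exp_ne_zero _))
  have h4 : ContMDiffAt ((𝓡 n).prod 𝓘(ℝ, ℝ)) 𝓘(ℝ, ℝ × ℝ) ∞ (fun z : M × ℝ ↦ (f z.1, z.2)) z :=
    ((hf.comp contMDiff_fst).prodMk_space contMDiff_snd) z
  exact ContMDiffAt.comp (g := fun y : ℝ × ℝ ↦ (Real.exp y.2)⁻¹ * (Real.exp (Real.log y.1 / 2))⁻¹)
    z h3.contMDiffAt h4

end ConformalStructure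

end Density

/-! ### Metric, generator and inclusion along a slice -/

section Slice

variable {n p q : ℕ} {M : Type*} [TopologicalSpace M]
    [ChartedSpace (EuclideanSpace ℝ (Fin n)) M] [IsManifold (𝓡 n) ∞ M]
    {c : ConformalStructure n p q M}

open ConformalStructure

variable {A : Type*} [TopologicalSpace A] [ChartedSpace (EuclideanSpace ℝ (Fin (n + 2))) A]
    [MulAction PosReal A] {ι : c.RayBundle → A} (hA : IsAmbientManifold ι)
    {g : ∀ x : M, TangentSpace (𝓡 n) x →L[ℝ] TangentSpace (𝓡 n) x →L[ℝ] ℝ}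
    (hg : g ∈ c.metrics) [IsManifold (𝓡 (n + 2)) ∞ A]
  {h : ∀ u : A, TangentSpace (𝓡 (n + 2)) u →L[ℝ] TangentSpace (𝓡 (n + 2)) u →L[ℝ] ℝ}
  (hh : IsAmbientMetric ι h)

include hA in
lemma IsAmbientManifold.triv_injective : Function.Injective (triv hg) := fun _ _ h ↦
  hA.param_injective hg (congrArg ι h)

lemma slice_eq (x : M) : ι (triv hg (x, 0)) = slice hA hg x := congrArg ι (triv_zero hg x)

/-- The derivative of the slice. -/
def sliceDeriv (x : M) : EuclideanSpace ℝ (Fin n) →L[ℝ] EuclideanSpace ℝ (Fin (n + 2)) :=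
  mfderiv (𝓡 n) (𝓡 (n + 2)) (slice hA hg) x

/-- The generator along the slice. -/
def sliceGenerator (x : M) : EuclideanSpace ℝ (Fin (n + 2)) :=
  (generator (slice hA hg x) : TangentSpace (𝓡 (n + 2)) (slice hA hg x))

/-- The metric along the slice. -/
def sliceMetric (h : ∀ u : A, TangentSpace (𝓡 (n + 2)) u →L[ℝ] TangentSpace (𝓡 (n + 2)) u →L[ℝ] ℝ)
    (x : M) : EuclideanSpace ℝ (Fin (n + 2)) →L[ℝ] EuclideanSpace ℝ (Fin (n + 2)) →L[ℝ] ℝ :=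
  h (slice hA hg x)

lemma sliceDeriv_eq (x : M) (v : EuclideanSpace ℝ (Fin n)) : sliceDeriv hA hg x v =
    mfderiv ((𝓡 n).prod 𝓘(ℝ, ℝ)) (𝓡 (n + 2)) (fun z : M × ℝ ↦ ι (triv hg z)) (x, 0)
      ((v, 0) : EuclideanSpace ℝ (Fin n) × ℝ) := by
  have hk : HasMFDerivAt (𝓡 n) ((𝓡 n).prod 𝓘(ℝ, ℝ)) (fun x : M ↦ (x, (0 : ℝ))) x
      ((ContinuousLinearMap.id ℝ (EuclideanSpace ℝ (Fin n))).prod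
        (0 : EuclideanSpace ℝ (Fin n) →L[ℝ] ℝ)) :=
    (hasMFDerivAt_id x).prodMk (hasMFDerivAt_const (0 : ℝ) x)
  have h1 := ((hA.mdifferentiableAt_param hg (x, 0)).hasMFDerivAt.comp x hk).mfderiv
  have h2 : (fun z : M × ℝ ↦ ι (triv hg z)) ∘ (fun x : M ↦ (x, (0 : ℝ))) = slice hA hg :=
    funext fun x ↦ slice_eq hA hg x
  rw [h2] at h1
  exact congrArg (fun L : EuclideanSpace ℝ (Fin n) →L[ℝ] EuclideanSpace ℝ (Fin (n + 2)) ↦ L v) h1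

lemma sliceGenerator_eq (x : M) : sliceGenerator hA hg x =
    mfderiv ((𝓡 n).prod 𝓘(ℝ, ℝ)) (𝓡 (n + 2)) (fun z : M × ℝ ↦ ι (triv hg z)) (x, 0)
      ((0, 1) : EuclideanSpace ℝ (Fin n) × ℝ) :=
  (congrArg (fun a : A ↦ ((generator a : TangentSpace (𝓡 (n + 2)) a) :
    EuclideanSpace ℝ (Fin (n + 2)))) (slice_eq hA hg x)).symm.trans
      (hA.mfderiv_param_vertical hg (x, 0)).symm

lemma sliceDeriv_add_smul_generator (x : M) (v : EuclideanSpace ℝ (Fin n)) (r : ℝ) :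
    sliceDeriv hA hg x v + r • sliceGenerator hA hg x =
    mfderiv ((𝓡 n).prod 𝓘(ℝ, ℝ)) (𝓡 (n + 2)) (fun z : M × ℝ ↦ ι (triv hg z)) (x, 0)
      ((v, r) : EuclideanSpace ℝ (Fin n) × ℝ) := by
  have h1 : ((v, r) : EuclideanSpace ℝ (Fin n) × ℝ) = (v, 0) + r • (0, 1) :=
    Prod.ext (by simp) (by simp)
  have h2 (L : EuclideanSpace ℝ (Fin n) × ℝ →L[ℝ] EuclideanSpace ℝ (Fin (n + 2))) :
      L (v, r) = L (v, 0) + r • L (0, 1) := by rw [h1, map_add, map_smul]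
  rw [sliceDeriv_eq, sliceGenerator_eq]
  exact (h2 _).symm

lemma eq_zero_of_sliceDeriv_add_eq_zero {x : M} {v : EuclideanSpace ℝ (Fin n)} {r : ℝ}
    (h0 : sliceDeriv hA hg x v + r • sliceGenerator hA hg x = 0) : v = 0 ∧ r = 0 := by
  rw [sliceDeriv_add_smul_generator] at h0
  have h1 := hA.mfderiv_param_injective hg (x, 0) (h0.trans (map_zero (mfderiv
    ((𝓡 n).prod 𝓘(ℝ, ℝ)) (𝓡 (n + 2)) (fun z : M × ℝ ↦ ι (triv hg z)) (x, 0))).symm)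
  exact ⟨congrArg (fun y : EuclideanSpace ℝ (Fin n) × ℝ ↦ y.1) h1,
    congrArg (fun y : EuclideanSpace ℝ (Fin n) × ℝ ↦ y.2) h1⟩

namespace IsAmbientMetric

include hh

/-- The tautological condition at t = 0, where the point of 𝒬 is g_x itself. Components along X do
not matter because they project to zero. -/
lemma sliceMetric_apply (x : M) (v w : EuclideanSpace ℝ (Fin n)) (r s : ℝ) :
    sliceMetric hA hg h x (sliceDeriv hA hg x v + r • sliceGenerator hA hg x)
      (sliceDeriv hA hg x w + s • sliceGenerator hA hg x) = g x v w := by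
  rw [sliceDeriv_add_smul_generator, sliceDeriv_add_smul_generator]
  refine (apply_congr_point h (slice_eq hA hg x) _ _).symm.trans
    ((hh.tautological g hg (x, 0) ((v, r) : EuclideanSpace ℝ (Fin n) × ℝ)
      ((w, s) : EuclideanSpace ℝ (Fin n) × ℝ)).trans ?_)
  rw [mfderiv_fst]
  change (Real.exp 0 ^ 2 • (g x : EuclideanSpace ℝ (Fin n) →L[ℝ] EuclideanSpace ℝ (Fin n) →L[ℝ] ℝ))
    v w = g x v w
  rw [Real.exp_zero, one_pow, one_smul]

lemma sliceMetric_sliceGenerator (x : M) (v : EuclideanSpace ℝ (Fin n)) (r : ℝ) :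
    sliceMetric hA hg h x (sliceGenerator hA hg x)
      (sliceDeriv hA hg x v + r • sliceGenerator hA hg x) = 0 := by
  have h1 := hh.sliceMetric_apply hA hg x 0 v 1 r
  rw [map_zero, zero_add, one_smul] at h1
  rw [h1]
  exact (congrArg (fun L : EuclideanSpace ℝ (Fin n) →L[ℝ] ℝ ↦ L v) (map_zero (g x))).trans rfl

lemma exists_sliceDeriv_add_eq {x : M} {e : EuclideanSpace ℝ (Fin (n + 2))}
    (he : sliceMetric hA hg h x (sliceGenerator hA hg x) e = 0) :
    ∃ (v : EuclideanSpace ℝ (Fin n)) (r : ℝ), sliceDeriv hA hg x v + r • sliceGenerator hA hg x = e := by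
  have h1 : h (ι (triv hg (x, 0))) (generator (ι (triv hg (x, 0)))) e = 0 := by
    refine Eq.trans ?_ he
    have (a b : A) (hab : a = b) : h a (generator a) e = h b (generator b) e := by
      subst hab; rfl
    exact this _ _ (slice_eq hA hg x)
  obtain ⟨⟨v, r⟩, hv⟩ := hh.exists_mfderiv_param_eq hA hg (x, 0) e h1
  exact ⟨v, r, (sliceDeriv_add_smul_generator hA hg x v r).trans hv⟩

omit hh in
lemma _root_.AmbientTractor.sliceGenerator_ne_zero (x : M) : sliceGenerator hA hg x ≠ 0 := by
  intro h0
  have := (eq_zero_of_sliceDeriv_add_eq_zero hA hg (x := x) (v := 0) (r := 1)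
    (by rw [map_zero, h0, smul_zero, add_zero])).2
  exact one_ne_zero this

end IsAmbientMetric

lemma contMDiff_generator_slice : ContMDiff (𝓡 n) (𝓡 (n + 2)).tangent ∞
    (fun x ↦ (⟨slice hA hg x, generator (slice hA hg x)⟩ : TangentBundle (𝓡 (n + 2)) A)) :=
  (contMDiff_generator hA.smooth_action).comp (slice hA hg).contMDiff

lemma isSmoothSection_tractorInclusion {φ : ∀ x, c.density (-1) x} (hφ : c.IsSmoothDensity φ) :
    IsSmoothSection n (fun x ↦ tractorInclusion hA hg x (φ x)) := by
  rw [isSmoothSection_iff]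
  intro x
  exact contMDiffAt_smul_section (slice hA hg).contMDiff.contMDiffAt
    (hφ.contMDiff_value (hg := hg) x) (contMDiff_generator_slice hA hg x)

lemma tractorInclusion_injective (x : M) : Function.Injective (tractorInclusion hA hg x) := by
  intro φ ψ h
  have h1 : φ.1 ⟨value hg x, rfl⟩ • sliceGenerator hA hg x =
      ψ.1 ⟨value hg x, rfl⟩ • sliceGenerator hA hg x := h
  exact density_ext hg (smul_left_injective ℝ (sliceGenerator_ne_zero hA hg x) h1)

lemma mem_range_tractorInclusion (x : M) (r : ℝ) :
    (show Tractor (slice hA hg) x from r • sliceGenerator hA hg x) ∈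
      LinearMap.range (tractorInclusion hA hg x) := by
  have hinj := hA.triv_injective hg
  refine ⟨r • unitDensity hg hinj x, ?_⟩
  have h1 : densityFun (unitDensity hg hinj) (value hg x) = 1 := by
    rw [← triv_zero, densityFun_unitDensity, Real.exp_zero, inv_one]
  change (r * densityFun (unitDensity hg hinj) (value hg x)) • sliceGenerator hA hg x = _
  rw [h1, mul_one]

lemma mem_range_tractorInclusion_iff (x : M) (e : Tractor (slice hA hg) x) :
    e ∈ LinearMap.range (tractorInclusion hA hg x) ↔
      ∃ r : ℝ, (e : EuclideanSpace ℝ (Fin (n + 2))) = r • sliceGenerator hA hg x := by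
  constructor
  · rintro ⟨φ, rfl⟩
    exact ⟨φ.1 ⟨value hg x, rfl⟩, rfl⟩
  · rintro ⟨r, hr⟩
    have := mem_range_tractorInclusion hA hg x r
    rw [← hr] at this
    exact this

include hh

/-- The tractor derivative of a section of the distinguished line bundle. -/
lemma tractorConnection_tractorInclusion
    (h0 : ∀ u ∈ Set.range ι, ∀ v w : TangentSpace (𝓡 (n + 2)) u,
      extDerivForm (dualForm h) u v w = 0)
    {φ : ∀ x, c.density (-1) x} (hφ : c.IsSmoothDensity φ) (x : M) (v : TangentSpace (𝓡 n) x) :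
    (tractorConnection h (slice hA hg) (fun y ↦ tractorInclusion hA hg y (φ y)) x v :
      EuclideanSpace ℝ (Fin (n + 2))) =
      densityFun φ (value hg x) • sliceDeriv hA hg x v +
        (mvfderiv (𝓡 n) (fun x ↦ densityFun φ (value hg x)) x v : ℝ) •
          sliceGenerator hA hg x := by
  have h1 := covDerivAlong_smul (h := h) (f := slice hA hg)
    (s := fun x ↦ generator (slice hA hg x)) (hφ.contMDiff_value (hg := hg) |>.mdifferentiable
      (by simp) x) ((contMDiff_generator_slice hA hg).mdifferentiable (by simp) x) v
  refine h1.trans ?_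
  -- X along the slice is the restriction of a field on A, so its derivative in the direction v is
  -- ∇X applied to Tf(v), which is Tf(v) since dα = 0.
  have h2 := covDerivAlong_comp (h := h) (IN := 𝓡 (n + 2))
    (σ := fun a ↦ (⟨a, generator a⟩ : TangentBundle (𝓡 (n + 2)) A)) (k := slice hA hg) (z := x)
    ((contMDiff_generator hA.smooth_action).mdifferentiable (by simp) _)
    ((slice hA hg).contMDiff.mdifferentiable (by simp) x) v
  have h3 := h2.trans (hh.covDerivAlong_generator hA (h0 (slice hA hg x) ⟨value hg x, rfl⟩) _)
  exact congrArg (fun e : EuclideanSpace ℝ (Fin (n + 2)) ↦ densityFun φ (value hg x) • e +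
    (mvfderiv (𝓡 n) (fun x ↦ densityFun φ (value hg x)) x v : ℝ) • sliceGenerator hA hg x) h3

end Slice

/-! ### Metric compatibility of the tractor connection -/

section Metric

variable {n : ℕ} {M : Type*} [TopologicalSpace M]
    [ChartedSpace (EuclideanSpace ℝ (Fin n)) M] [IsManifold (𝓡 n) ∞ M]
    {A : Type*} [TopologicalSpace A] [ChartedSpace (EuclideanSpace ℝ (Fin (n + 2))) A]
    [IsManifold (𝓡 (n + 2)) ∞ A] {f : ContMDiffMap (𝓡 n) (𝓡 (n + 2)) M A ∞}
    {h : ∀ u : A, TangentSpace (𝓡 (n + 2)) u →L[ℝ] TangentSpace (𝓡 (n + 2)) u →L[ℝ] ℝ} {p q : ℕ}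

lemma mfderiv_tractorMetric
    (hh : IsPseudoMetric (𝓡 (n + 2)) (EuclideanSpace ℝ (Fin (n + 2)))
      (TangentSpace (𝓡 (n + 2)) : A → Type _) p q h) {σ τ : ∀ x, Tractor f x}
    (hσ : IsSmoothSection n σ) (hτ : IsSmoothSection n τ) (x : M) (v : TangentSpace (𝓡 n) x) :
    (mfderiv (𝓡 n) 𝓘(ℝ, ℝ) (fun y ↦ tractorMetric h f y (σ y) (τ y)) x v : ℝ) =
      tractorMetric h f x (tractorConnection h f σ x v) (τ x) +
        tractorMetric h f x (σ x) (tractorConnection h f τ x v) := by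
  rw [isSmoothSection_iff] at hσ hτ
  have hx := mem_extChartAt_source (I := 𝓡 n) x
  have hu := mem_extChartAt_source (I := 𝓡 (n + 2)) (f x)
  let φ := chartMap (m := n) (m' := n + 2) f x (f x)
  let a := chartSection σ x (f x)
  let b := chartSection τ x (f x)
  have hφ : ContDiffAt ℝ ∞ φ (extChartAt (𝓡 n) x x) :=
    contDiffAt_chartMap hx hu f.contMDiff.contMDiffAt
  have ha : ContDiffAt ℝ ∞ a (extChartAt (𝓡 n) x x) := contDiffAt_chartSection hx hu (hσ x)
  have hb : ContDiffAt ℝ ∞ b (extChartAt (𝓡 n) x x) := contDiffAt_chartSection hx hu (hτ x)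
  have hφx : φ (extChartAt (𝓡 n) x x) = extChartAt (𝓡 (n + 2)) (f x) (f x) := chartMap_apply hx
  have hmem : φ (extChartAt (𝓡 n) x x) ∈ (extChartAt (𝓡 (n + 2)) (f x)).target := by
    rw [hφx]
    exact mem_extChartAt_target _
  have hG := hh.isCoordMetric (f x)
  have e1 : (fun y ↦ tractorMetric h f y (σ y) (τ y)) =ᶠ[𝓝 x]
      fun y ↦ chartMetric h (f x) (φ (extChartAt (𝓡 n) x y)) (a (extChartAt (𝓡 n) x y))
        (b (extChartAt (𝓡 n) x y)) := by
    filter_upwards [eventually_slice_mem (f := f) x,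
      extChartAt_source_mem_nhds (I := 𝓡 n) x] with y hy hys
    have h1 : φ (extChartAt (𝓡 n) x y) = extChartAt (𝓡 (n + 2)) (f x) (f y) := chartMap_apply hys
    have h2 : a (extChartAt (𝓡 n) x y) = tangentChart (f x) (f y) (σ y) :=
      (chartSection_apply hys).trans (vecCoord_eq (ζ := fieldAlong σ y) hy)
    have h3 : b (extChartAt (𝓡 n) x y) = tangentChart (f x) (f y) (τ y) :=
      (chartSection_apply hys).trans (vecCoord_eq (ζ := fieldAlong τ y) hy)
    rw [h1, h2, h3]
    exact (chartMetric_tangentChart h hy (σ y) (τ y)).symm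
  have hd : DifferentiableAt ℝ (fun z ↦ chartMetric h (f x) (φ z) (a z) (b z))
      (extChartAt (𝓡 n) x x) :=
    (((hG.differentiableAt hmem).comp _ (hφ.differentiableAt (by simp))).clm_apply
      (ha.differentiableAt (by simp))).clm_apply (hb.differentiableAt (by simp))
  have h4 := mvfderiv_fderiv_comp (g := fun y ↦ extChartAt (𝓡 n) x y) hd
    (mdifferentiableAt_extChartAt_of_mem hx) v
  have h5 : mvfderiv (𝓡 n) (fun y ↦ extChartAt (𝓡 n) x y) x v = tangentChart x x v := rfl
  have h6 := hG.fderiv_metric_along hmem (hφ.differentiableAt (by simp))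
    (ha.differentiableAt (by simp)) (hb.differentiableAt (by simp)) (tangentChart x x v)
  have h7 := tangentChart_tractorConnection hh hx hu (hσ x) v
  have h8 := tangentChart_tractorConnection hh hx hu (hτ x) v
  have h9 : a (extChartAt (𝓡 n) x x) = tangentChart (f x) (f x) (σ x) :=
    (chartSection_apply hx).trans (vecCoord_eq (ζ := fieldAlong σ x) hu)
  have h10 : b (extChartAt (𝓡 n) x x) = tangentChart (f x) (f x) (τ x) :=
    (chartSection_apply hx).trans (vecCoord_eq (ζ := fieldAlong τ x) hu)
  refine (congrArg (fun L : EuclideanSpace ℝ (Fin n) →L[ℝ] ℝ ↦ L v) (mvfderiv_congr e1)).trans ?_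
  refine h4.trans ?_
  rw [h5, h6, ← h7, ← h8, h9, h10, hφx]
  exact congrArg₂ (· + ·) (chartMetric_tangentChart h hu _ (τ x))
    (chartMetric_tangentChart h hu (σ x) _)

end Metric

/-! ### The standard tractor bundle -/

section Standard

variable {n p q : ℕ} {M : Type*} [TopologicalSpace M]
    [ChartedSpace (EuclideanSpace ℝ (Fin n)) M] [IsManifold (𝓡 n) ∞ M]
    {c : ConformalStructure n p q M}

open ConformalStructure

variable {A : Type*} [TopologicalSpace A] [ChartedSpace (EuclideanSpace ℝ (Fin (n + 2))) A]
    [MulAction PosReal A] {ι : c.RayBundle → A} (hA : IsAmbientManifold ι)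
    {g : ∀ x : M, TangentSpace (𝓡 n) x →L[ℝ] TangentSpace (𝓡 n) x →L[ℝ] ℝ}
    (hg : g ∈ c.metrics) [IsManifold (𝓡 (n + 2)) ∞ A]
  {h : ∀ u : A, TangentSpace (𝓡 (n + 2)) u →L[ℝ] TangentSpace (𝓡 (n + 2)) u →L[ℝ] ℝ}
  (hh : IsAmbientMetric ι h)

include hh

lemma isStandardTractorBundle
    (h0 : ∀ u ∈ Set.range ι, ∀ v w : TangentSpace (𝓡 (n + 2)) u,
      extDerivForm (dualForm h) u v w = 0) :
    IsStandardTractorBundle c (tractorInclusion hA hg) (tractorMetric h (slice hA hg))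
      (tractorConnection h (slice hA hg)) where
  isPseudoMetric := isPseudoMetric_tractorMetric hh.isPseudoMetric
  smooth_inclusion _ hφ := isSmoothSection_tractorInclusion hA hg hφ
  injective := tractorInclusion_injective hA hg
  null x φ ψ := by
    have h1 := hh.sliceMetric_sliceGenerator hA hg x 0 1
    rw [map_zero, zero_add, one_smul] at h1
    have h2 (r s : ℝ) : sliceMetric hA hg h x (r • sliceGenerator hA hg x)
        (s • sliceGenerator hA hg x) = 0 := by
      rw [map_smul, map_smul, smul_apply, h1, smul_zero, smul_zero]
    exact h2 (φ.1 ⟨value hg x, rfl⟩) (ψ.1 ⟨value hg x, rfl⟩)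
  smooth_connection := contMDiffCovariantDerivative_tractorConnection hh.isPseudoMetric
  metric_connection _ _ hσ hτ := mfderiv_tractorMetric hh.isPseudoMetric hσ hτ
  -- For the unit density, ∇_v(jφ) is Tf(v) plus a multiple of X, and Tf(v) lies on the line of X
  -- only if v = 0.
  nondegenerate x v hv := by
    have hinj := hA.triv_injective hg
    have hφ := isSmoothDensity_unitDensity hinj
    refine ⟨unitDensity hg hinj, hφ, fun h1 ↦ hv ?_⟩
    obtain ⟨r, hr⟩ := (mem_range_tractorInclusion_iff hA hg x _).1 h1
    have h2 := (tractorConnection_tractorInclusion hA hg hh h0 hφ x v).symm.trans hr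
    have h3 : densityFun (unitDensity hg hinj) (value hg x) = 1 := by
      rw [← triv_zero, densityFun_unitDensity, Real.exp_zero, inv_one]
    have h4 (v : EuclideanSpace ℝ (Fin n)) (s : ℝ) (h2 : (1 : ℝ) • sliceDeriv hA hg x v +
        s • sliceGenerator hA hg x = r • sliceGenerator hA hg x) : v = 0 := by
      rw [one_smul, ← sub_eq_zero, add_sub_assoc, ← sub_smul] at h2
      exact (eq_zero_of_sliceDeriv_add_eq_zero hA hg h2).1
    rw [h3] at h2
    exact h4 v _ h2
  -- Everything is compared with g_x: for b = e^{2t}g_x the two densities contribute e^{-2t} and the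
  -- form contributes e^{2t}.
  conformal φ ψ hφ hψ b v w := by
    obtain ⟨t, ht⟩ := triv_surjective hg b
    have h1 (φ : ∀ x, c.density (-1) x) :
        densityFun φ b = (Real.exp t)⁻¹ * densityFun φ (value hg b.base) :=
      (congrArg (densityFun φ) ht).symm.trans (density_triv hg φ (b.base, t))
    have h2 : (b.form v w : ℝ) = Real.exp t ^ 2 * g b.base v w := by
      have h3 : b.form = Real.exp t ^ 2 • g b.base := by
        obtain ⟨x, form, hb⟩ := b
        exact (RayBundle.mk.inj ht).2.symm
      rw [h3]
      rfl
    have h3 (a r a' r' : ℝ) (v w : EuclideanSpace ℝ (Fin n)) :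
        sliceMetric hA hg h b.base
          (a • sliceDeriv hA hg b.base v + r • sliceGenerator hA hg b.base)
          (a' • sliceDeriv hA hg b.base w + r' • sliceGenerator hA hg b.base) =
        a * a' * g b.base v w := by
      rw [← map_smul, ← map_smul, hh.sliceMetric_apply]
      have (L : EuclideanSpace ℝ (Fin n) →L[ℝ] EuclideanSpace ℝ (Fin n) →L[ℝ] ℝ) :
          L (a • v) (a' • w) = a * a' * L v w := by
        rw [map_smul, map_smul, smul_apply, smul_eq_mul, smul_eq_mul]
        ring
      exact this (g b.base)
    have h4 := tractorConnection_tractorInclusion hA hg hh h0 hφ b.base v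
    have h5 := tractorConnection_tractorInclusion hA hg hh h0 hψ b.base w
    refine (congrArg₂ (fun e e' ↦ sliceMetric hA hg h b.base e e') h4 h5).trans
      ((h3 _ _ _ _ v w).trans ?_)
    rw [h1, h1, h2]
    field_simp

end Standard

/-! ### Vector fields and Lie brackets in charts -/

section Field

variable {m : ℕ} {M : Type*} [TopologicalSpace M]
    [ChartedSpace (EuclideanSpace ℝ (Fin m)) M] [IsManifold (𝓡 m) ∞ M]

/-- The coordinate expression of a vector field in the preferred chart at `x`. -/
def chartField (ξ : ∀ x : M, TangentSpace (𝓡 m) x) (x : M) (y : EuclideanSpace ℝ (Fin m)) :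
    EuclideanSpace ℝ (Fin m) :=
  tangentChart x ((extChartAt (𝓡 m) x).symm y) (ξ ((extChartAt (𝓡 m) x).symm y))

lemma chartField_apply {ξ : ∀ x : M, TangentSpace (𝓡 m) x} {x y : M}
    (hy : y ∈ (extChartAt (𝓡 m) x).source) :
    chartField ξ x (extChartAt (𝓡 m) x y) = tangentChart x y (ξ y) := by
  rw [chartField, (extChartAt (𝓡 m) x).left_inv hy]

lemma contDiffAt_chartField {ξ : ∀ x : M, TangentSpace (𝓡 m) x} (hξ : IsSmoothField ξ) {x y : M}
    (hy : y ∈ (extChartAt (𝓡 m) x).source) :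
    ContDiffAt ℝ ∞ (chartField ξ x) (extChartAt (𝓡 m) x y) := by
  have ht := (extChartAt (𝓡 m) x).map_source hy
  have h1 : ContMDiffAt 𝓘(ℝ, EuclideanSpace ℝ (Fin m)) (𝓡 m) ∞ (extChartAt (𝓡 m) x).symm
      (extChartAt (𝓡 m) x y) :=
    (contMDiffOn_extChartAt_symm x).contMDiffAt ((isOpen_extChartAt_target x).mem_nhds ht)
  have h2 : ContMDiffAt (𝓡 m) 𝓘(ℝ, EuclideanSpace ℝ (Fin m)) ∞
      (fun y ↦ vecCoord x (⟨y, ξ y⟩ : TangentBundle (𝓡 m) M)) y :=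
    (contMDiffAt_section_iff_of_mem (f := fun y : M ↦ y) contMDiffAt_id hy).1 (hξ y)
  have h3 : ContMDiffAt 𝓘(ℝ, EuclideanSpace ℝ (Fin m)) 𝓘(ℝ, EuclideanSpace ℝ (Fin m)) ∞
      (fun z ↦ vecCoord x (⟨(extChartAt (𝓡 m) x).symm z, ξ ((extChartAt (𝓡 m) x).symm z)⟩ :
        TangentBundle (𝓡 m) M)) (extChartAt (𝓡 m) x y) :=
    ContMDiffAt.comp (g := fun y ↦ vecCoord x (⟨y, ξ y⟩ : TangentBundle (𝓡 m) M))
      (extChartAt (𝓡 m) x y) (by rwa [(extChartAt (𝓡 m) x).left_inv hy]) h1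
  refine h3.contDiffAt.congr_of_eventuallyEq ?_
  filter_upwards [(isOpen_extChartAt_target x).mem_nhds ht] with z hz
  exact (vecCoord_eq (ζ := (⟨(extChartAt (𝓡 m) x).symm z, ξ ((extChartAt (𝓡 m) x).symm z)⟩ :
    TangentBundle (𝓡 m) M)) ((extChartAt (𝓡 m) x).map_target hz)).symm

lemma tangentChart_mlieBracket (ξ η : ∀ x : M, TangentSpace (𝓡 m) x) (x : M) :
    tangentChart x x (VectorField.mlieBracket (𝓡 m) ξ η x) =
      fderiv ℝ (chartField η x) (extChartAt (𝓡 m) x x) (chartField ξ x (extChartAt (𝓡 m) x x)) -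
      fderiv ℝ (chartField ξ x) (extChartAt (𝓡 m) x x)
        (chartField η x (extChartAt (𝓡 m) x x)) := by
  have hx := mem_extChartAt_source (I := 𝓡 m) x
  have ht := (extChartAt (𝓡 m) x).map_source hx
  have key (ξ : ∀ x : M, TangentSpace (𝓡 m) x) :
      VectorField.mpullbackWithin 𝓘(ℝ, EuclideanSpace ℝ (Fin m)) (𝓡 m)
        (extChartAt (𝓡 m) x).symm ξ (Set.range (𝓡 m)) =ᶠ[𝓝 (extChartAt (𝓡 m) x x)]
      chartField ξ x := by
    filter_upwards [(isOpen_extChartAt_target x).mem_nhds ht] with z hz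
    rw [VectorField.mpullbackWithin, ModelWithCorners.range_eq_univ, mfderivWithin_univ]
    -- The bracket is defined by pulling back along the inverse chart, which applies the inverse of
    -- its derivative, that is, the derivative of the chart.
    have h1 : ContinuousLinearMap.inverse
        (chartFrame x z : EuclideanSpace ℝ (Fin m) →L[ℝ] EuclideanSpace ℝ (Fin m)) =
        tangentChart x ((extChartAt (𝓡 m) x).symm z) := by
      refine ContinuousLinearMap.inverse_eq ?_ ?_
      · ext1 v
        have := chartFrame_tangentChart ((extChartAt (𝓡 m) x).map_target hz) v
        rw [(extChartAt (𝓡 m) x).right_inv hz] at this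
        exact this
      · ext1 v
        exact tangentChart_chartFrame hz v
    exact congrArg (fun L : EuclideanSpace ℝ (Fin m) →L[ℝ] EuclideanSpace ℝ (Fin m) ↦
      L (ξ ((extChartAt (𝓡 m) x).symm z))) h1
  let V (ξ : ∀ x : M, TangentSpace (𝓡 m) x) : EuclideanSpace ℝ (Fin m) → EuclideanSpace ℝ (Fin m) :=
    VectorField.mpullbackWithin 𝓘(ℝ, EuclideanSpace ℝ (Fin m)) (𝓡 m)
      (extChartAt (𝓡 m) x).symm ξ (Set.range (𝓡 m))
  let L : EuclideanSpace ℝ (Fin m) →L[ℝ] EuclideanSpace ℝ (Fin m) :=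
    mfderiv (𝓡 m) 𝓘(ℝ, EuclideanSpace ℝ (Fin m)) (extChartAt (𝓡 m) x) x
  have h1 : VectorField.mlieBracket (𝓡 m) ξ η x = L.inverse (VectorField.lieBracketWithin ℝ
      (V ξ) (V η) ((extChartAt (𝓡 m) x).symm ⁻¹' Set.univ ∩ Set.range (𝓡 m))
        (extChartAt (𝓡 m) x x)) := rfl
  have h2 : L.inverse = ContinuousLinearMap.id ℝ _ := by
    refine ContinuousLinearMap.inverse_eq ?_ ?_ <;>
    · ext1 v
      exact tangentChart_self x v
  have h3 : (extChartAt (𝓡 m) x).symm ⁻¹' Set.univ ∩ Set.range (𝓡 m) = Set.univ := by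
    rw [ModelWithCorners.range_eq_univ, Set.preimage_univ, Set.univ_inter]
  rw [h2, h3, VectorField.lieBracketWithin_univ] at h1
  refine (tangentChart_self x _).trans (h1.trans ?_)
  exact ((key ξ).lieBracket_vectorField_eq (key η)).trans
    (congrFun VectorField.lieBracket_eq _)

end Field

/-! ### Curvature of the tractor connection -/

section Curvature

variable {n : ℕ} {M : Type*} [TopologicalSpace M]
    [ChartedSpace (EuclideanSpace ℝ (Fin n)) M] [IsManifold (𝓡 n) ∞ M]
    {A : Type*} [TopologicalSpace A] [ChartedSpace (EuclideanSpace ℝ (Fin (n + 2))) A]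
    [IsManifold (𝓡 (n + 2)) ∞ A] {f : ContMDiffMap (𝓡 n) (𝓡 (n + 2)) M A ∞}
    {h : ∀ u : A, TangentSpace (𝓡 (n + 2)) u →L[ℝ] TangentSpace (𝓡 (n + 2)) u →L[ℝ] ℝ} {p q : ℕ}
    (hh : IsPseudoMetric (𝓡 (n + 2)) (EuclideanSpace ℝ (Fin (n + 2)))
      (TangentSpace (𝓡 (n + 2)) : A → Type _) p q h) {σ : ∀ x, Tractor f x}
    (hσ : IsSmoothSection n σ) {ξ η : ∀ x : M, TangentSpace (𝓡 n) x} (hξ : IsSmoothField ξ)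
    (hη : IsSmoothField η)

include hh hσ

lemma vecCoord_tractorConnection (ξ : ∀ x : M, TangentSpace (𝓡 n) x) {x y : M}
    (hy : f y ∈ (extChartAt (𝓡 (n + 2)) (f x)).source) (hys : y ∈ (extChartAt (𝓡 n) x).source) :
    vecCoord (f x) (fieldAlong (fun y ↦ tractorConnection h f σ y (ξ y)) y) =
      covAlong (chartMetric h (f x)) (chartMap (m := n) (m' := n + 2) f x (f x))
        (chartSection σ x (f x)) (extChartAt (𝓡 n) x y)
        (chartField ξ x (extChartAt (𝓡 n) x y)) := by
  rw [chartField_apply hys, ← tangentChart_tractorConnection hh hys hy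
    (isSmoothSection_iff.1 hσ y) (ξ y)]
  exact vecCoord_eq (ζ := fieldAlong (fun y ↦ tractorConnection h f σ y (ξ y)) y) hy

include hξ

lemma contDiffAt_covAlong_chartSection (x : M) :
    ContDiffAt ℝ ∞ (fun z ↦ covAlong (chartMetric h (f x))
      (chartMap (m := n) (m' := n + 2) f x (f x)) (chartSection σ x (f x)) z
        (chartField ξ x z)) (extChartAt (𝓡 n) x x) := by
  have hx := mem_extChartAt_source (I := 𝓡 n) x
  have hu := mem_extChartAt_source (I := 𝓡 (n + 2)) (f x)
  have hφ : ContDiffAt ℝ ∞ (chartMap (m := n) (m' := n + 2) f x (f x)) (extChartAt (𝓡 n) x x) :=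
    contDiffAt_chartMap hx hu f.contMDiff.contMDiffAt
  have ha := contDiffAt_chartSection hx hu (isSmoothSection_iff.1 hσ x)
  have hc := contDiffAt_chartField hξ hx
  have hΓ : ContDiffAt ℝ ∞ (christoffelMap (chartMetric h (f x)))
      (chartMap (m := n) (m' := n + 2) f x (f x) (extChartAt (𝓡 n) x x)) := by
    refine (hh.isCoordMetric (f x)).contDiffAt_christoffelMap ?_
    rw [chartMap_apply hx]
    exact mem_extChartAt_target _
  exact ((ha.fderiv_right (by simp)).clm_apply hc).add
    (((ContDiffAt.comp (g := christoffelMap (chartMetric h (f x))) _ hΓ hφ).clm_apply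
      ((hφ.fderiv_right (by simp)).clm_apply hc)).clm_apply ha)

lemma isSmoothSection_tractorConnection :
    IsSmoothSection n (fun y ↦ tractorConnection h f σ y (ξ y)) := by
  rw [isSmoothSection_iff]
  intro x
  refine (contMDiffAt_section_iff (f := f) (s := fun y ↦ tractorConnection h f σ y (ξ y))
    f.contMDiff.contMDiffAt).2 ?_
  have h1 := ContMDiffAt.comp (g := fun z ↦ covAlong (chartMetric h (f x))
      (chartMap (m := n) (m' := n + 2) f x (f x)) (chartSection σ x (f x)) z
        (chartField ξ x z)) x (contDiffAt_covAlong_chartSection hh hσ hξ x).contMDiffAt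
        (contMDiffAt_extChartAt (I := 𝓡 n) (n := ∞))
  refine h1.congr_of_eventuallyEq ?_
  filter_upwards [eventually_slice_mem (f := f) x,
    extChartAt_source_mem_nhds (I := 𝓡 n) x] with y hy hys
  exact vecCoord_tractorConnection hh hσ ξ hy hys

lemma chartSection_tractorConnection (x : M) :
    chartSection (fun y ↦ tractorConnection h f σ y (ξ y)) x (f x) =ᶠ[𝓝 (extChartAt (𝓡 n) x x)]
      fun z ↦ covAlong (chartMetric h (f x)) (chartMap (m := n) (m' := n + 2) f x (f x))
        (chartSection σ x (f x)) z (chartField ξ x z) := by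
  have hx := mem_extChartAt_source (I := 𝓡 n) x
  have ht := (extChartAt (𝓡 n) x).map_source hx
  have h1 : Tendsto (extChartAt (𝓡 n) x).symm (𝓝 (extChartAt (𝓡 n) x x)) (𝓝 x) := by
    have := continuousAt_extChartAt_symm (I := 𝓡 n) x
    rwa [ContinuousAt, (extChartAt (𝓡 n) x).left_inv hx] at this
  have h2 : ∀ᶠ z in 𝓝 (extChartAt (𝓡 n) x x),
      f ((extChartAt (𝓡 n) x).symm z) ∈ (extChartAt (𝓡 (n + 2)) (f x)).source :=
    h1.eventually (eventually_slice_mem (f := f) x)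
  filter_upwards [h2, (isOpen_extChartAt_target x).mem_nhds ht] with z hz hzt
  have h3 := vecCoord_tractorConnection hh hσ ξ hz ((extChartAt (𝓡 n) x).map_target hzt)
  rw [(extChartAt (𝓡 n) x).right_inv hzt] at h3
  exact h3

include hη

/-- The curvature of the tractor connection is the pull-back of the Riemann curvature. -/
lemma curvature_tractorConnection (x : M) :
    (curvature (tractorConnection h f) ξ η σ x : EuclideanSpace ℝ (Fin (n + 2))) =
      riemann (chartMetric h (f x)) (extChartAt (𝓡 (n + 2)) (f x) (f x))
        (mfderiv (𝓡 n) (𝓡 (n + 2)) f x (ξ x)) (mfderiv (𝓡 n) (𝓡 (n + 2)) f x (η x)) (σ x) := by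
  have hx := mem_extChartAt_source (I := 𝓡 n) x
  have hu := mem_extChartAt_source (I := 𝓡 (n + 2)) (f x)
  have hφ : ContDiffAt ℝ ∞ (chartMap (m := n) (m' := n + 2) f x (f x)) (extChartAt (𝓡 n) x x) :=
    contDiffAt_chartMap hx hu f.contMDiff.contMDiffAt
  have ha := contDiffAt_chartSection hx hu (isSmoothSection_iff.1 hσ x)
  have hmem : chartMap (m := n) (m' := n + 2) f x (f x) (extChartAt (𝓡 n) x x) ∈
      (extChartAt (𝓡 (n + 2)) (f x)).target := by
    rw [chartMap_apply hx]
    exact mem_extChartAt_target _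
  have key {ξ η : ∀ x : M, TangentSpace (𝓡 n) x} (hη : IsSmoothField η) :
      (tractorConnection h f (fun y ↦ tractorConnection h f σ y (η y)) x (ξ x) :
        EuclideanSpace ℝ (Fin (n + 2))) =
      covAlong (chartMetric h (f x)) (chartMap (m := n) (m' := n + 2) f x (f x))
        (fun z ↦ covAlong (chartMetric h (f x)) (chartMap (m := n) (m' := n + 2) f x (f x))
          (chartSection σ x (f x)) z (chartField η x z)) (extChartAt (𝓡 n) x x)
        (chartField ξ x (extChartAt (𝓡 n) x x)) := by
    have h1 := tangentChart_tractorConnection hh hx hu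
      (isSmoothSection_iff.1 (isSmoothSection_tractorConnection hh hσ hη) x) (ξ x)
    rw [chartField_apply hx]
    have h2 := chartSection_tractorConnection hh hσ hη x
    refine (tangentChart_self (f x) _).symm.trans (h1.trans ?_)
    rw [covAlong, covAlong, h2.fderiv_eq, h2.self_of_nhds]
  have h3 := (tangentChart_self (f x) _).symm.trans (tangentChart_tractorConnection hh hx hu
    (isSmoothSection_iff.1 hσ x) (VectorField.mlieBracket (𝓡 n) ξ η x))
  rw [tangentChart_mlieBracket] at h3
  have h4 := (hh.isCoordMetric (f x)).covAlong_covAlong_sub hmem hφ ha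
    ((contDiffAt_chartField hξ hx).differentiableAt (by simp))
    ((contDiffAt_chartField hη hx).differentiableAt (by simp))
  have h5 (ξ : ∀ x : M, TangentSpace (𝓡 n) x) :
      fderiv ℝ (chartMap (m := n) (m' := n + 2) f x (f x)) (extChartAt (𝓡 n) x x)
        (chartField ξ x (extChartAt (𝓡 n) x x)) = mfderiv (𝓡 n) (𝓡 (n + 2)) f x (ξ x) := by
    rw [chartField_apply hx]
    exact (fderiv_chartMap hx hu (f.contMDiff.mdifferentiable (by simp) x) (ξ x)).trans
      (tangentChart_self _ _)
  rw [h5, h5, chartMap_apply hx, chartSection_apply hx] at h4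
  have h6 : vecCoord (f x) (fieldAlong σ x) = σ x :=
    (vecCoord_eq (ζ := fieldAlong σ x) hu).trans (tangentChart_self _ _)
  rw [h6] at h4
  refine Eq.trans ?_ h4
  exact congrArg₂ (fun a b : EuclideanSpace ℝ (Fin (n + 2)) ↦ a - b)
    (congrArg₂ (fun a b : EuclideanSpace ℝ (Fin (n + 2)) ↦ a - b) (key hη) (key hξ)) h3

end Curvature

/-! ### Traces of induced trilinear maps -/

section Flat

variable {E : Type*} [NormedAddCommGroup E] [NormedSpace ℝ E]

/-- The curvature of a metric in coordinates as a trilinear map. -/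
def riemannTrilin (G : E → E →L[ℝ] E →L[ℝ] ℝ) (y : E) : E →ₗ[ℝ] E →ₗ[ℝ] E →ₗ[ℝ] E :=
  LinearMap.mk₂ ℝ
    (fun v w ↦
      { toFun := riemann G y v w
        map_add' := fun z z' ↦ by simp only [riemann, map_add]; abel
        map_smul' := fun r z ↦ by
          simp only [riemann, map_smul, smul_sub, smul_add, RingHom.id_apply] })
    (fun v v' w ↦ by
      ext1 z
      simp only [LinearMap.coe_mk, AddHom.coe_mk, LinearMap.add_apply, riemann, map_add, add_apply]
      abel)
    (fun r v w ↦ by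
      ext1 z
      simp only [LinearMap.coe_mk, AddHom.coe_mk, LinearMap.smul_apply, riemann, map_smul,
        smul_apply, smul_sub, smul_add])
    (fun v w w' ↦ by
      ext1 z
      simp only [LinearMap.coe_mk, AddHom.coe_mk, LinearMap.add_apply, riemann, map_add, add_apply]
      abel)
    (fun r v w ↦ by
      ext1 z
      simp only [LinearMap.coe_mk, AddHom.coe_mk, LinearMap.smul_apply, riemann, map_smul,
        smul_apply, smul_sub, smul_add])

/-- The trilinear map which a trilinear map on `E` induces on a space `V` with maps from and
to `E`. -/
def inducedTrilin {V : Type*} [AddCommGroup V] [Module ℝ V] (R : E →ₗ[ℝ] E →ₗ[ℝ] E →ₗ[ℝ] E)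
    (L : V →ₗ[ℝ] E) (Q : E →ₗ[ℝ] V) : V →ₗ[ℝ] V →ₗ[ℝ] V →ₗ[ℝ] V :=
  LinearMap.mk₂ ℝ (fun v w ↦ Q ∘ₗ R (L v) (L w) ∘ₗ L)
    (fun v v' w ↦ by ext1; simp) (fun r v w ↦ by ext1; simp)
    (fun v w w' ↦ by ext1; simp) (fun r v w ↦ by ext1; simp)

/-- With T = R(·,Lv)(Lw) the hypothesis says T = L Q T + (k∘T) ⊗ X. The rank-one term has trace
k(TX) = 0, and cyclicity of the trace turns L Q T into Q T L, an endomorphism of V. -/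
lemma trace_inducedTrilin [FiniteDimensional ℝ E] {V : Type*} [AddCommGroup V] [Module ℝ V]
    [FiniteDimensional ℝ V] {R : E →ₗ[ℝ] E →ₗ[ℝ] E →ₗ[ℝ] E} {L : V →ₗ[ℝ] E} {Q : E →ₗ[ℝ] V}
    {k : E →ₗ[ℝ] ℝ} {X : E} {v w : V}
    (hT : ∀ e, R e (L v) (L w) = L (Q (R e (L v) (L w))) + k (R e (L v) (L w)) • X)
    (hX : R X (L v) (L w) = 0) :
    LinearMap.trace ℝ V (((inducedTrilin R L Q).flip v).flip w) =
      LinearMap.trace ℝ E ((R.flip (L v)).flip (L w)) := by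
  set T : E →ₗ[ℝ] E := (R.flip (L v)).flip (L w) with hTdef
  have h1 : ((inducedTrilin R L Q).flip v).flip w = (Q ∘ₗ T) ∘ₗ L := by
    ext1
    rfl
  have h2 : T = L ∘ₗ (Q ∘ₗ T) + (k ∘ₗ T).smulRight X := LinearMap.ext hT
  have h3 := congrArg (LinearMap.trace ℝ E) h2
  have h4 : (k ∘ₗ T) X = 0 := by
    rw [LinearMap.comp_apply, show T X = 0 from hX, map_zero]
  rw [map_add, LinearMap.trace_smulRight, h4, add_zero] at h3
  rw [h1, h3, LinearMap.trace_comp_comm']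

end Flat

/-! ### Normality -/

section Normal

variable {n p q : ℕ} {M : Type*} [TopologicalSpace M]
    [ChartedSpace (EuclideanSpace ℝ (Fin n)) M] [IsManifold (𝓡 n) ∞ M]
    {c : ConformalStructure n p q M}

open ConformalStructure

variable {A : Type*} [TopologicalSpace A] [ChartedSpace (EuclideanSpace ℝ (Fin (n + 2))) A]
    [MulAction PosReal A] {ι : c.RayBundle → A} (hA : IsAmbientManifold ι)
    {g : ∀ x : M, TangentSpace (𝓡 n) x →L[ℝ] TangentSpace (𝓡 n) x →L[ℝ] ℝ}
    (hg : g ∈ c.metrics) [IsManifold (𝓡 (n + 2)) ∞ A]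
  {h : ∀ u : A, TangentSpace (𝓡 (n + 2)) u →L[ℝ] TangentSpace (𝓡 (n + 2)) u →L[ℝ] ℝ}
  (hh : IsAmbientMetric ι h)
  (h0 : ∀ u ∈ Set.range ι, ∀ v w : TangentSpace (𝓡 (n + 2)) u,
    extDerivForm (dualForm h) u v w = 0)

namespace IsAmbientMetric

include hA hh h0

lemma exists_isNullCone_curl {u : A} (hu : u ∈ Set.range ι) :
    ∃ (φ : EuclideanSpace ℝ (Fin n) × ℝ → EuclideanSpace ℝ (Fin (n + 2)))
      (z : EuclideanSpace ℝ (Fin n) × ℝ),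
      IsNullCone (chartMetric h u) (extChartAt (𝓡 (n + 2)) u).target (chartGenerator u) φ z ∧
      φ z = extChartAt (𝓡 (n + 2)) u u ∧
      ∀ᶠ z' in 𝓝 z, ∀ v w, curl (chartMetric h u) (chartGenerator u) (φ z') v w = 0 := by
  obtain ⟨φ, z, hC, hz, hev⟩ := hh.exists_isNullCone hA hu
  refine ⟨φ, z, hC, hz, ?_⟩
  filter_upwards [hev] with z' hz' v w
  obtain ⟨a, ha, has, haz⟩ := hz'
  have h1 (v : EuclideanSpace ℝ (Fin (n + 2))) :
      ∃ v' : TangentSpace (𝓡 (n + 2)) a, tangentChart u a v' = v := by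
    have := tangentChart_chartFrame ((extChartAt (𝓡 (n + 2)) u).map_source has) v
    rw [(extChartAt (𝓡 (n + 2)) u).left_inv has] at this
    exact ⟨_, this⟩
  obtain ⟨v', rfl⟩ := h1 v
  obtain ⟨w', rfl⟩ := h1 w
  rw [haz, ← hh.extDerivForm_eq hA has, h0 a ha]

end IsAmbientMetric

/-- The curvature of the ambient metric along the slice. -/
def sliceRiemann
    (h : ∀ u : A, TangentSpace (𝓡 (n + 2)) u →L[ℝ] TangentSpace (𝓡 (n + 2)) u →L[ℝ] ℝ) (x : M) :
    EuclideanSpace ℝ (Fin (n + 2)) →ₗ[ℝ] EuclideanSpace ℝ (Fin (n + 2)) →ₗ[ℝ]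
      EuclideanSpace ℝ (Fin (n + 2)) →ₗ[ℝ] EuclideanSpace ℝ (Fin (n + 2)) :=
  riemannTrilin (chartMetric h (slice hA hg x))
    (extChartAt (𝓡 (n + 2)) (slice hA hg x) (slice hA hg x))

namespace IsAmbientMetric

include hh h0

lemma sliceRiemann_tangent (x : M) {v w z : EuclideanSpace ℝ (Fin (n + 2))}
    (hw : sliceMetric hA hg h x (sliceGenerator hA hg x) w = 0) :
    sliceRiemann hA hg h x (sliceGenerator hA hg x) w z = 0 ∧
    (sliceMetric hA hg h x (sliceGenerator hA hg x) v = 0 →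
      sliceRiemann hA hg h x v w (sliceGenerator hA hg x) = 0) ∧
    (sliceMetric hA hg h x (sliceGenerator hA hg x) z = 0 →
      sliceMetric hA hg h x (sliceGenerator hA hg x) (sliceRiemann hA hg h x v w z) = 0) := by
  obtain ⟨φ, z₀, hC, hz, hev⟩ := hh.exists_isNullCone_curl hA h0 (u := slice hA hg x)
    ⟨value hg x, rfl⟩
  have hX : chartGenerator (slice hA hg x) (φ z₀) = sliceGenerator hA hg x := by
    rw [hz]
    exact chartGenerator_self (slice hA hg x)
  have hG (v w : EuclideanSpace ℝ (Fin (n + 2))) :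
      chartMetric h (slice hA hg x) (φ z₀) v w = sliceMetric hA hg h x v w := by
    rw [hz]
    exact chartMetric_self (u := slice hA hg x) _ _
  have hR (v w z : EuclideanSpace ℝ (Fin (n + 2))) :
      riemann (chartMetric h (slice hA hg x)) (φ z₀) v w z = sliceRiemann hA hg h x v w z := by
    rw [hz]
    rfl
  simp only [← hR, ← hG, ← hX] at hw ⊢
  exact ⟨hC.riemann_field_left hev hw, fun hv ↦ hC.riemann_field hev hv hw,
    fun hz ↦ hC.riemann_tangent hev hw hz⟩

end IsAmbientMetric

/-- The map (v,r) ↦ Tf(v) + rX is injective, so it has a linear left inverse. Its extension beyond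
T𝒬 is arbitrary, which is harmless: it will only be applied to tangential vectors. -/
lemma exists_sliceProj (x : M) : ∃ (Q : EuclideanSpace ℝ (Fin (n + 2)) →ₗ[ℝ] EuclideanSpace ℝ (Fin n))
    (k : EuclideanSpace ℝ (Fin (n + 2)) →ₗ[ℝ] ℝ), ∀ (v : EuclideanSpace ℝ (Fin n)) (r : ℝ),
      Q (sliceDeriv hA hg x v + r • sliceGenerator hA hg x) = v ∧
      k (sliceDeriv hA hg x v + r • sliceGenerator hA hg x) = r := by
  let L : EuclideanSpace ℝ (Fin n) × ℝ →ₗ[ℝ] EuclideanSpace ℝ (Fin (n + 2)) :=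
    LinearMap.coprod (sliceDeriv hA hg x : EuclideanSpace ℝ (Fin n) →ₗ[ℝ] _)
      (LinearMap.id.smulRight (sliceGenerator hA hg x))
  have hL (v : EuclideanSpace ℝ (Fin n)) (r : ℝ) :
      L (v, r) = sliceDeriv hA hg x v + r • sliceGenerator hA hg x := rfl
  obtain ⟨K, hK⟩ := LinearMap.exists_leftInverse_of_injective L (by
    refine LinearMap.ker_eq_bot'.2 ?_
    rintro ⟨v, r⟩ hvr
    obtain ⟨h1, h2⟩ := eq_zero_of_sliceDeriv_add_eq_zero hA hg ((hL v r).symm.trans hvr)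
    rw [h1, h2]
    rfl)
  refine ⟨LinearMap.fst ℝ _ _ ∘ₗ K, LinearMap.snd ℝ _ _ ∘ₗ K, fun v r ↦ ?_⟩
  have h1 := LinearMap.congr_fun hK (v, r)
  rw [LinearMap.comp_apply, hL] at h1
  exact ⟨congrArg Prod.fst h1, congrArg Prod.snd h1⟩

include hh h0

lemma curvature_sliceRiemann {σ : ∀ x, Tractor (slice hA hg) x} (hσ : IsSmoothSection n σ)
    {ξ η : ∀ x : M, TangentSpace (𝓡 n) x} (hξ : IsSmoothField ξ) (hη : IsSmoothField η) (x : M) :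
    (curvature (tractorConnection h (slice hA hg)) ξ η σ x : EuclideanSpace ℝ (Fin (n + 2))) =
      sliceRiemann hA hg h x (sliceDeriv hA hg x (ξ x)) (sliceDeriv hA hg x (η x)) (σ x) :=
  curvature_tractorConnection hh.isPseudoMetric hσ hξ hη x

lemma isNormal (hric : ∀ u ∈ Set.range ι, ∀ v w : TangentSpace (𝓡 (n + 2)) u,
      dualForm h u v = 0 → dualForm h u w = 0 → ricci h u v w = 0) :
    IsNormal c (tractorInclusion hA hg) (tractorConnection h (slice hA hg)) := by
  have htan (x : M) (v : EuclideanSpace ℝ (Fin n)) :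
      sliceMetric hA hg h x (sliceGenerator hA hg x) (sliceDeriv hA hg x v) = 0 := by
    have := hh.sliceMetric_sliceGenerator hA hg x v 0
    rwa [zero_smul, add_zero] at this
  have hRX (x : M) (v w : EuclideanSpace ℝ (Fin n)) : sliceRiemann hA hg h x
      (sliceDeriv hA hg x v) (sliceDeriv hA hg x w) (sliceGenerator hA hg x) = 0 :=
    (hh.sliceRiemann_tangent hA hg h0 x (z := 0) (htan x w)).2.1 (htan x v)
  constructor
  · intro ξ η hξ hη φ hφ x
    -- More than required holds: the curvature annihilates the distinguished line.
    refine (mem_range_tractorInclusion_iff hA hg x _).2 ⟨0, ?_⟩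
    refine (curvature_sliceRiemann hA hg hh h0 (isSmoothSection_tractorInclusion hA hg hφ)
      hξ hη x).trans ?_
    have h1 (r : ℝ) (v w : EuclideanSpace ℝ (Fin n)) : sliceRiemann hA hg h x
        (sliceDeriv hA hg x v) (sliceDeriv hA hg x w) (r • sliceGenerator hA hg x) =
        (0 : ℝ) • sliceGenerator hA hg x := by
      rw [map_smul, hRX, smul_zero, zero_smul]
    exact h1 (densityFun φ (value hg x)) (ξ x) (η x)
  · intro x
    obtain ⟨Q, k, hQ⟩ := exists_sliceProj hA hg x
    -- R(v,w)z is tangential for every ambient v, so it splits into a slice part and a multiple of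
    -- X. The arbitrary first argument is what lets the trace over TA reduce to one over TM.
    have hdec (v : EuclideanSpace ℝ (Fin (n + 2))) (w z : EuclideanSpace ℝ (Fin n)) :
        sliceRiemann hA hg h x v (sliceDeriv hA hg x w) (sliceDeriv hA hg x z) =
          sliceDeriv hA hg x (Q (sliceRiemann hA hg h x v (sliceDeriv hA hg x w)
            (sliceDeriv hA hg x z))) +
          k (sliceRiemann hA hg h x v (sliceDeriv hA hg x w) (sliceDeriv hA hg x z)) •
            sliceGenerator hA hg x := by
      obtain ⟨v', r, hv⟩ := hh.exists_sliceDeriv_add_eq hA hg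
        ((hh.sliceRiemann_tangent hA hg h0 x (v := v) (z := sliceDeriv hA hg x z)
          (htan x w)).2.2 (htan x z))
      rw [← hv, (hQ v' r).1, (hQ v' r).2]
    let L : EuclideanSpace ℝ (Fin n) →ₗ[ℝ] EuclideanSpace ℝ (Fin (n + 2)) := sliceDeriv hA hg x
    let W : EuclideanSpace ℝ (Fin n) →ₗ[ℝ] EuclideanSpace ℝ (Fin n) →ₗ[ℝ]
      EuclideanSpace ℝ (Fin n) →ₗ[ℝ] EuclideanSpace ℝ (Fin n) :=
      inducedTrilin (sliceRiemann hA hg h x) L Q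
    refine ⟨W, ?_, ?_⟩
    · intro ξ η ζ hξ hη hζ φ hφ
      have hj := isSmoothSection_tractorInclusion hA hg hφ
      have h1 := curvature_sliceRiemann hA hg hh h0
        (isSmoothSection_tractorConnection hh.isPseudoMetric hj hζ) hξ hη x
      have h2 := tractorConnection_tractorInclusion hA hg hh h0 hφ x (ζ x)
      have h3 := tractorConnection_tractorInclusion hA hg hh h0 hφ x (W (ξ x) (η x) (ζ x))
      have h4 (a r s : ℝ) (v w z : EuclideanSpace ℝ (Fin n)) :
          sliceRiemann hA hg h x (sliceDeriv hA hg x v) (sliceDeriv hA hg x w)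
            (a • sliceDeriv hA hg x z + r • sliceGenerator hA hg x) -
            (a • sliceDeriv hA hg x (W v w z) + s • sliceGenerator hA hg x) =
          (a * k (sliceRiemann hA hg h x (sliceDeriv hA hg x v) (sliceDeriv hA hg x w)
            (sliceDeriv hA hg x z)) - s) • sliceGenerator hA hg x := by
        have h5 := hdec (sliceDeriv hA hg x v) w z
        have h6 : W v w z = Q (sliceRiemann hA hg h x (sliceDeriv hA hg x v)
          (sliceDeriv hA hg x w) (sliceDeriv hA hg x z)) := rfl
        rw [map_add, map_smul, map_smul, hRX, smul_zero, add_zero, h6]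
        nth_rewrite 1 [h5]
        module
      exact (mem_range_tractorInclusion_iff hA hg x _).2
        ⟨_, (congrArg₂ (fun a b : EuclideanSpace ℝ (Fin (n + 2)) ↦ a - b) (h1.trans
          (congrArg (fun e ↦ sliceRiemann hA hg h x (sliceDeriv hA hg x (ξ x))
            (sliceDeriv hA hg x (η x)) e) h2)) h3).trans (h4 _ _ _ (ξ x) (η x) (ζ x))⟩
    · intro v w
      -- R(X,w) = 0 removes the generator and tangentiality of the image removes the transverse
      -- direction, so the contraction of W is Ric(Tf v, Tf w).
      have h1 := trace_inducedTrilin (R := sliceRiemann hA hg h x) (L := L) (Q := Q) (k := k)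
        (X := sliceGenerator hA hg x) (v := v) (w := w) (fun e ↦ hdec e v w)
        (hh.sliceRiemann_tangent hA hg h0 x (v := 0) (htan x v)).1
      refine Eq.trans ?_ (h1.trans ?_)
      · rfl
      · have h2 := hh.ricci_eq (u := slice hA hg x) (sliceDeriv hA hg x v) (sliceDeriv hA hg x w)
        refine Eq.trans ?_ (h2.symm.trans (hric (slice hA hg x) ⟨value hg x, rfl⟩ _ _
          (htan x v) (htan x w)))
        rfl

/-- The tractor bundle induced by an ambient metric whose Ricci curvature vanishes on tangential
vectors. -/
lemma inducesNormalTractorBundle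
    (hric : ∀ u ∈ Set.range ι, ∀ v w : TangentSpace (𝓡 (n + 2)) u,
      dualForm h u v = 0 → dualForm h u w = 0 → ricci h u v w = 0) :
    InducesNormalTractorBundle hA h := fun _ hg ↦
  ⟨isQuotientBundle hA hg hh, tractorConnection h (slice hA hg), isInducedConnection hA hg hh h0,
    isStandardTractorBundle hA hg hh h0, isNormal hA hg hh h0 hric⟩

end Normal

end AmbientTractor

end

/-! ### The theorem -/

theorem theorem2p6 {n p q : ℕ} (hn : 3 ≤ n) (hpq : p + q = n)
    {M : Type*} [TopologicalSpace M] [T2Space M] [SecondCountableTopology M]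
    [ChartedSpace (EuclideanSpace ℝ (Fin n)) M] [IsManifold (𝓡 n) ∞ M]
    (c : AmbientTractor.ConformalStructure n p q M)
    {A : Type*} [TopologicalSpace A] [T2Space A] [SecondCountableTopology A]
    [ChartedSpace (EuclideanSpace ℝ (Fin (n + 2))) A] [IsManifold (𝓡 (n + 2)) ∞ A]
    [MulAction AmbientTractor.PosReal A]
    (ι : c.RayBundle → A) (hA : AmbientTractor.IsAmbientManifold ι)
    (h : ∀ u : A, TangentSpace (𝓡 (n + 2)) u →L[ℝ] TangentSpace (𝓡 (n + 2)) u →L[ℝ] ℝ)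
    (hh : AmbientTractor.IsAmbientMetric ι h) :
    -- part (1)
    (((∀ u ∈ Set.range ι, AmbientTractor.ricci h u
          (AmbientTractor.generator u) (AmbientTractor.generator u) = 0) ↔
        ∀ u ∈ Set.range ι, ∀ w : TangentSpace (𝓡 (n + 2)) u,
          AmbientTractor.extDerivForm (AmbientTractor.dualForm h) u
            (AmbientTractor.generator u) w = 0) ∧
      ((∀ u ∈ Set.range ι, AmbientTractor.ricci h u
          (AmbientTractor.generator u) (AmbientTractor.generator u) = 0) →
        AmbientTractor.IsDefiningFunction (n := n) (Set.range ι)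
          (fun u ↦ 1 / 2 * h u (AmbientTractor.generator u) (AmbientTractor.generator u)) ∧
        ∀ (U : Set A) (Y : ∀ u : A, TangentSpace (𝓡 (n + 2)) u), IsOpen U →
          ContMDiffOn (𝓡 (n + 2)) (𝓡 (n + 2)).tangent ∞
            (fun u ↦ (⟨u, Y u⟩ : TangentBundle (𝓡 (n + 2)) A)) U →
          (∀ u ∈ U, h u (AmbientTractor.generator u) (Y u) = 1) →
          ∀ u ∈ U ∩ Set.range ι,
            (mfderiv (𝓡 (n + 2)) 𝓘(ℝ, ℝ) (fun u' : A ↦ 1 / 2 *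
              h u' (AmbientTractor.generator u') (AmbientTractor.generator u')) u (Y u) : ℝ)
                = 1)) ∧
    -- part (2)
    (((∀ u ∈ Set.range ι, ∀ w : TangentSpace (𝓡 (n + 2)) u,
          (⟨u, w⟩ : TangentBundle (𝓡 (n + 2)) A) ∈ AmbientTractor.tangentQ ι →
          AmbientTractor.ricci h u (AmbientTractor.generator u) w = 0) ↔
        ∀ u ∈ Set.range ι, ∀ v w : TangentSpace (𝓡 (n + 2)) u,
          AmbientTractor.extDerivForm (AmbientTractor.dualForm h) u v w = 0) ∧
      ((∀ u ∈ Set.range ι, ∀ v w : TangentSpace (𝓡 (n + 2)) u,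
          (⟨u, v⟩ : TangentBundle (𝓡 (n + 2)) A) ∈ AmbientTractor.tangentQ ι →
          (⟨u, w⟩ : TangentBundle (𝓡 (n + 2)) A) ∈ AmbientTractor.tangentQ ι →
          AmbientTractor.ricci h u v w = 0) →
        AmbientTractor.InducesNormalTractorBundle hA h)) := by
  open AmbientTractor in
  have hn0 : 0 < n := by omega
  have h1 : (∀ u ∈ Set.range ι, ricci h u (generator u) (generator u) = 0) ↔
      ∀ u ∈ Set.range ι, ∀ w : TangentSpace (𝓡 (n + 2)) u,
        extDerivForm (dualForm h) u (generator u) w = 0 :=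
    forall₂_congr fun u hu ↦ hh.ricci_generator_eq_zero_iff hA hn0 hu
  have h2 : (∀ u ∈ Set.range ι, ∀ w : TangentSpace (𝓡 (n + 2)) u,
      (⟨u, w⟩ : TangentBundle (𝓡 (n + 2)) A) ∈ tangentQ ι → ricci h u (generator u) w = 0) ↔
      ∀ u ∈ Set.range ι, ∀ v w : TangentSpace (𝓡 (n + 2)) u,
        extDerivForm (dualForm h) u v w = 0 := by
    rw [← hh.ricci_tangent_eq_zero_iff hA hn0]
    exact forall₂_congr fun u hu ↦ forall_congr' fun w ↦ by rw [hh.mem_tangentQ_iff hA hu]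
  refine ⟨⟨h1, fun hX ↦ ⟨hh.isDefiningFunction hA (h1.1 hX), ?_⟩⟩, h2, fun hric ↦ ?_⟩
  · intro U Y _ _ hY u hu
    exact (hh.mfderiv_halfSq_eq hA (h1.1 hX u hu.2) (Y u)).trans (hY u hu.1)
  -- X is tangential, so the vanishing of the tangential Ricci components includes that of Ric(X,·)
  -- and forces dα = 0 along 𝒬.
  · refine inducesNormalTractorBundle hA hh (h2.1 fun u hu w hw ↦ hric u hu _ _ ?_ hw) ?_
    · exact (hh.mem_tangentQ_iff hA hu _).2 (hh.dualForm_generator hA hu)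
    · intro u hu v w hv hw
      exact hric u hu v w ((hh.mem_tangentQ_iff hA hu v).2 hv) ((hh.mem_tangentQ_iff hA hu w).2 hw)
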